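/- **Setting.** Let $n\ge 0$, $\omega,\nu>0$, let $\alpha,\beta:[0,1]\to[0,\infty)$ be $C^1$ with $\alpha+\beta>0$, and let $p_{\rm data}$ be a probability measure on $\mathbb R^n$ with finite second moment. Let $q=\mathcal N(0,\omega^2I)$, $p(\bar x\mid x)=\mathcal N(\bar x;x,\nu^2I)$, $h(x\mid\bar x,t)=\alpha(t)\log q(x)+\beta(t)\log p(\bar x\mid x)$, and for $t\in[0,1]$ $$\rho(x\mid\bar x,t)=\frac{e^{h(x\mid\bar x,t)}}{\int_{\mathbb R^n}e^{h(x'\mid\bar x,t)}\,dx'},\qquad \bar\rho(x,t)=\mathbb E_{\bar x\sim p_{\rm data}}\big[\rho(x\mid\bar x,t)\big],$$ $$\gamma(x,\bar x,t)=\frac{\dot\alpha(t)}{\omega^2}\|x\|^2+\frac{\dot\beta(t)}{\nu^2}\|x-\bar x\|^2,\qquad \bar\gamma(\bar x,t)=\int_{\mathbb R^n}\rho(x\mid\bar x,t)\,\gamma(x,\bar x,t)\,dx .$$ Write $H^1_0(\mathbb R^n,\bar\rho(\cdot,t))$ for the closure of $C_c^\infty(\mathbb R^n)$ in the $H^1$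 norm weighted by $\bar\rho(\cdot,t)$. A $C^2$ function $\varphi$ *solves the density-weighted Poisson equation at time $t$* if on $\mathbb R^n$ $$\nabla\cdot\big(\bar\rho(\cdot,t)\nabla\varphi\big)=\tfrac12\,\mathbb E_{\bar x\sim p_{\rm data}}\big[\rho(\cdot\mid\bar x,t)\,(\gamma(\cdot,\bar x,t)-\bar\gamma(\bar x,t))\big].\tag{P}$$ **(a) First-order optimality of one step.** Let $t\in[0,1)$ and let $\varphi\in C^2\cap H^1_0(\mathbb R^n,\bar\rho(\cdot,t))$ be such that for all sufficiently small $\Delta>0$ the forward Euler map $T_\Delta(x)=x+\Delta\nabla\varphi(x)$ is a bijection of $\mathbb R^n$ with differentiable inverse and $\mathrm{KL}[(T_\Delta)_\#\bar\rho(\cdot,t)\,\|\,\bar\rho(\cdot,t+\Delta)]<\infty$. Then $\varphi$ solves (P) at time $t$ if and only if for every vector field $\eta\in C_c^\infty(\mathbb R^n;\mathbb R^n)$ the first variation $$\delta_\Delta(\eta)=\frac{d}{d\varepsilon}\Big|_{\varepsilon=0}\mathrm{KL}\big[(T_\Delta+\varepsilon\eta)_\#\bar\rho(\cdot,t)\,\big\|\,\bar\rho(\cdot,t+\Delta)\big]$$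 exists for all sufficiently small $\Delta>0$ (the divergence being finite for $\varepsilon$ near $0$), and $\delta_\Delta(\eta)=o(\Delta)$ as $\Delta\downarrow0$. **(b) Minimization along the flow.** A *potential flow* is a pair $(\Phi,X)$ such that $\Phi(\cdot,t)\in C^2\cap H^1_0(\mathbb R^n,\bar\rho(\cdot,t))$ for each $t\in[0,1]$, $\nabla_x\Phi$ and $\nabla_x^2\Phi$ are continuous on $\mathbb R^n\times[0,1]$, and $X(x,0)=x$, $\frac{d}{dt}X(x,t)=\nabla_x\Phi(X(x,t),t)$ for all $x\in\mathbb R^n$ and $t\in[0,1]$. Its flow-driven homotopy $\rho_\Phi(\cdot,t)$ is the law of $X(x,t)$ when $x$ has law $\bar\rho(\cdot,0)$. For every potential flow $(\Phi,X)$: 1. $\Phi(\cdot,t)$ solves (P) at every $t\in[0,1]$ if and only if $\rho_\Phi(\cdot,t)=\bar\rho(\cdot,t)$ for every $t\in[0,1]$; 2. if $\Phi(\cdot,t)$ solves (P) at every $t\in[0,1]$, then for every $t\in[0,1]$ it minimizes $\mathrm{KL}[\rho_\Phi(\cdot,t)\,\|\,\bar\rho(\cdot,t)]$ among all potential flows;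 3. conversely, provided that some potential flow solves (P) at every $t\in[0,1]$, if for every $t\in[0,1]$ $(\Phi,X)$ minimizes $\mathrm{KL}[\rho_\Phi(\cdot,t)\,\|\,\bar\rho(\cdot,t)]$ among all potential flows, then $\Phi(\cdot,t)$ solves (P) at every $t\in[0,1]$. -/

import Mathlib

open MeasureTheory Filter Topology InformationTheory Set
open scoped ENNReal

noncomputable section

namespace VPFB

/-- The sample space `ℝⁿ` with its Euclidean norm. -/
abbrev E (n : ℕ) : Type := EuclideanSpace ℝ (Fin n)

/-- Density at `x` of the isotropic Gaussian `N(m, s² I)` on `ℝⁿ`. -/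
def gaussianDensity {n : ℕ} (m : E n) (s : ℝ) (x : E n) : ℝ :=
  (2 * Real.pi * s ^ 2) ^ (-(n : ℝ) / 2) * Real.exp (-‖x - m‖ ^ 2 / (2 * s ^ 2))

/-- Parameters of the homotopy: the standard deviation `ω` of the prior, the standard deviation
`ν` of the conditional data likelihood, the schedules `α`, `β`, and the data distribution. -/
structure Params (n : ℕ) where
  ω : ℝ
  ν : ℝ
  α : ℝ → ℝ
  β : ℝ → ℝ
  pdata : Measure (E n)

/-- Conditions on the parameters under which the homotopy is defined on the whole of `[0, 1]`. -/
structure Params.Valid {n : ℕ} (P : Params n) : Prop where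
  ω_pos : 0 < P.ω
  ν_pos : 0 < P.ν
  α_smooth : ContDiffOn ℝ 1 P.α (Icc 0 1)
  β_smooth : ContDiffOn ℝ 1 P.β (Icc 0 1)
  α_nonneg : ∀ t ∈ Icc (0 : ℝ) 1, 0 ≤ P.α t
  β_nonneg : ∀ t ∈ Icc (0 : ℝ) 1, 0 ≤ P.β t
  sum_pos : ∀ t ∈ Icc (0 : ℝ) 1, 0 < P.α t + P.β t
  prob : IsProbabilityMeasure P.pdata
  moment : Integrable (fun y => ‖y‖ ^ 2) P.pdata

namespace Params

variable {n : ℕ} (P : Params n)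

/-- `h(x | x̄, t) = α(t) log q(x) + β(t) log p(x̄ | x)`. -/
def logHomotopy (x xbar : E n) (t : ℝ) : ℝ :=
  P.α t * Real.log (gaussianDensity 0 P.ω x) + P.β t * Real.log (gaussianDensity x P.ν xbar)

/-- The conditional homotopy `ρ(x | x̄, t) = exp h(x | x̄, t) / ∫ exp h(x' | x̄, t) dx'`. -/
def condDensity (x xbar : E n) (t : ℝ) : ℝ :=
  Real.exp (P.logHomotopy x xbar t) / ∫ x', Real.exp (P.logHomotopy x' xbar t)

/-- The marginal homotopy `ρ̄(x, t)`. -/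
def marginalDensity (x : E n) (t : ℝ) : ℝ :=
  ∫ xbar, P.condDensity x xbar t ∂P.pdata

/-- The probability law with density `ρ̄(·, t)`. -/
def marginalLaw (t : ℝ) : Measure (E n) :=
  volume.withDensity fun x => ENNReal.ofReal (P.marginalDensity x t)

/-- The innovation `γ(x, x̄, t)`. -/
def innovation (x xbar : E n) (t : ℝ) : ℝ :=
  derivWithin P.α (Icc 0 1) t / P.ω ^ 2 * ‖x‖ ^ 2 +
    derivWithin P.β (Icc 0 1) t / P.ν ^ 2 * ‖x - xbar‖ ^ 2

/-- The expectation `γ̄` of the innovation under `ρ(· | x̄, t)`. -/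
def meanInnovation (xbar : E n) (t : ℝ) : ℝ :=
  ∫ x, P.condDensity x xbar t * P.innovation x xbar t

/-- The right-hand side `½ E_{p_data}[ρ(x | x̄, t) (γ - γ̄)]` of the Poisson equation. -/
def source (x : E n) (t : ℝ) : ℝ :=
  1 / 2 * ∫ xbar, P.condDensity x xbar t *
    (P.innovation x xbar t - P.meanInnovation xbar t) ∂P.pdata

end Params

/-- The divergence of a vector field. -/
def divergence {n : ℕ} (F : E n → E n) (x : E n) : ℝ :=
  LinearMap.trace ℝ (E n) (fderiv ℝ F x : E n →ₗ[ℝ] E n)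

/-- Membership of a differentiable function in the weighted Sobolev space `H¹₀(ℝⁿ, m)`, the
closure of the smooth compactly supported functions in the weighted `H¹` norm. -/
structure MemH10 {n : ℕ} (m : Measure (E n)) (φ : E n → ℝ) : Prop where
  differentiable : Differentiable ℝ φ
  memLp : MemLp φ 2 m
  memLp_gradient : MemLp (gradient φ) 2 m
  approx : ∃ ψ : ℕ → E n → ℝ,
    (∀ k, ContDiff ℝ (⊤ : ℕ∞) (ψ k) ∧ HasCompactSupport (ψ k)) ∧
    Tendsto (fun k => eLpNorm (fun x => φ x - ψ k x) 2 m) atTop (𝓝 0) ∧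
    Tendsto (fun k => eLpNorm (fun x => gradient φ x - gradient (ψ k) x) 2 m) atTop (𝓝 0)

/-- `φ` solves the density-weighted Poisson equation
`∇ · (ρ̄(·, t) ∇φ) = ½ E_{p_data}[ρ(· | x̄, t) (γ - γ̄)]`. -/
def SolvesPoisson {n : ℕ} (P : Params n) (t : ℝ) (φ : E n → ℝ) : Prop :=
  ∀ x, divergence (fun y => P.marginalDensity y t • gradient φ y) x = P.source x t

/-- One forward Euler step of length `Δ` for `dx/dt = ∇φ(x)`. -/
def eulerStep {n : ℕ} (φ : E n → ℝ) (Δ : ℝ) (x : E n) : E n :=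
  x + Δ • gradient φ x

/-- The divergence `KL[(α + ε η)_# ρ̄(·, t) ‖ ρ̄(·, t + Δ)]`, where `α` is the Euler step of length
`Δ` and `η` is a vector field. -/
def stepKL {n : ℕ} (P : Params n) (t : ℝ) (φ : E n → ℝ) (η : E n → E n) (Δ ε : ℝ) : ℝ≥0∞ :=
  klDiv ((P.marginalLaw t).map fun x => eulerStep φ Δ x + ε • η x) (P.marginalLaw (t + Δ))

/-- Potentials for which the one-step problem at time `t` makes sense: for small step lengths the
Euler step is a bijection with differentiable inverse and the divergence is finite. -/
structure StepAdmissible {n : ℕ} (P : Params n) (t : ℝ) (φ : E n → ℝ) : Prop where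
  smooth : ContDiff ℝ 2 φ
  memH10 : MemH10 (P.marginalLaw t) φ
  diffeo : ∀ᶠ Δ in 𝓝[>] (0 : ℝ), ∃ g : E n → E n, Differentiable ℝ g ∧
    Function.LeftInverse g (eulerStep φ Δ) ∧ Function.RightInverse g (eulerStep φ Δ)
  finite : ∀ᶠ Δ in 𝓝[>] (0 : ℝ), stepKL P t φ 0 Δ 0 ≠ ∞

/-- First-order optimality at time `t`: for every trial field `η` the first variation `δ Δ` of the
divergence after one step of length `Δ` exists for small `Δ > 0`, and vanishes to first order
in `Δ`. -/
def FirstOrderOptimal {n : ℕ} (P : Params n) (t : ℝ) (φ : E n → ℝ) : Prop :=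
  ∀ η : E n → E n, ContDiff ℝ (⊤ : ℕ∞) η → HasCompactSupport η →
    ∃ δ : ℝ → ℝ,
      (∀ᶠ Δ in 𝓝[>] (0 : ℝ), (∀ᶠ ε in 𝓝 (0 : ℝ), stepKL P t φ η Δ ε ≠ ∞) ∧
        HasDerivAt (fun ε => (stepKL P t φ η Δ ε).toReal) (δ Δ) 0) ∧
      Tendsto (fun Δ => δ Δ / Δ) (𝓝[>] 0) (𝓝 0)

/-- `X x t` is the position at time `t ∈ [0, 1]` of the particle that starts at `x` and follows
`dx/dt = ∇ₓΦ(x, t)`, where `Φ(·, t) ∈ H¹₀(ℝⁿ, ρ̄(·, t))` is twice continuously differentiable. -/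
structure IsPotentialFlow {n : ℕ} (P : Params n) (Φ : E n → ℝ → ℝ) (X : E n → ℝ → E n) :
    Prop where
  smooth : ∀ t ∈ Icc (0 : ℝ) 1, ContDiff ℝ 2 fun x => Φ x t
  continuous_gradient :
    ContinuousOn (fun z : E n × ℝ => gradient (fun x => Φ x z.2) z.1) (univ ×ˢ Icc 0 1)
  continuous_hessian :
    ContinuousOn (fun z : E n × ℝ => fderiv ℝ (gradient fun x => Φ x z.2) z.1)
      (univ ×ˢ Icc 0 1)
  memH10 : ∀ t ∈ Icc (0 : ℝ) 1, MemH10 (P.marginalLaw t) fun x => Φ x t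
  start : ∀ x, X x 0 = x
  ode : ∀ x, ∀ t ∈ Icc (0 : ℝ) 1,
    HasDerivWithinAt (X x) (gradient (fun y => Φ y t) (X x t)) (Icc 0 1) t

/-- The flow-driven homotopy `ρ_Φ(·, t)`: the law at time `t` of particles that start with law
`ρ̄(·, 0)` and follow the flow `X`. -/
def flowLaw {n : ℕ} (P : Params n) (X : E n → ℝ → E n) (t : ℝ) : Measure (E n) :=
  (P.marginalLaw 0).map fun x => X x t

/-- The flow `X` minimizes `KL[ρ_Φ(·, t) ‖ ρ̄(·, t)]` among all potential flows. -/
def MinimizesKL {n : ℕ} (P : Params n) (X : E n → ℝ → E n) (t : ℝ) : Prop :=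
  ∀ (Ψ : E n → ℝ → ℝ) (Y : E n → ℝ → E n), IsPotentialFlow P Ψ Y →
    klDiv (flowLaw P X t) (P.marginalLaw t) ≤ klDiv (flowLaw P Y t) (P.marginalLaw t)

end VPFB

end

/-! Completing the square turns the conditional homotopy into a Gaussian in a standardized variable:
ρ(x | y, t) = uⁿ g(u x − v y), with g the standard Gaussian density, u² = α/ω² + β/ν² and u v = β/ν²
(`condDensity_eq`). Hence ρ̄(x, t) = uⁿ S(u x, v), where S(z, s) is the mean of g(z − s y) over the
data. Second moments make S of class C² in (z, s), while x ↦ ρ̄(x, t) is smooth. In these variables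
−½(γ − γ̄) is the time derivative of log ρ(x | y, t), so the right-hand side of (P) is −∂ₜρ̄
(`source_eq`): (P) is the continuity equation for ρ̄ with velocity V = ∇φ. Dividing by ρ̄ > 0, it
says that the residual r = div V + ∇log ρ̄ · V + ∂ₜ log ρ̄ vanishes.

Part (b). By Liouville's formula, log ρ̄(X(x, t), t) + log |det DX(x, t)| has time derivative r
along a trajectory (`marginalDensity_mul_det`). If r = 0, the change of variables formula identifies
the transported law with ρ̄. Conversely, if the laws agree, differentiating the mean of a test
function both through the flow and through the density gives (P) weakly, and pointwise because both
sides are continuous. A solving flow has divergence 0, which is the least possible value and is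
attained only by equality of the laws; this gives both statements on minimization.

Part (a). After a change of variables the divergence is the mean under ρ̄(·, t) of log ρ̄(x, t) −
log |det D(T + εη)| − log ρ̄(T + εη, t + Δ), where T is the Euler map. Its ε-derivative at 0 is
minus the mean of tr(Dη (DT)⁻¹) + ∇log ρ̄(T, t + Δ) · η (`hasDerivAt_klDiv_perturbation`). For Δ = 0
this is the integral of −div(ρ̄η), which is zero. The next order in Δ, after integration by parts,
is ∫ r div(ρ̄η) (`integral_stepVariation_deriv`). First-order optimality therefore means that r is
orthogonal to div(ρ̄η) for every test field η. As ρ̄ is smooth and positive, ρ̄η is an arbitrary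
test field, so r is a constant c. Then div(ρ̄V) equals the source plus cρ̄, which has total integral
c, while the flux of the integrable field ρ̄V through infinity vanishes; hence c = 0
(`eq_zero_of_residual_eq`). -/

noncomputable section

namespace VPFB

/-! ### Differentiation under the integral sign -/

/-- Differentiation under the integral sign, for a family with a globally dominated derivative. -/
theorem hasFDerivAt_integral_of_contDiff {Y V F : Type*}
    [NormedAddCommGroup Y] [NormedSpace ℝ Y] [MeasurableSpace Y] [BorelSpace Y]
    [SecondCountableTopology Y] [NormedAddCommGroup V] [NormedSpace ℝ V]
    [NormedAddCommGroup F] [NormedSpace ℝ F] {μ : Measure Y} {h : Y → V → F} {B₀ B₁ : Y → ℝ}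
    (hh : ContDiff ℝ 1 (Function.uncurry h)) (hB₀ : Integrable B₀ μ) (hB₁ : Integrable B₁ μ)
    (hb₀ : ∀ y z, ‖h y z‖ ≤ B₀ y) (hb₁ : ∀ y z, ‖fderiv ℝ (h y) z‖ ≤ B₁ y) (z : V) :
    HasFDerivAt (fun z => ∫ y, h y z ∂μ) (∫ y, fderiv ℝ (h y) z ∂μ) z := by
  have hc : ∀ z, Continuous fun y => h y z := fun z =>
    hh.continuous.comp (Continuous.prodMk_left z)
  have hd : ∀ y, Differentiable ℝ (h y) := fun y =>
    (hh.comp (contDiff_prodMk_right y)).differentiable one_ne_zero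
  refine hasFDerivAt_integral_of_dominated_of_fderiv_le (F' := fun z y => fderiv ℝ (h y) z)
    (bound := B₁) univ_mem ?_ ?_ ?_ ?_ hB₁ ?_
  · exact Eventually.of_forall fun z => (hc z).aestronglyMeasurable
  · exact hB₀.mono' (hc z).aestronglyMeasurable (Eventually.of_forall fun y => hb₀ y z)
  · have : ContDiff ℝ 0 fun y => fderiv ℝ (h y) z :=
      ContDiff.fderiv (m := 1) hh contDiff_const (by simp)
    exact this.continuous.aestronglyMeasurable
  · exact Eventually.of_forall fun y z _ => hb₁ y z
  · exact Eventually.of_forall fun y z _ => (hd y z).hasFDerivAt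

/-- An integral of `C^k` functions depending on a parameter is `C^k` if the derivatives of order
at most `k` are dominated by integrable functions. -/
theorem contDiff_integral_of_dominated.{u} {Y : Type*} {V : Type u}
    [NormedAddCommGroup Y] [NormedSpace ℝ Y] [MeasurableSpace Y] [BorelSpace Y]
    [SecondCountableTopology Y] [NormedAddCommGroup V] [NormedSpace ℝ V]
    {μ : Measure Y} (k : ℕ) {F : Type u} [NormedAddCommGroup F] [NormedSpace ℝ F]
    {h : Y → V → F} {B : ℕ → Y → ℝ}
    (hh : ContDiff ℝ k (Function.uncurry h)) (hB : ∀ i ≤ k, Integrable (B i) μ)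
    (hb : ∀ i ≤ k, ∀ y z, ‖iteratedFDeriv ℝ i (h y) z‖ ≤ B i y) :
    ContDiff ℝ k fun z => ∫ y, h y z ∂μ := by
  induction k generalizing F B with
  | zero =>
    rw [Nat.cast_zero, contDiff_zero] at *
    refine MeasureTheory.continuous_of_dominated (bound := B 0) ?_ ?_ (hB 0 le_rfl) ?_
    · exact fun z => (hh.comp (Continuous.prodMk_left z)).aestronglyMeasurable
    · exact fun z => Eventually.of_forall fun y => by simpa using hb 0 le_rfl y z
    · exact Eventually.of_forall fun y => hh.comp (Continuous.prodMk_right y)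
  | succ k ih =>
    push_cast at hh ⊢
    rw [contDiff_succ_iff_hasFDerivAt]
    refine ⟨fun z => ∫ y, fderiv ℝ (h y) z ∂μ, ?_, fun z => ?_⟩
    -- The induction hypothesis is applied to the family of derivatives, with values in `V →L[ℝ] F`;
    -- this is why `V` and `F` share a universe and why the bounds shift by one.
    · refine ih (B := fun i => B (i + 1)) ?_ (fun i hi => hB _ (by omega)) fun i hi y z => ?_
      · refine ContDiff.fderiv (f := fun p : Y × V => h p.1) (g := fun p : Y × V => p.2)
          (m := k + 1) ?_ contDiff_snd le_rfl
        exact hh.comp ((contDiff_fst.comp contDiff_fst).prodMk contDiff_snd)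
      · rw [norm_iteratedFDeriv_fderiv]
        exact hb _ (by omega) y z
    · refine hasFDerivAt_integral_of_contDiff (hh.of_le (by simp)) (hB 0 (by omega))
        (hB 1 (by omega)) (fun y z => by simpa using hb 0 (by omega) y z) (fun y z => ?_) z
      have := hb 1 (by omega) y z
      rwa [← zero_add 1, ← norm_iteratedFDeriv_fderiv, norm_iteratedFDeriv_zero] at this

/-- Differentiation under the integral sign within a compact interval. -/
theorem hasDerivWithinAt_integral {α : Type*} [MeasurableSpace α] {μ : Measure α}
    {F F' : ℝ → α → ℝ} {bound : α → ℝ} {a b t : ℝ} (ht : t ∈ Icc a b)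
    (hF : ∀ s ∈ Icc a b, Integrable (F s) μ)
    (hF' : ∀ᵐ x ∂μ, ∀ s ∈ Icc a b, HasDerivWithinAt (fun s => F s x) (F' s x) (Icc a b) s)
    (hb : ∀ᵐ x ∂μ, ∀ s ∈ Icc a b, ‖F' s x‖ ≤ bound x) (hbound : Integrable bound μ) :
    HasDerivWithinAt (fun s => ∫ x, F s x ∂μ) (∫ x, F' t x ∂μ) (Icc a b) t := by
  rw [hasDerivWithinAt_iff_tendsto_slope]
  have hev : ∀ᶠ s in 𝓝[Icc a b \ {t}] t, s ∈ Icc a b \ {t} := self_mem_nhdsWithin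
  -- The mean value inequality bounds every difference quotient at `t` by `bound`, so dominated
  -- convergence applies to the slopes.
  have key : Tendsto (fun s => ∫ x, slope (fun s => F s x) t s ∂μ) (𝓝[Icc a b \ {t}] t)
      (𝓝 (∫ x, F' t x ∂μ)) := by
    refine tendsto_integral_filter_of_dominated_convergence bound ?_ ?_ hbound ?_
    · filter_upwards [hev] with s hs
      simp only [slope_def_module]
      exact (((hF s hs.1).sub (hF t ht)).smul (s - t)⁻¹).aestronglyMeasurable
    · filter_upwards [hev] with s hs
      filter_upwards [hF', hb] with x hx hx'
      have := Convex.norm_image_sub_le_of_norm_hasDerivWithin_le hx hx' (convex_Icc a b) ht hs.1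
      have h0 : 0 < ‖s - t‖ := norm_pos_iff.2 (sub_ne_zero.2 hs.2)
      rw [slope_def_module, norm_smul, norm_inv, inv_mul_le_iff₀ h0, mul_comm]
      exact this
    · filter_upwards [hF'] with x hx
      exact hasDerivWithinAt_iff_tendsto_slope.1 (hx t ht)
  refine key.congr' ?_
  filter_upwards [hev] with s hs
  simp only [slope_def_module]
  rw [integral_smul, integral_sub (hF s hs.1) (hF t ht)]

/-! ### Determinants -/

section Det

variable {V : Type*} [NormedAddCommGroup V] [NormedSpace ℝ V] [FiniteDimensional ℝ V]

/-- In a basis the Leibniz expansion makes the determinant a polynomial in matrix entries, which are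
linear in `A`. -/
theorem differentiable_det : Differentiable ℝ fun A : V →L[ℝ] V => A.det := by
  classical
  let b := Module.finBasis ℝ V
  have h : (fun A : V →L[ℝ] V => A.det) = fun A =>
      ∑ σ : Equiv.Perm (Fin (Module.finrank ℝ V)), Equiv.Perm.sign σ •
        ∏ i, b.repr (A (b i)) (σ i) := by
    ext A
    rw [ContinuousLinearMap.det, ← LinearMap.det_toMatrix b, Matrix.det_apply]
    simp [LinearMap.toMatrix_apply]
  have hlin : ∀ i j, Differentiable ℝ fun A : V →L[ℝ] V => b.repr (A (b i)) j := fun i j =>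
    ((LinearMap.toContinuousLinearMap (b.coord j)).comp
      (ContinuousLinearMap.apply ℝ V (b i))).differentiable
  rw [h]
  refine Differentiable.fun_sum fun σ _ => Differentiable.const_smul ?_ _
  exact fun A => (HasFDerivAt.finsetProd (u := Finset.univ)
    fun i _ => (hlin i (σ i) A).hasFDerivAt).differentiableAt

theorem hasDerivAt_det_one_add_smul (C : V →L[ℝ] V) :
    HasDerivAt (fun ε : ℝ => (1 + ε • C).det) (LinearMap.trace ℝ V (C : V →ₗ[ℝ] V)) 0 := by
  classical
  let b := Module.finBasis ℝ V
  let M := LinearMap.toMatrix b b (C : V →ₗ[ℝ] V)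
  -- Removing the constant and linear coefficients of det(1 + X M) leaves `q`, so the remainder
  -- after 1 + ε tr M is ε² q(ε).
  let q := (1 + (Polynomial.X : Polynomial ℝ) • M.map Polynomial.C).det.divX.divX
  have h : (fun ε : ℝ => (1 + ε • C).det) = fun ε => 1 + M.trace * ε + q.eval ε * ε ^ 2 := by
    ext ε
    rw [← Matrix.det_one_add_smul, ContinuousLinearMap.det, ← LinearMap.det_toMatrix b]
    simp [M, map_add]
  rw [h, LinearMap.trace_eq_matrix_trace ℝ b]
  have h1 : HasDerivAt (fun ε : ℝ => 1 + M.trace * ε) M.trace 0 := by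
    simpa using ((hasDerivAt_id (0 : ℝ)).const_mul M.trace).const_add 1
  have h2 := (q.hasDerivAt 0).mul (hasDerivAt_pow 2 (0 : ℝ))
  have h3 := h1.add h2
  simp only [ne_eq, OfNat.ofNat_ne_zero, not_false_eq_true, zero_pow, mul_zero, Nat.cast_ofNat,
    Nat.add_one_sub_one, pow_one, add_zero] at h3
  exact h3

/-- Jacobi's formula for the derivative of the determinant at an invertible operator. -/
theorem fderiv_det_apply {A K : V →L[ℝ] V} (hK : A * K = 1) (B : V →L[ℝ] V) :
    fderiv ℝ (fun A : V →L[ℝ] V => A.det) A B =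
      A.det * LinearMap.trace ℝ V ((B * K : V →L[ℝ] V) : V →ₗ[ℝ] V) := by
  have hK' : K * A = 1 := by
    have h : (A : V →ₗ[ℝ] V) * (K : V →ₗ[ℝ] V) = 1 :=
      LinearMap.ext fun x => DFunLike.congr_fun hK x
    ext x
    exact LinearMap.congr_fun (mul_eq_one_comm.1 h) x
  have h1 : HasDerivAt (fun ε : ℝ => (A + ε • B).det)
      (fderiv ℝ (fun A : V →L[ℝ] V => A.det) A B) 0 := by
    have hl : HasDerivAt (fun ε : ℝ => A + ε • B) B 0 := by
      simpa using ((hasDerivAt_id (0 : ℝ)).smul_const B).const_add A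
    have hd := (differentiable_det (V := V) A).hasFDerivAt
    exact hd.comp_hasDerivAt_of_eq (0 : ℝ) hl (by simp)
  -- Factoring out `A` reduces the derivative at `A` to the derivative at the identity.
  have h2 : (fun ε : ℝ => (A + ε • B).det) = fun ε => (1 + ε • (B * K)).det * A.det := by
    ext ε
    have : A + ε • B = (1 + ε • (B * K)) * A := by
      rw [add_mul, one_mul, smul_mul_assoc, mul_assoc, hK', mul_one]
    rw [this]
    exact map_mul LinearMap.det _ _
  rw [h2] at h1
  rw [h1.unique ((hasDerivAt_det_one_add_smul (B * K)).mul_const A.det), mul_comm]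

theorem det_ne_zero_of_mul_eq_one {V : Type*} [NormedAddCommGroup V] [NormedSpace ℝ V]
    {A K : V →L[ℝ] V} (hK : A * K = 1) : A.det ≠ 0 := by
  have : A.det * K.det = 1 := by
    have h := congrArg (fun f : V →L[ℝ] V => f.det) hK
    have h1 : (A * K).det = A.det * K.det := map_mul LinearMap.det _ _
    have h2 : (1 : V →L[ℝ] V).det = 1 := map_one LinearMap.det
    simp only [h1, h2] at h
    exact h
  exact left_ne_zero_of_mul_eq_one this

/-- The logarithmic derivative of the determinant along a curve of invertible operators. -/
theorem hasDerivWithinAt_log_det {J : ℝ → V →L[ℝ] V} {J' K : V →L[ℝ] V} {s : Set ℝ} {t : ℝ}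
    (hJ : HasDerivWithinAt J J' s t) (hK : J t * K = 1) :
    HasDerivWithinAt (fun s => Real.log (J s).det)
      (LinearMap.trace ℝ V ((J' * K : V →L[ℝ] V) : V →ₗ[ℝ] V)) s t := by
  -- `Real.log` is log |·|, so only nonvanishing of the determinant matters and orientation is never
  -- tracked.
  have h0 := det_ne_zero_of_mul_eq_one hK
  have h1 := (differentiable_det (V := V) (J t)).hasFDerivAt.comp_hasDerivWithinAt t hJ
  rw [fderiv_det_apply hK] at h1
  have h2 := h1.log h0
  simpa only [Function.comp_apply, mul_div_cancel_left₀ _ h0] using h2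

end Det

/-! ### Integration by parts -/

section Parts

variable {n : ℕ}

theorem continuous_trace_clm {V : Type*} [NormedAddCommGroup V] [NormedSpace ℝ V]
    [FiniteDimensional ℝ V] :
    Continuous fun A : V →L[ℝ] V => LinearMap.trace ℝ V (A : V →ₗ[ℝ] V) :=
  LinearMap.continuous_of_finiteDimensional
    ((LinearMap.trace ℝ V).comp (ContinuousLinearMap.coeLM ℝ))

/-- The trace as a continuous linear functional on operators. -/
def traceCLM (n : ℕ) : (E n →L[ℝ] E n) →L[ℝ] ℝ :=
  ⟨(LinearMap.trace ℝ (E n)).comp (ContinuousLinearMap.coeLM ℝ), continuous_trace_clm⟩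

theorem traceCLM_apply (A : E n →L[ℝ] E n) :
    traceCLM n A = LinearMap.trace ℝ (E n) (A : E n →ₗ[ℝ] E n) := rfl

theorem divergence_eq_traceCLM (F : E n → E n) (x : E n) :
    divergence F x = traceCLM n (fderiv ℝ F x) := rfl

theorem traceCLM_mul_comm (A B : E n →L[ℝ] E n) : traceCLM n (A * B) = traceCLM n (B * A) :=
  LinearMap.trace_mul_comm ℝ (A : E n →ₗ[ℝ] E n) (B : E n →ₗ[ℝ] E n)

theorem traceCLM_smulRight (l : E n →L[ℝ] ℝ) (w : E n) :
    traceCLM n (l.smulRight w) = l w := by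
  have := LinearMap.trace_smulRight (R := ℝ) (M := E n) (l : E n →ₗ[ℝ] ℝ) w
  exact this

theorem divergence_eq_sum {F : E n → E n} {x : E n} (hF : DifferentiableAt ℝ F x) :
    divergence F x = ∑ i, fderiv ℝ (fun y => F y i) x (EuclideanSpace.single i 1) := by
  rw [divergence, LinearMap.trace_eq_sum_inner _ (EuclideanSpace.basisFun (Fin n) ℝ)]
  refine Finset.sum_congr rfl fun i _ => ?_
  have h : HasFDerivAt (fun y => F y i)
      ((EuclideanSpace.proj i : E n →L[ℝ] ℝ).comp (fderiv ℝ F x)) x :=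
    (EuclideanSpace.proj i : E n →L[ℝ] ℝ).hasFDerivAt.comp x hF.hasFDerivAt
  rw [h.fderiv]
  simp [EuclideanSpace.inner_single_left]

theorem continuous_divergence {F : E n → E n} (hF : ContDiff ℝ 1 F) :
    Continuous (divergence F) :=
  (traceCLM n).continuous.comp (hF.continuous_fderiv one_ne_zero)

/-- Each coordinate derivative is integrated by parts against the constant function 1. -/
theorem integral_divergence_eq_zero {F : E n → E n} (hF : ContDiff ℝ 1 F)
    (hc : HasCompactSupport F) : ∫ x, divergence F x = 0 := by
  have hi : ∀ i, ContDiff ℝ 1 fun y => F y i := fun i =>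
    (EuclideanSpace.proj i : E n →L[ℝ] ℝ).contDiff.comp hF
  have hci : ∀ i, HasCompactSupport fun y => F y i := fun i =>
    hc.comp_left (g := fun z : E n => z i) rfl
  have hint : ∀ i, Integrable
      (fun x => fderiv ℝ (fun y => F y i) x (EuclideanSpace.single i 1)) (volume : Measure (E n)) :=
    fun i => (((hi i).continuous_fderiv one_ne_zero).clm_apply
      continuous_const).integrable_of_hasCompactSupport ((hci i).fderiv_apply ℝ _)
  simp_rw [divergence_eq_sum (hF.differentiable one_ne_zero _)]
  rw [integral_finsetSum _ fun i _ => hint i]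
  refine Finset.sum_eq_zero fun i _ => ?_
  have := integral_mul_fderiv_eq_neg_fderiv_mul_of_integrable (μ := (volume : Measure (E n)))
    (f := fun _ : E n => (1 : ℝ)) (g := fun y => F y i) (v := EuclideanSpace.single i 1)
    (by simp) (by simpa using hint i)
    (by simpa using (hi i).continuous.integrable_of_hasCompactSupport (hci i))
    (fun x _ => differentiableAt_const _)
    (fun x _ => (hi i).differentiable one_ne_zero x)
  simpa using this

theorem divergence_smul {f : E n → ℝ} {ξ : E n → E n} {x : E n}
    (hf : DifferentiableAt ℝ f x) (hξ : DifferentiableAt ℝ ξ x) :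
    divergence (fun y => f y • ξ y) x = f x * divergence ξ x + fderiv ℝ f x (ξ x) := by
  rw [divergence_eq_traceCLM, fderiv_fun_smul hf hξ, map_add, map_smul, traceCLM_smulRight]
  rfl

/-- Compact support is asked only of the product, so either the function or the field may serve as
the cut-off. -/
theorem integral_mul_divergence_add_eq_zero {f : E n → ℝ} {ξ : E n → E n}
    (hf : ContDiff ℝ 1 f) (hξ : ContDiff ℝ 1 ξ) (hc : HasCompactSupport fun x => f x • ξ x) :
    ∫ x, (f x * divergence ξ x + fderiv ℝ f x (ξ x)) = 0 := by
  rw [← integral_divergence_eq_zero (hf.smul hξ) hc]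
  refine integral_congr_ae (Eventually.of_forall fun x => ?_)
  exact (divergence_smul (hf.differentiable one_ne_zero x)
    (hξ.differentiable one_ne_zero x)).symm

/-- `∫ tr (DV Dξ) = ∫ div V div ξ` for a compactly supported field `ξ`. -/
theorem integral_trace_fderiv_mul_fderiv {V ξ : E n → E n} (hV : ContDiff ℝ 1 V)
    (hξ : ContDiff ℝ 2 ξ) (hc : HasCompactSupport ξ) :
    ∫ x, traceCLM n (fderiv ℝ V x * fderiv ℝ ξ x) = ∫ x, divergence V x * divergence ξ x := by
  have hξ1 : ContDiff ℝ 1 (fderiv ℝ ξ) := hξ.fderiv_right (by norm_num)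
  have hdiv : ContDiff ℝ 1 (divergence ξ) := (traceCLM n).contDiff.comp hξ1
  have hW1 : ContDiff ℝ 1 fun x => fderiv ℝ ξ x (V x) := hξ1.clm_apply hV
  have hW2 : ContDiff ℝ 1 fun x => divergence ξ x • V x := hdiv.smul hV
  have hcdiv : HasCompactSupport (divergence ξ) :=
    (hc.fderiv ℝ).comp_left (g := traceCLM n) (map_zero _)
  -- The divergence of Dξ V − (div ξ) V is tr(DV Dξ) − div V div ξ: the terms with second
  -- derivatives of `ξ` cancel by symmetry, so `V` is differentiated only once.
  have hW : HasCompactSupport fun x => fderiv ℝ ξ x (V x) - divergence ξ x • V x := by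
    refine HasCompactSupport.sub (f := fun x => fderiv ℝ ξ x (V x)) ?_ hcdiv.smul_right
    refine (hc.fderiv ℝ).mono ?_
    intro x hx h
    exact hx (by simp [h])
  have hpt : ∀ x, divergence (fun x => fderiv ℝ ξ x (V x) - divergence ξ x • V x) x =
      traceCLM n (fderiv ℝ V x * fderiv ℝ ξ x) - divergence V x * divergence ξ x := by
    intro x
    have hVd := hV.differentiable one_ne_zero x
    have hξd := hξ1.differentiable one_ne_zero x
    have hdd := hdiv.differentiable one_ne_zero x
    rw [divergence_eq_traceCLM, fderiv_fun_sub (hW1.differentiable one_ne_zero x)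
      (hW2.differentiable one_ne_zero x), map_sub]
    have h1 : traceCLM n (fderiv ℝ (fun x => divergence ξ x • V x) x) = _ :=
      divergence_smul hdd hVd
    have h2 : fderiv ℝ (divergence ξ) x = (traceCLM n).comp (fderiv ℝ (fderiv ℝ ξ) x) :=
      ((traceCLM n).hasFDerivAt.comp x hξd.hasFDerivAt).fderiv
    have h3 : (fderiv ℝ (fderiv ℝ ξ) x).flip (V x) = fderiv ℝ (fderiv ℝ ξ) x (V x) := by
      ext1 w
      exact (hξ.contDiffAt.isSymmSndFDerivAt (by simp)).eq w (V x)
    rw [h1, fderiv_clm_apply hξd hVd, h2, map_add, h3]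
    have h4 : traceCLM n ((fderiv ℝ ξ x).comp (fderiv ℝ V x)) =
      traceCLM n (fderiv ℝ V x * fderiv ℝ ξ x) := traceCLM_mul_comm _ _
    rw [h4]
    simp only [ContinuousLinearMap.comp_apply]
    ring
  have h0 := integral_divergence_eq_zero (hW1.sub hW2) hW
  simp_rw [hpt] at h0
  have hcd := continuous_divergence hV
  rw [integral_sub] at h0
  · linarith
  · refine ((traceCLM n).continuous.comp ((hV.continuous_fderiv one_ne_zero).mul
      (hξ.continuous_fderiv two_ne_zero))).integrable_of_hasCompactSupport ?_
    refine (hc.fderiv ℝ).mono ?_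
    intro x hx h
    exact hx (by simp [h])
  · exact (hcd.mul hdiv.continuous).integrable_of_hasCompactSupport hcdiv.mul_left

/-- A continuous function whose weak derivative vanishes is constant. -/
theorem eq_of_integral_mul_fderiv_eq_zero {r : E n → ℝ} (hr : Continuous r)
    (h : ∀ ζ : E n → ℝ, ContDiff ℝ (⊤ : ℕ∞) ζ → HasCompactSupport ζ → ∀ e : E n,
      ∫ x, r x * fderiv ℝ ζ x e = 0) (x y : E n) : r x = r y := by
  -- Mollification: the derivative of `r` convolved with a bump falls on the bump, whose reflected
  -- translate is a test function, so each mollification is constant. Shrinking the bumps recovers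
  -- `r`.
  let φ : ℕ → ContDiffBump (0 : E n) := fun k =>
    ⟨1 / ((k : ℝ) + 2), 1 / ((k : ℝ) + 1), by positivity, by gcongr; norm_num⟩
  have hφ : Tendsto (fun k => (φ k).rOut) atTop (𝓝 0) := tendsto_one_div_add_atTop_nhds_zero_nat
  have hconst : ∀ k, ∀ x y,
      convolution ((φ k).normed volume) r (ContinuousLinearMap.lsmul ℝ ℝ) volume x =
      convolution ((φ k).normed volume) r (ContinuousLinearMap.lsmul ℝ ℝ) volume y := by
    intro k
    set f := (φ k).normed (volume : Measure (E n)) with hf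
    have hfs : ContDiff ℝ (⊤ : ℕ∞) f := (φ k).contDiff_normed
    have hfc : HasCompactSupport f := (φ k).hasCompactSupport_normed
    have hder := hfc.hasFDerivAt_convolution_left (ContinuousLinearMap.lsmul ℝ ℝ)
      (hfs.of_le (by simp)) (hr.locallyIntegrable (μ := volume))
    refine is_const_of_fderiv_eq_zero (𝕜 := ℝ) (fun x => (hder x).differentiableAt) fun x => ?_
    rw [(hder x).fderiv]
    ext e
    have hexist := (hfc.fderiv ℝ).convolutionExists_left
      ((ContinuousLinearMap.lsmul ℝ ℝ).precompL (E n)) (hfs.continuous_fderiv (by simp))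
      (hr.locallyIntegrable (μ := volume)) x
    rw [convolution, ContinuousLinearMap.integral_apply hexist]
    have hg : ContDiff ℝ (⊤ : ℕ∞) fun s : E n => x - s := contDiff_const.sub contDiff_id
    have h0 := h (fun s => f (x - s)) (hfs.comp hg)
      (hfc.comp_homeomorph (Homeomorph.subLeft x)) e
    rw [← integral_sub_left_eq_self _ volume x]
    have hpt : ∀ s, fderiv ℝ (fun s => f (x - s)) s e = -fderiv ℝ f (x - s) e := by
      intro s
      have h1 : HasFDerivAt (fun s : E n => x - s) (-ContinuousLinearMap.id ℝ (E n)) s := by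
        simpa using (hasFDerivAt_id s).const_sub x
      have h2 := ((hfs.differentiable (by simp)) (x - s)).hasFDerivAt.comp s h1
      have h3 := h2.fderiv
      simp only [Function.comp_def] at h3
      rw [h3]
      simp
    simp_rw [hpt] at h0
    have h4 : ∀ s, r s * -fderiv ℝ f (x - s) e = -(fderiv ℝ f (x - s) e * r s) := fun s => by ring
    simp_rw [h4] at h0
    rw [integral_neg, neg_eq_zero] at h0
    simpa [ContinuousLinearMap.precompL_apply] using h0
  refine tendsto_nhds_unique
    (ContDiffBump.convolution_tendsto_right_of_continuous (μ := volume) hφ hr x) ?_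
  refine (ContDiffBump.convolution_tendsto_right_of_continuous (μ := volume) hφ hr y).congr
    fun k => hconst k y x

/-- A continuous function that is orthogonal to all test functions vanishes. -/
theorem eq_zero_of_integral_mul_eq_zero {r : E n → ℝ} (hr : Continuous r)
    (h : ∀ ζ : E n → ℝ, ContDiff ℝ (⊤ : ℕ∞) ζ → HasCompactSupport ζ → ∫ x, ζ x * r x = 0)
    (x : E n) : r x = 0 := by
  have := ae_eq_zero_of_integral_contDiff_smul_eq_zero (hr.locallyIntegrable (μ := volume))
    fun g hg hgc => h g hg hgc
  have h2 : r = fun _ => 0 :=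
    (Continuous.ae_eq_iff_eq (volume : Measure (E n)) hr continuous_const).1 this
  exact congrFun h2 x

end Parts

/-! ### Linear differential equations -/

section Linear

variable {F : Type*} [NormedAddCommGroup F] [NormedSpace ℝ F]

/-- The radial retraction onto the closed ball of radius `R`. -/
def radialRetraction (R : ℝ) (x : F) : F := (R / max R ‖x‖) • x

theorem radialRetraction_of_norm_le {R : ℝ} (hR : 0 < R) {x : F} (hx : ‖x‖ ≤ R) :
    radialRetraction R x = x := by
  rw [radialRetraction, max_eq_left hx, div_self hR.ne', one_smul]

theorem norm_radialRetraction_le {R : ℝ} (hR : 0 < R) (x : F) : ‖radialRetraction R x‖ ≤ R := by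
  have hm : 0 < max R ‖x‖ := lt_max_of_lt_left hR
  rw [radialRetraction, norm_smul, Real.norm_of_nonneg (by positivity), div_mul_eq_mul_div,
    div_le_iff₀ hm]
  gcongr
  exact le_max_right _ _

theorem norm_radialRetraction_le_norm {R : ℝ} (hR : 0 < R) (x : F) :
    ‖radialRetraction R x‖ ≤ ‖x‖ := by
  have hm : 0 < max R ‖x‖ := lt_max_of_lt_left hR
  rw [radialRetraction, norm_smul, Real.norm_of_nonneg (by positivity)]
  exact mul_le_of_le_one_left (norm_nonneg _) ((div_le_one hm).2 (le_max_left _ _))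

/-- The difference splits as (R/a)(x − y) + (R/a − R/b) y, with a and b the two denominators, and
each term is at most ‖x − y‖. This needs no inner product. -/
theorem norm_radialRetraction_sub_le {R : ℝ} (hR : 0 < R) (x y : F) :
    ‖radialRetraction R x - radialRetraction R y‖ ≤ 2 * ‖x - y‖ := by
  set a := max R ‖x‖ with ha
  set b := max R ‖y‖ with hb
  have ha0 : 0 < a := lt_max_of_lt_left hR
  have hb0 : 0 < b := lt_max_of_lt_left hR
  have hRa : R ≤ a := le_max_left _ _
  have hyb : ‖y‖ ≤ b := le_max_right _ _
  have hab : |b - a| ≤ ‖x - y‖ := by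
    refine (abs_max_sub_max_le_max R ‖y‖ R ‖x‖).trans ?_
    rw [sub_self, abs_zero, max_eq_right (abs_nonneg _), norm_sub_rev]
    exact abs_norm_sub_norm_le y x
  have h1 : radialRetraction R x - radialRetraction R y =
      (R / a) • (x - y) + (R / a - R / b) • y := by
    simp only [radialRetraction, ← ha, ← hb]
    module
  have h2 : ‖(R / a) • (x - y)‖ ≤ ‖x - y‖ := by
    rw [norm_smul, Real.norm_of_nonneg (by positivity)]
    exact mul_le_of_le_one_left (norm_nonneg _) ((div_le_one ha0).2 hRa)
  have h3 : ‖(R / a - R / b) • y‖ ≤ ‖x - y‖ := by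
    have : R / a - R / b = R / a * ((b - a) / b) := by field_simp
    rw [this, norm_smul, norm_mul, norm_div (b - a), Real.norm_of_nonneg hb0.le,
      Real.norm_of_nonneg (r := R / a) (by positivity), Real.norm_eq_abs]
    calc R / a * (|b - a| / b) * ‖y‖ = (R / a) * |b - a| * (‖y‖ / b) := by ring
      _ ≤ 1 * ‖x - y‖ * 1 := by
        gcongr
        · exact (div_le_one ha0).2 hRa
        · exact (div_le_one hb0).2 hyb
      _ = ‖x - y‖ := by ring
  rw [h1]
  refine (norm_add_le _ _).trans ?_
  linarith

theorem _root_.HasDerivWithinAt.Ici_of_Icc {f : ℝ → F} {f' : F} {a b t : ℝ} (ht : t ∈ Ico a b)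
    (h : HasDerivWithinAt f f' (Icc a b) t) : HasDerivWithinAt f f' (Ici t) t :=
  h.mono_of_mem_nhdsWithin (Icc_mem_nhdsGE_of_mem ht)

/-- A linear differential equation with continuous coefficients has a solution on `[0, 1]`. -/
theorem exists_linear_ode [CompleteSpace F] {A : ℝ → F →L[ℝ] F} (hA : ContinuousOn A (Icc 0 1))
    (y₀ : F) : ∃ y : ℝ → F, y 0 = y₀ ∧
      ∀ t ∈ Icc (0 : ℝ) 1, HasDerivWithinAt y (A t (y t)) (Icc 0 1) t := by
  obtain ⟨M₀, hM₀⟩ := isCompact_Icc.exists_bound_of_continuousOn hA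
  obtain ⟨M, hM⟩ : ∃ M : NNReal, ∀ t ∈ Icc (0 : ℝ) 1, ‖A t‖ ≤ M :=
    ⟨M₀.toNNReal, fun t ht => (hM₀ t ht).trans (Real.le_coe_toNNReal _)⟩
  -- The field truncated at radius `R` is bounded by `M * R` and `2M`-Lipschitz, so Picard–Lindelöf
  -- reaches all of [0, 1]. Grönwall bounds the solution by ‖y₀‖ exp M ≤ `R`, so the truncation is
  -- never active; the `+ 1` keeps `R` positive.
  let R : NNReal := ⟨(‖y₀‖ + 1) * Real.exp M, by positivity⟩
  have hR : (0 : ℝ) < R := by change 0 < (‖y₀‖ + 1) * Real.exp M; positivity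
  have hPL : IsPicardLindelof (fun t y => A t (radialRetraction R y))
      (tmin := 0) (tmax := 1) ⟨0, by simp⟩ y₀ (M * R) 0 (M * R) (M * 2) := by
    refine ⟨fun t ht => ?_, fun y _ => ?_, fun t ht y _ => ?_, by simp⟩
    · refine LipschitzOnWith.of_dist_le_mul fun x _ y _ => ?_
      rw [dist_eq_norm, dist_eq_norm, ← map_sub]
      refine ((A t).le_opNorm _).trans ?_
      push_cast
      rw [mul_assoc]
      exact mul_le_mul (hM t ht) (norm_radialRetraction_sub_le hR x y) (norm_nonneg _) M.2
    · exact hA.clm_apply continuousOn_const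
    · refine ((A t).le_opNorm _).trans ?_
      push_cast
      exact mul_le_mul (hM t ht) (norm_radialRetraction_le hR y) (norm_nonneg _) M.2
  obtain ⟨y, hy0, hy⟩ := hPL.exists_eq_forall_mem_Icc_hasDerivWithinAt₀
  refine ⟨y, hy0, fun t ht => ?_⟩
  have hb := norm_le_gronwallBound_of_norm_deriv_right_le (f := y) (δ := ‖y₀‖) (K := M) (ε := 0)
    (fun t ht => (hy t ht).continuousWithinAt)
    (fun t ht => (hy t (Ico_subset_Icc_self ht)).Ici_of_Icc ht) (by
      rw [show y 0 = y₀ from hy0]) (fun t ht => by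
      rw [add_zero]
      exact ((A t).le_opNorm _).trans (mul_le_mul (hM t (Ico_subset_Icc_self ht))
        (norm_radialRetraction_le_norm hR _) (norm_nonneg _) M.2)) t ht
  have hyR : ‖y t‖ ≤ R := by
    refine hb.trans ?_
    rw [gronwallBound_ε0, sub_zero]
    change ‖y₀‖ * Real.exp (M * t) ≤ (‖y₀‖ + 1) * Real.exp M
    gcongr
    · linarith
    · exact mul_le_of_le_one_right M.2 ht.2
  have := hy t ht
  rwa [radialRetraction_of_norm_le hR hyR] at this

end Linear

/-! ### Differentiability of flows in the initial point -/

section Flow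

variable {V : Type*} [NormedAddCommGroup V] [NormedSpace ℝ V]

/-- `X` is the flow on `[0, 1]` of the time-dependent `C¹` vector field `w` with space
derivative `A`. -/
structure IsC1Flow (w : V → ℝ → V) (A : V → ℝ → V →L[ℝ] V) (X : V → ℝ → V) : Prop where
  hasFDerivAt : ∀ t ∈ Icc (0 : ℝ) 1, ∀ x, HasFDerivAt (fun x => w x t) (A x t) x
  continuousOn_deriv : ContinuousOn (fun z : V × ℝ => A z.1 z.2) (univ ×ˢ Icc 0 1)
  start : ∀ x, X x 0 = x
  ode : ∀ x, ∀ t ∈ Icc (0 : ℝ) 1, HasDerivWithinAt (X x) (w (X x t) t) (Icc 0 1) t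

namespace IsC1Flow

variable {w : V → ℝ → V} {A : V → ℝ → V →L[ℝ] V} {X : V → ℝ → V}

theorem continuousOn (h : IsC1Flow w A X) (x : V) : ContinuousOn (X x) (Icc 0 1) :=
  fun t ht => (h.ode x t ht).continuousWithinAt

theorem continuousOn_deriv_along (h : IsC1Flow w A X) (x : V) :
    ContinuousOn (fun t => A (X x t) t) (Icc 0 1) :=
  h.continuousOn_deriv.comp ((h.continuousOn x).prodMk continuousOn_id) fun _ ht => ⟨trivial, ht⟩

theorem exists_norm_le (h : IsC1Flow w A X) (x : V) : ∃ R, ∀ t ∈ Icc (0 : ℝ) 1, ‖X x t‖ ≤ R :=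
  isCompact_Icc.exists_bound_of_continuousOn (h.continuousOn x)

theorem lipschitzOnWith (h : IsC1Flow w A X) {R : ℝ} {K : NNReal}
    (hK : ∀ t ∈ Icc (0 : ℝ) 1, ∀ x ∈ Metric.closedBall (0 : V) R, ‖A x t‖ ≤ K)
    {t : ℝ} (ht : t ∈ Icc (0 : ℝ) 1) :
    LipschitzOnWith K (fun x => w x t) (Metric.closedBall 0 R) :=
  (convex_closedBall _ _).lipschitzOnWith_of_nnnorm_hasFDerivWithin_le
    (fun x _ => (h.hasFDerivAt t ht x).hasFDerivWithinAt) fun x hx => hK t ht x hx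

/-- Trajectories that start close to each other stay close to each other. -/
theorem dist_le (h : IsC1Flow w A X) {R : ℝ} {K : NNReal}
    (hK : ∀ t ∈ Icc (0 : ℝ) 1, ∀ x ∈ Metric.closedBall (0 : V) (R + 1), ‖A x t‖ ≤ K)
    {x y : V} (hR : ∀ t ∈ Icc (0 : ℝ) 1, ‖X x t‖ ≤ R) (hy : dist y x * Real.exp K < 1) :
    ∀ t ∈ Icc (0 : ℝ) 1, dist (X y t) (X x t) ≤ dist y x * Real.exp K ∧
      X y t ∈ Metric.closedBall (0 : V) (R + 1) := by
  have hmem : ∀ t ∈ Icc (0 : ℝ) 1, dist (X y t) (X x t) < 1 →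
      X y t ∈ Metric.closedBall (0 : V) (R + 1) := by
    intro t ht hd
    rw [mem_closedBall_zero_iff]
    have h1 := hR t ht
    have h2 : ‖X y t‖ ≤ ‖X x t‖ + ‖X y t - X x t‖ := norm_le_norm_add_norm_sub' _ _
    rw [dist_eq_norm] at hd
    linarith
  have hmemx : ∀ t ∈ Icc (0 : ℝ) 1, X x t ∈ Metric.closedBall (0 : V) (R + 1) := by
    intro t ht
    rw [mem_closedBall_zero_iff]
    linarith [hR t ht]
  -- While the trajectories are less than 1 apart, both stay in the ball where the Lipschitz bound
  -- holds, and Grönwall applies up to and including time `b`.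
  have key : ∀ b ∈ Icc (0 : ℝ) 1, (∀ t ∈ Ico 0 b, dist (X y t) (X x t) < 1) →
      dist (X y b) (X x b) ≤ dist y x * Real.exp K := by
    intro b hb hlt
    have hsub : Icc 0 b ⊆ Icc (0 : ℝ) 1 := Icc_subset_Icc_right hb.2
    have hIco : ∀ s ∈ Ico 0 b, s ∈ Icc (0 : ℝ) 1 := fun s hs => hsub (Ico_subset_Icc_self hs)
    have hder : ∀ z, ∀ s ∈ Ico 0 b, HasDerivWithinAt (X z) (w (X z s) s) (Ici s) s :=
      fun z s hs => (h.ode z s (hIco s hs)).Ici_of_Icc ⟨hs.1, hs.2.trans_le hb.2⟩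
    have := dist_le_of_trajectories_ODE_of_mem (v := fun t x => w x t)
      (s := fun _ => Metric.closedBall (0 : V) (R + 1)) (δ := dist y x)
      (fun s hs => h.lipschitzOnWith hK (hIco s hs))
      ((h.continuousOn y).mono hsub) (hder y) (fun s hs => hmem s (hIco s hs) (hlt s hs))
      ((h.continuousOn x).mono hsub) (hder x) (fun s hs => hmemx s (hIco s hs))
      (by rw [h.start, h.start]) b (right_mem_Icc.2 hb.1)
    refine this.trans ?_
    rw [sub_zero]
    gcongr
    exact mul_le_of_le_one_right K.2 hb.2
  -- At the first time `τ` at which the distance reaches 1, `key` would give a distance below 1.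
  have hlt : ∀ t ∈ Icc (0 : ℝ) 1, dist (X y t) (X x t) < 1 := by
    by_contra! hcon
    obtain ⟨t₀, ht₀, h1⟩ := hcon
    have hcl : IsCompact (Icc (0 : ℝ) 1 ∩ (fun t => dist (X y t) (X x t)) ⁻¹' Ici 1) :=
      isCompact_Icc.of_isClosed_subset (ContinuousOn.preimage_isClosed_of_isClosed
        (continuous_dist.comp_continuousOn ((h.continuousOn y).prodMk (h.continuousOn x))) isClosed_Icc isClosed_Ici) inter_subset_left
    obtain ⟨τ, hτ, hmin⟩ := hcl.exists_isLeast ⟨t₀, ht₀, h1⟩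
    have := key τ hτ.1 fun t ht => by
      by_contra! hge
      exact absurd (hmin ⟨⟨ht.1, ht.2.le.trans hτ.1.2⟩, hge⟩) (not_le.2 ht.2)
    have hτ1 : 1 ≤ dist (X y τ) (X x τ) := hτ.2
    exact absurd hτ1 (not_le.2 (this.trans_lt hy))
  exact fun t ht => ⟨key t ht fun s hs => hlt s ⟨hs.1, hs.2.le.trans ht.2⟩, hmem t ht (hlt t ht)⟩

variable [FiniteDimensional ℝ V]

/-- The normalization `1 ≤ K` later absorbs the division by `K` in Grönwall's bound. -/
theorem exists_deriv_bound (h : IsC1Flow w A X) (R : ℝ) : ∃ K : NNReal, 1 ≤ K ∧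
    ∀ t ∈ Icc (0 : ℝ) 1, ∀ x ∈ Metric.closedBall (0 : V) R, ‖A x t‖ ≤ K := by
  have : ProperSpace V := FiniteDimensional.proper ℝ V
  obtain ⟨K, hK⟩ := ((isCompact_closedBall (0 : V) R).prod
    (isCompact_Icc (a := (0 : ℝ)) (b := 1))).exists_bound_of_continuousOn
    (h.continuousOn_deriv.mono (prod_mono_left (subset_univ _)))
  refine ⟨max 1 K.toNNReal, le_max_left _ _, fun t ht x hx => ?_⟩
  refine (hK (x, t) ⟨hx, ht⟩).trans ((Real.le_coe_toNNReal K).trans ?_)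
  exact_mod_cast le_max_right _ _

/-- Backward uniqueness: trajectories that meet at time `t` agree back to time 0. -/
theorem injective (h : IsC1Flow w A X) {t : ℝ} (ht : t ∈ Icc (0 : ℝ) 1) :
    Function.Injective fun x => X x t := by
  intro x y hxy
  obtain ⟨R₁, hR₁⟩ := h.exists_norm_le x
  obtain ⟨R₂, hR₂⟩ := h.exists_norm_le y
  obtain ⟨K, -, hK⟩ := h.exists_deriv_bound (max R₁ R₂)
  have hsub : Icc 0 t ⊆ Icc (0 : ℝ) 1 := Icc_subset_Icc_right ht.2
  have hIoc : ∀ s ∈ Ioc 0 t, s ∈ Icc (0 : ℝ) 1 := fun s hs => hsub (Ioc_subset_Icc_self hs)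
  have hder : ∀ z, ∀ s ∈ Ioc 0 t, HasDerivWithinAt (X z) (w (X z s) s) (Iic s) s := fun z s hs =>
    (h.ode z s (hIoc s hs)).mono_of_mem_nhdsWithin
      (Icc_mem_nhdsLE_of_mem ⟨hs.1, hs.2.trans ht.2⟩)
  have := ODE_solution_unique_of_mem_Icc_left (v := fun t x => w x t)
    (s := fun _ => Metric.closedBall (0 : V) (max R₁ R₂))
    (fun s hs => h.lipschitzOnWith hK (hIoc s hs))
    ((h.continuousOn x).mono hsub) (hder x)
    (fun s hs => mem_closedBall_zero_iff.2 ((hR₁ s (hIoc s hs)).trans (le_max_left _ _)))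
    ((h.continuousOn y).mono hsub) (hder y)
    (fun s hs => mem_closedBall_zero_iff.2 ((hR₂ s (hIoc s hs)).trans (le_max_right _ _)))
    hxy (left_mem_Icc.2 ht.1)
  simpa [h.start] using this

/-- The flow of a `C¹` vector field is differentiable in the initial point, and its derivative
solves the linearized equation. -/
theorem hasFDerivAt_flow (h : IsC1Flow w A X) {x : V} {J : ℝ → V →L[ℝ] V} (hJ0 : J 0 = 1)
    (hJ : ∀ t ∈ Icc (0 : ℝ) 1, HasDerivWithinAt J (A (X x t) t * J t) (Icc 0 1) t)
    {t : ℝ} (ht : t ∈ Icc (0 : ℝ) 1) : HasFDerivAt (fun y => X y t) (J t) x := by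
  have : ProperSpace V := FiniteDimensional.proper ℝ V
  obtain ⟨R, hR⟩ := h.exists_norm_le x
  obtain ⟨K, hK1, hK⟩ := h.exists_deriv_bound (R + 1)
  have hK1' : (1 : ℝ) ≤ K := by exact_mod_cast hK1
  have hunif : UniformContinuousOn (fun z : V × ℝ => A z.1 z.2)
      (Metric.closedBall 0 (R + 1) ×ˢ Icc 0 1) :=
    ((isCompact_closedBall (0 : V) (R + 1)).prod
      isCompact_Icc).uniformContinuousOn_of_continuous
      (h.continuousOn_deriv.mono (prod_mono_left (subset_univ _)))
  rw [hasFDerivAt_iff_isLittleO, Asymptotics.isLittleO_iff]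
  intro c hc
  -- One factor exp K is lost when comparing the trajectories, the other in Grönwall's inequality
  -- for X y − X x − J(y − x); with this `η` the final error is c · dist y x.
  set η := c / (Real.exp K * Real.exp K) with hη
  have hη0 : 0 < η := by positivity
  obtain ⟨δ, hδ0, hδ⟩ := Metric.uniformContinuousOn_iff.1 hunif η hη0
  have hev : ∀ᶠ y in 𝓝 x, dist y x * Real.exp K < min 1 δ := by
    have : Tendsto (fun y => dist y x * Real.exp K) (𝓝 x) (𝓝 (dist x x * Real.exp K)) :=
      ((continuous_id.dist continuous_const).mul continuous_const).tendsto x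
    rw [dist_self, zero_mul] at this
    exact this.eventually (gt_mem_nhds (lt_min one_pos hδ0))
  filter_upwards [hev] with y hy
  have hd := h.dist_le hK hR (hy.trans_le (min_le_left _ _))
  have hlin : ∀ s ∈ Icc (0 : ℝ) 1,
      ‖w (X y s) s - w (X x s) s - A (X x s) s (X y s - X x s)‖ ≤ η * ‖X y s - X x s‖ := by
    intro s hs
    have hxs : X x s ∈ Metric.closedBall (0 : V) (R + 1) := by
      rw [mem_closedBall_zero_iff]
      linarith [hR s hs]
    have hconv : Convex ℝ (Metric.ball (X x s) δ ∩ Metric.closedBall 0 (R + 1)) :=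
      (convex_ball _ _).inter (convex_closedBall _ _)
    refine hconv.norm_image_sub_le_of_norm_hasFDerivWithin_le' (f := fun z => w z s)
      (f' := fun z => A z s) (fun z _ => (h.hasFDerivAt s hs z).hasFDerivWithinAt)
      (fun z hz => ?_) ⟨Metric.mem_ball_self hδ0, hxs⟩
      ⟨(hd s hs).1.trans_lt (hy.trans_le (min_le_right _ _)), (hd s hs).2⟩
    rw [← dist_eq_norm]
    refine (hδ (z, s) ⟨hz.2, hs⟩ (X x s, s) ⟨hxs, hs⟩ ?_).le
    rw [Prod.dist_eq, dist_self, max_eq_left dist_nonneg]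
    exact hz.1
  have hder : ∀ s ∈ Icc (0 : ℝ) 1, HasDerivWithinAt
      (fun s => X y s - X x s - J s (y - x))
      (w (X y s) s - w (X x s) s - (A (X x s) s * J s) (y - x)) (Icc 0 1) s := fun s hs =>
    ((h.ode y s hs).sub (h.ode x s hs)).sub
      (by simpa using (hJ s hs).clm_apply (hasDerivWithinAt_const s _ (y - x)))
  have hgr := norm_le_gronwallBound_of_norm_deriv_right_le
    (f := fun s => X y s - X x s - J s (y - x)) (δ := 0) (K := K)
    (ε := η * (dist y x * Real.exp K)) (fun s hs => (hder s hs).continuousWithinAt)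
    (fun s hs => (hder s (Ico_subset_Icc_self hs)).Ici_of_Icc hs)
    (by simp [h.start, hJ0]) (fun s hs => by
      have hs' := Ico_subset_Icc_self hs
      have hxs : X x s ∈ Metric.closedBall (0 : V) (R + 1) := by
        rw [mem_closedBall_zero_iff]
        linarith [hR s hs']
      have e : w (X y s) s - w (X x s) s - (A (X x s) s * J s) (y - x) =
          A (X x s) s (X y s - X x s - J s (y - x)) +
          (w (X y s) s - w (X x s) s - A (X x s) s (X y s - X x s)) := by
        simp only [map_sub, mul_apply_eq_comp]
        abel
      rw [e]
      refine (norm_add_le _ _).trans (add_le_add ?_ ((hlin s hs').trans ?_))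
      · exact ((A (X x s) s).le_opNorm _).trans
          (mul_le_mul_of_nonneg_right (hK s hs' _ hxs) (norm_nonneg _))
      · rw [← dist_eq_norm]
        exact mul_le_mul_of_nonneg_left (hd s hs').1 hη0.le) t ht
  refine hgr.trans ?_
  rw [gronwallBound_of_K_ne_0 (by positivity), ← dist_eq_norm, sub_zero]
  have h1 : Real.exp (K * t) - 1 ≤ Real.exp K := by
    have : Real.exp (K * t) ≤ Real.exp K :=
      Real.exp_le_exp.2 (mul_le_of_le_one_right K.2 ht.2)
    linarith
  have h0 : 0 ≤ Real.exp (K * t) - 1 := by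
    have := Real.one_le_exp (mul_nonneg K.2 ht.1)
    exact sub_nonneg.2 this
  have h2 : η * (dist y x * Real.exp K) / K ≤ η * (dist y x * Real.exp K) :=
    div_le_self (by positivity) hK1'
  calc 0 * Real.exp (K * t) + η * (dist y x * Real.exp K) / K * (Real.exp (K * t) - 1)
      ≤ η * (dist y x * Real.exp K) * Real.exp K := by
        rw [zero_mul, zero_add]
        exact mul_le_mul h2 h1 h0 (by positivity)
    _ = c * dist y x := by rw [hη]; field_simp

/-- Liouville's formula. -/
theorem exists_jacobian (h : IsC1Flow w A X) (x : V) : ∃ J : ℝ → V →L[ℝ] V, J 0 = 1 ∧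
    ∀ t ∈ Icc (0 : ℝ) 1, HasFDerivAt (fun y => X y t) (J t) x ∧ (J t).det ≠ 0 ∧
      HasDerivWithinAt (fun s => Real.log (J s).det)
        (LinearMap.trace ℝ V (A (X x t) t : V →ₗ[ℝ] V)) (Icc 0 1) t := by
  have hA := h.continuousOn_deriv_along x
  obtain ⟨J, hJ0, hJ⟩ := exists_linear_ode (F := V →L[ℝ] V)
    (A := fun t => ContinuousLinearMap.mul ℝ (V →L[ℝ] V) (A (X x t) t))
    ((ContinuousLinearMap.continuous _).comp_continuousOn hA) 1
  -- `L` solves L' = −L A, so (L J)' = 0 and `L` inverts `J` at all times; invertibility of the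
  -- Jacobian is thus known before Liouville's formula is used.
  obtain ⟨L, hL0, hL⟩ := exists_linear_ode (F := V →L[ℝ] V)
    (A := fun t => (ContinuousLinearMap.mul ℝ (V →L[ℝ] V)).flip (-A (X x t) t))
    ((ContinuousLinearMap.continuous _).comp_continuousOn hA.neg) 1
  simp only [ContinuousLinearMap.mul_apply', ContinuousLinearMap.flip_apply] at hJ hL
  have hder : ∀ t ∈ Icc (0 : ℝ) 1, HasDerivWithinAt (fun s => L s * J s) 0 (Icc 0 1) t := by
    intro t ht
    have := (hL t ht).mul (hJ t ht)
    refine this.congr_deriv ?_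
    rw [mul_neg, neg_mul, mul_assoc, neg_add_cancel]
  have hLJ : ∀ t ∈ Icc (0 : ℝ) 1, L t * J t = 1 := by
    intro t ht
    have h1 := (convex_Icc (0 : ℝ) 1).norm_image_sub_le_of_norm_hasDerivWithin_le
      (f := fun s => L s * J s) (C := 0) hder (by simp) (left_mem_Icc.2 zero_le_one) ht
    rw [zero_mul, norm_le_zero_iff, sub_eq_zero] at h1
    rw [h1, hJ0, hL0, one_mul]
  refine ⟨J, hJ0, fun t ht => ?_⟩
  have hJL : J t * L t = 1 := by
    have h1 : (L t : V →ₗ[ℝ] V) * (J t : V →ₗ[ℝ] V) = 1 :=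
      LinearMap.ext fun x => DFunLike.congr_fun (hLJ t ht) x
    ext x
    exact LinearMap.congr_fun (mul_eq_one_comm.1 h1) x
  refine ⟨h.hasFDerivAt_flow hJ0 hJ ht, det_ne_zero_of_mul_eq_one hJL, ?_⟩
  have := hasDerivWithinAt_log_det (hJ t ht) hJL
  rwa [mul_assoc, hJL, mul_one] at this

end IsC1Flow

end Flow

/-! ### Pushforwards of densities and their Kullback-Leibler divergence -/

section Pushforward

variable {n : ℕ} {f : E n → E n} {u v : E n → ℝ}

/-- The law with density `u`. -/
abbrev densityLaw (u : E n → ℝ) : Measure (E n) :=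
  volume.withDensity fun x => ENNReal.ofReal (u x)

/-- The density of the image under `f` of the law with density `u`. -/
def pushforwardDensity (f : E n → E n) (u : E n → ℝ) : E n → ℝ≥0∞ :=
  Function.extend f (fun x => ENNReal.ofReal (u x / |(fderiv ℝ f x).det|)) 0

theorem measurable_det_fderiv (f : E n → E n) : Measurable fun x => (fderiv ℝ f x).det :=
  ContinuousLinearMap.continuous_det.measurable.comp (measurable_fderiv ℝ f)

theorem measurable_pushforwardDensity (hf : Differentiable ℝ f) (hinj : Function.Injective f)
    (hu : Measurable u) : Measurable (pushforwardDensity f u) :=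
  (hf.continuous.measurableEmbedding hinj).measurable_extend
    (ENNReal.measurable_ofReal.comp (hu.div (measurable_det_fderiv f).abs)) measurable_const

theorem pushforwardDensity_apply (hinj : Function.Injective f) (x : E n) :
    pushforwardDensity f u (f x) = ENNReal.ofReal (u x / |(fderiv ℝ f x).det|) :=
  hinj.extend_apply _ _ _

/-- The area formula on preimages. Surjectivity is not needed, since the pushed density is 0 off the
range. -/
theorem map_densityLaw (hf : Differentiable ℝ f) (hinj : Function.Injective f)
    (hdet : ∀ x, (fderiv ℝ f x).det ≠ 0) :
    (densityLaw u).map f = volume.withDensity (pushforwardDensity f u) := by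
  have hemb := hf.continuous.measurableEmbedding hinj
  ext s hs
  have hpre : MeasurableSet (f ⁻¹' s) := hemb.measurable hs
  rw [Measure.map_apply hemb.measurable hs, withDensity_apply _ hpre, withDensity_apply _ hs]
  have h1 : ∫⁻ y in s, pushforwardDensity f u y =
      ∫⁻ y in f '' (f ⁻¹' s), pushforwardDensity f u y := by
    rw [image_preimage_eq_inter_range, ← lintegral_indicator hs,
      ← lintegral_indicator (hs.inter hemb.measurableSet_range)]
    congr 1
    ext y
    by_cases hy : y ∈ range f
    · by_cases hys : y ∈ s
      · rw [indicator_of_mem hys, indicator_of_mem (show y ∈ s ∩ range f from ⟨hys, hy⟩)]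
      · rw [indicator_of_notMem hys, indicator_of_notMem fun h : y ∈ s ∩ range f => hys h.1]
    · have : pushforwardDensity f u y = 0 := Function.extend_apply' _ _ _ hy
      rw [indicator_apply_eq_zero.2 fun _ => this, indicator_apply_eq_zero.2 fun _ => this]
  rw [h1, lintegral_image_eq_lintegral_abs_det_fderiv_mul volume hpre
    (fun x _ => (hf x).hasFDerivAt.hasFDerivWithinAt) hinj.injOn]
  refine lintegral_congr fun x => ?_
  rw [pushforwardDensity_apply hinj, ← ENNReal.ofReal_mul (abs_nonneg _),
    mul_div_cancel₀ _ (abs_ne_zero.2 (hdet x))]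

/-- This exhibits the Radon–Nikodym derivative that enters the log-likelihood ratio. -/
theorem withDensity_eq_withDensity_densityLaw {d : E n → ℝ≥0∞} (hd : Measurable d)
    (hv : Measurable v) (hv0 : ∀ x, 0 < v x) :
    volume.withDensity d = (densityLaw v).withDensity fun x => d x / ENNReal.ofReal (v x) := by
  have hv' : Measurable fun x => ENNReal.ofReal (v x) := ENNReal.measurable_ofReal.comp hv
  have h := withDensity_mul volume hv' (hd.div hv')
  refine Eq.trans ?_ h
  congr 1
  ext x
  simp only [Pi.mul_apply, Pi.div_apply]
  rw [ENNReal.mul_div_cancel (by simpa using hv0 x) ENNReal.ofReal_ne_top]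

/-- The divergence between the image of a law with density `u` under an injective map and a law
with density `v`, computed by a change of variables. -/
theorem klDiv_map_densityLaw (hf : Differentiable ℝ f) (hinj : Function.Injective f)
    (hdet : ∀ x, (fderiv ℝ f x).det ≠ 0) (hu : Measurable u) (hv : Measurable v)
    (hu0 : ∀ x, 0 < u x) (hv0 : ∀ x, 0 < v x) [IsProbabilityMeasure (densityLaw u)]
    [IsProbabilityMeasure (densityLaw v)] :
    (klDiv ((densityLaw u).map f) (densityLaw v) ≠ ∞ ↔
      Integrable (fun x => Real.log (u x) - Real.log (fderiv ℝ f x).det - Real.log (v (f x)))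
        (densityLaw u)) ∧
    (klDiv ((densityLaw u).map f) (densityLaw v)).toReal =
      ∫ x, (Real.log (u x) - Real.log (fderiv ℝ f x).det - Real.log (v (f x)))
        ∂(densityLaw u) := by
  have hfm : Measurable f := hf.continuous.measurable
  have hemb := hf.continuous.measurableEmbedding hinj
  have hd := measurable_pushforwardDensity hf hinj hu
  have hk : Measurable fun x => pushforwardDensity f u x / ENNReal.ofReal (v x) :=
    hd.div (ENNReal.measurable_ofReal.comp hv)
  have hmap : (densityLaw u).map f = (densityLaw v).withDensity
      fun x => pushforwardDensity f u x / ENNReal.ofReal (v x) := by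
    rw [map_densityLaw hf hinj hdet, withDensity_eq_withDensity_densityLaw hd hv hv0]
  have hac : (densityLaw u).map f ≪ densityLaw v := by
    rw [hmap]
    exact withDensity_absolutelyContinuous _ _
  have hprob : IsProbabilityMeasure ((densityLaw u).map f) :=
    Measure.isProbabilityMeasure_map hfm.aemeasurable
  have hllr : (fun x => llr ((densityLaw u).map f) (densityLaw v) (f x)) =ᵐ[densityLaw u]
      fun x => Real.log (u x) - Real.log (fderiv ℝ f x).det - Real.log (v (f x)) := by
    have h1 : ((densityLaw u).map f).rnDeriv (densityLaw v) =ᵐ[densityLaw v]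
        fun x => pushforwardDensity f u x / ENNReal.ofReal (v x) := by
      rw [hmap]
      exact Measure.rnDeriv_withDensity _ hk
    filter_upwards [ae_of_ae_map hfm.aemeasurable (hac.ae_le h1)] with x hx
    rw [llr, hx, pushforwardDensity_apply hinj, ENNReal.toReal_div,
      ENNReal.toReal_ofReal (by have := (hu0 x).le; positivity),
      ENNReal.toReal_ofReal (hv0 _).le,
      Real.log_div (div_ne_zero (hu0 x).ne' (abs_ne_zero.2 (hdet x))) (hv0 _).ne',
      Real.log_div (hu0 x).ne' (abs_ne_zero.2 (hdet x)), Real.log_abs]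
  constructor
  · rw [klDiv_ne_top_iff, hemb.integrable_map_iff]
    simp only [hac, true_and]
    exact integrable_congr hllr
  · rw [toReal_klDiv_of_measure_eq hac (by simp), hemb.integral_map]
    exact integral_congr_ae hllr

end Pushforward

/-! ### The standard Gaussian density -/

section Gaussian

variable {n : ℕ}

/-- The density of the standard Gaussian law. -/
def stdDensity (w : E n) : ℝ := (2 * Real.pi) ^ (-(n : ℝ) / 2) * Real.exp (-‖w‖ ^ 2 / 2)

theorem stdDensity_pos (w : E n) : 0 < stdDensity w := by
  unfold stdDensity
  positivity

theorem contDiff_stdDensity : ContDiff ℝ (⊤ : ℕ∞) (stdDensity (n := n)) := by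
  unfold stdDensity
  exact contDiff_const.mul (((contDiff_norm_sq ℝ).neg.div_const _).exp)

theorem continuous_stdDensity : Continuous (stdDensity (n := n)) := contDiff_stdDensity.continuous

theorem stdDensity_neg (w : E n) : stdDensity (-w) = stdDensity w := by simp [stdDensity]

theorem hasFDerivAt_neg_norm_sq_div_two (w : E n) :
    HasFDerivAt (fun w : E n => -‖w‖ ^ 2 / 2) (-innerSL ℝ w) w := by
  have h := ((hasStrictFDerivAt_norm_sq w).hasFDerivAt.neg).mul_const (2⁻¹ : ℝ)
  refine (h.congr_fderiv ?_).congr_of_eventuallyEq (Eventually.of_forall fun x => ?_)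
  · ext v
    simp
  · simp [div_eq_mul_inv]

theorem hasFDerivAt_stdDensity (w : E n) :
    HasFDerivAt stdDensity (-(stdDensity w) • innerSL ℝ w) w := by
  have h2 := ((hasFDerivAt_neg_norm_sq_div_two w).exp).const_mul ((2 * Real.pi) ^ (-(n : ℝ) / 2))
  refine h2.congr_fderiv ?_
  ext v
  simp [stdDensity]
  ring

theorem fderiv_stdDensity_apply (w v : E n) :
    fderiv ℝ stdDensity w v = -(stdDensity w * inner ℝ w v) := by
  rw [(hasFDerivAt_stdDensity w).fderiv]
  simp

theorem integrable_exp_neg_mul_norm_sq {b : ℝ} (hb : 0 < b) :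
    Integrable fun w : E n => Real.exp (-b * ‖w‖ ^ 2) := by
  by_contra h
  have h1 := GaussianFourier.integral_rexp_neg_mul_sq_norm (V := E n) hb
  rw [integral_undef h] at h1
  have : 0 < (Real.pi / b) ^ ((Module.finrank ℝ (E n) : ℝ) / 2) := by positivity
  exact this.ne h1

theorem integrable_stdDensity : Integrable (stdDensity (n := n)) := by
  have := (integrable_exp_neg_mul_norm_sq (n := n) (b := 1 / 2) (by norm_num)).const_mul
    ((2 * Real.pi) ^ (-(n : ℝ) / 2))
  refine this.congr (Eventually.of_forall fun w => ?_)
  simp only [stdDensity]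
  congr 2
  ring

theorem integral_stdDensity : ∫ w : E n, stdDensity w = 1 := by
  have h := GaussianFourier.integral_rexp_neg_mul_sq_norm (V := E n) (b := 1 / 2) (by norm_num)
  have h2 : ∀ w : E n, -‖w‖ ^ 2 / 2 = -(1 / 2) * ‖w‖ ^ 2 := fun w => by ring
  simp only [stdDensity, h2]
  rw [integral_const_mul, h, finrank_euclideanSpace, Fintype.card_fin,
    show Real.pi / (1 / 2) = 2 * Real.pi by ring, ← Real.rpow_add (by positivity)]
  rw [show -(n : ℝ) / 2 + (n : ℝ) / 2 = 0 by ring, Real.rpow_zero]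

theorem integrable_norm_sq_mul_stdDensity :
    Integrable fun w : E n => ‖w‖ ^ 2 * stdDensity w := by
  have := (integrable_exp_neg_mul_norm_sq (n := n) (b := 1 / 4) (by norm_num)).const_mul
    (4 * (2 * Real.pi) ^ (-(n : ℝ) / 2))
  refine this.mono' (by
    exact ((continuous_norm.pow 2).mul continuous_stdDensity).aestronglyMeasurable)
    (Eventually.of_forall fun w => ?_)
  have h0 := (stdDensity_pos w).le
  rw [Real.norm_of_nonneg (by positivity)]
  -- The polynomial factor is paid for with half of the Gaussian exponent.
  have h1 : ‖w‖ ^ 2 ≤ 4 * Real.exp (1 / 4 * ‖w‖ ^ 2) := by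
    have := Real.add_one_le_exp (1 / 4 * ‖w‖ ^ 2)
    linarith
  have h2 : Real.exp (1 / 4 * ‖w‖ ^ 2) * Real.exp (-‖w‖ ^ 2 / 2) =
      Real.exp (-(1 / 4) * ‖w‖ ^ 2) := by
    rw [← Real.exp_add]
    congr 1
    ring
  calc ‖w‖ ^ 2 * stdDensity w ≤ 4 * Real.exp (1 / 4 * ‖w‖ ^ 2) * stdDensity w := by gcongr
    _ = 4 * (2 * Real.pi) ^ (-(n : ℝ) / 2) *
        (Real.exp (1 / 4 * ‖w‖ ^ 2) * Real.exp (-‖w‖ ^ 2 / 2)) := by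
      rw [stdDensity]
      ring
    _ = _ := by rw [h2]

theorem integrable_norm_mul_stdDensity : Integrable fun w : E n => ‖w‖ * stdDensity w := by
  refine (integrable_stdDensity.add integrable_norm_sq_mul_stdDensity).mono'
    (continuous_norm.mul continuous_stdDensity).aestronglyMeasurable
    (Eventually.of_forall fun w => ?_)
  have h0 := (stdDensity_pos w).le
  rw [Real.norm_of_nonneg (by positivity)]
  simp only [Pi.add_apply]
  nlinarith [sq_nonneg (‖w‖ - 1), norm_nonneg w]

theorem integrable_inner_mul_stdDensity (y : E n) :
    Integrable fun w : E n => inner ℝ w y * stdDensity w := by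
  refine (integrable_norm_mul_stdDensity.const_mul ‖y‖).mono'
    ((continuous_id.inner continuous_const).mul continuous_stdDensity).aestronglyMeasurable
    (Eventually.of_forall fun w => ?_)
  rw [norm_mul, Real.norm_of_nonneg (stdDensity_pos w).le, ← mul_assoc, mul_comm ‖y‖]
  exact mul_le_mul_of_nonneg_right (norm_inner_le_norm w y) (stdDensity_pos w).le

theorem integral_inner_mul_stdDensity (y : E n) :
    ∫ w : E n, inner ℝ w y * stdDensity w = 0 := by
  have h := integral_neg_eq_self (fun w : E n => inner ℝ w y * stdDensity w) volume
  simp only [stdDensity_neg, inner_neg_left, neg_mul, integral_neg] at h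
  linarith

/-- Since ∂ᵢg = −wᵢg, integrating wᵢ by parts against ∂ᵢg shows that each coordinate has second
moment 1. -/
theorem integral_norm_sq_mul_stdDensity : ∫ w : E n, ‖w‖ ^ 2 * stdDensity w = n := by
  have hle : ∀ (i : Fin n) (w : E n), |w i| ≤ ‖w‖ := fun i w => PiLp.norm_apply_le w i
  have hci : ∀ i : Fin n, Continuous fun w : E n => w i := fun i =>
    (EuclideanSpace.proj i : E n →L[ℝ] ℝ).continuous
  have hi2 : ∀ i : Fin n, Integrable fun w : E n => w i * (w i * stdDensity w) := by
    intro i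
    refine integrable_norm_sq_mul_stdDensity.mono'
      ((hci i).mul ((hci i).mul continuous_stdDensity)).aestronglyMeasurable
      (Eventually.of_forall fun w => ?_)
    rw [norm_mul, norm_mul, Real.norm_of_nonneg (stdDensity_pos w).le, ← mul_assoc, sq,
      Real.norm_eq_abs]
    have := (stdDensity_pos w).le
    gcongr <;> exact hle i w
  have hi1 : ∀ i : Fin n, Integrable fun w : E n => w i * stdDensity w := by
    intro i
    refine integrable_norm_mul_stdDensity.mono'
      ((hci i).mul continuous_stdDensity).aestronglyMeasurable
      (Eventually.of_forall fun w => ?_)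
    rw [norm_mul, Real.norm_of_nonneg (stdDensity_pos w).le, Real.norm_eq_abs]
    have := (stdDensity_pos w).le
    gcongr
    exact hle i w
  have hone : ∀ i : Fin n, ∫ w : E n, w i * (w i * stdDensity w) = 1 := by
    intro i
    have hfd : ∀ w : E n, fderiv ℝ (fun w : E n => w i) w (EuclideanSpace.single i 1) = 1 := by
      intro w
      have : HasFDerivAt (fun w : E n => w i) (EuclideanSpace.proj i : E n →L[ℝ] ℝ) w :=
        (EuclideanSpace.proj i : E n →L[ℝ] ℝ).hasFDerivAt
      rw [this.fderiv]
      simp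
    have hfg : ∀ w : E n, fderiv ℝ stdDensity w (EuclideanSpace.single i 1) =
        -(w i * stdDensity w) := by
      intro w
      rw [fderiv_stdDensity_apply, EuclideanSpace.inner_single_right]
      simp [mul_comm]
    have h := integral_mul_fderiv_eq_neg_fderiv_mul_of_integrable (μ := (volume : Measure (E n)))
      (f := fun w : E n => w i) (g := stdDensity) (v := EuclideanSpace.single i 1)
      (by simpa only [hfd, one_mul] using integrable_stdDensity)
      (by simp only [hfg, mul_neg]; exact (hi2 i).neg) (hi1 i)
      (fun w _ => (EuclideanSpace.proj i : E n →L[ℝ] ℝ).differentiableAt)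
      (fun w _ => (hasFDerivAt_stdDensity w).differentiableAt)
    simp only [hfd, hfg, one_mul, mul_neg, integral_neg, integral_stdDensity] at h
    linarith
  have hsum : ∀ w : E n, ‖w‖ ^ 2 * stdDensity w = ∑ i, w i * (w i * stdDensity w) := by
    intro w
    rw [EuclideanSpace.real_norm_sq_eq, Finset.sum_mul]
    exact Finset.sum_congr rfl fun i _ => by ring
  simp_rw [hsum]
  rw [integral_finsetSum _ fun i _ => hi2 i]
  simp [hone]

/-- Derivatives of order three and higher vanish. The shape Dⁱ of the bound is the one that
`norm_iteratedFDeriv_comp_le` takes for the inner function of a composition. -/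
theorem norm_iteratedFDeriv_neg_norm_sq_div_two_le {i : ℕ} (hi : 1 ≤ i) (w : E n) :
    ‖iteratedFDeriv ℝ i (fun w : E n => -‖w‖ ^ 2 / 2) w‖ ≤ (1 + ‖w‖) ^ i := by
  have hf : fderiv ℝ (fun w : E n => -‖w‖ ^ 2 / 2) = ⇑(-innerSL ℝ : E n →L[ℝ] E n →L[ℝ] ℝ) := by
    ext1 w
    exact (hasFDerivAt_neg_norm_sq_div_two w).fderiv
  have hw : 1 ≤ 1 + ‖w‖ := by linarith [norm_nonneg w]
  obtain ⟨j, rfl⟩ := Nat.exists_eq_add_of_le' hi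
  rw [← norm_iteratedFDeriv_fderiv, hf]
  rcases j with _ | j
  · rw [norm_iteratedFDeriv_zero, neg_apply, norm_neg, innerSL_apply_norm]
    simp
  · have hc : fderiv ℝ ⇑(-innerSL ℝ : E n →L[ℝ] E n →L[ℝ] ℝ) = fun _ => -innerSL ℝ := by
      ext1 w
      exact ContinuousLinearMap.fderiv _
    rw [← norm_iteratedFDeriv_fderiv, hc]
    rcases j with _ | j
    · rw [norm_iteratedFDeriv_zero, norm_neg]
      exact (norm_innerSL_le ℝ).trans (one_le_pow₀ hw)
    · rw [iteratedFDeriv_const_of_ne (by omega)]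
      simp only [Pi.zero_apply, norm_zero]
      positivity

theorem exists_norm_iteratedFDeriv_stdDensity_le (k : ℕ) :
    ∃ C, ∀ w : E n, ‖iteratedFDeriv ℝ k stdDensity w‖ ≤ C := by
  set c : ℝ := (2 * Real.pi) ^ (-(n : ℝ) / 2) with hc
  have hf : ContDiff ℝ (⊤ : ℕ∞) fun w : E n => -‖w‖ ^ 2 / 2 :=
    (contDiff_norm_sq ℝ).neg.div_const _
  refine ⟨c * (k.factorial * k.factorial * Real.exp (3 / 2)), fun w => ?_⟩
  have h1 : ‖iteratedFDeriv ℝ k (Real.exp ∘ fun w : E n => -‖w‖ ^ 2 / 2) w‖ ≤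
      k.factorial * Real.exp (-‖w‖ ^ 2 / 2) * (1 + ‖w‖) ^ k := by
    refine norm_iteratedFDeriv_comp_le (N := (⊤ : ℕ∞)) Real.contDiff_exp hf
      (by exact_mod_cast le_top) w (fun i _ => ?_)
      fun i hi _ => norm_iteratedFDeriv_neg_norm_sq_div_two_le hi w
    rw [norm_iteratedFDeriv_eq_norm_iteratedDeriv, iteratedDeriv_eq_iterate,
      Real.iter_deriv_exp, Real.norm_of_nonneg (Real.exp_pos _).le]
  have h2 : (1 + ‖w‖) ^ k ≤ k.factorial * Real.exp (1 + ‖w‖) := by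
    have := Real.pow_div_factorial_le_exp (1 + ‖w‖) (by positivity) k
    rwa [div_le_iff₀' (by positivity)] at this
  -- The exponent 1 + r − r²/2 is largest at r = 1, where it equals 3/2.
  have h3 : Real.exp (-‖w‖ ^ 2 / 2) * Real.exp (1 + ‖w‖) ≤ Real.exp (3 / 2) := by
    rw [← Real.exp_add, Real.exp_le_exp]
    nlinarith [sq_nonneg (‖w‖ - 1)]
  have h4 : stdDensity (n := n) = c • (Real.exp ∘ fun w : E n => -‖w‖ ^ 2 / 2) := by
    ext w
    simp [stdDensity, hc]
  have hc0 : 0 ≤ c := by positivity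
  rw [h4, iteratedFDeriv_const_smul_apply ((Real.contDiff_exp.comp hf).contDiffAt.of_le
    (by exact_mod_cast le_top)), norm_smul, Real.norm_of_nonneg hc0]
  refine mul_le_mul_of_nonneg_left (h1.trans ?_) hc0
  calc k.factorial * Real.exp (-‖w‖ ^ 2 / 2) * (1 + ‖w‖) ^ k
      ≤ k.factorial * Real.exp (-‖w‖ ^ 2 / 2) * (k.factorial * Real.exp (1 + ‖w‖)) := by gcongr
    _ = k.factorial * k.factorial * (Real.exp (-‖w‖ ^ 2 / 2) * Real.exp (1 + ‖w‖)) := by ring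
    _ ≤ _ := by gcongr

/-- Integration after the change of variables `w = u x - c`. -/
theorem integral_comp_smul_sub {u : ℝ} (hu : 0 < u) (F : E n → ℝ) (c : E n) :
    ∫ x, F (u • x - c) = (u ^ n)⁻¹ * ∫ w, F w := by
  have h := Measure.integral_comp_smul (volume : Measure (E n)) (fun w => F (w - c)) u
  rw [h, integral_sub_right_eq_self (fun w => F w) c, finrank_euclideanSpace, Fintype.card_fin,
    abs_of_pos (by positivity), smul_eq_mul]

theorem integrable_comp_smul_sub {u : ℝ} (hu : 0 < u) {F : E n → ℝ} (hF : Integrable F)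
    (c : E n) : Integrable fun x => F (u • x - c) :=
  (hF.comp_sub_right c).comp_smul hu.ne'

end Gaussian

/-! ### Gaussian smoothing of a measure -/

section Smoothing

variable {n : ℕ}

/-- The average of the standard Gaussian density over the points `z.1 - z.2 • y`. -/
def smoothed (p : Measure (E n)) (z : E n × ℝ) : ℝ := ∫ y, stdDensity (z.1 - z.2 • y) ∂p

/-- The linear map `(x, s) ↦ x - s • y`. -/
def shear (y : E n) : E n × ℝ →L[ℝ] E n :=
  ContinuousLinearMap.fst ℝ (E n) ℝ - (ContinuousLinearMap.snd ℝ (E n) ℝ).smulRight y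

theorem shear_apply (y : E n) (z : E n × ℝ) : shear y z = z.1 - z.2 • y := rfl

theorem norm_shear_le (y : E n) : ‖shear y‖ ≤ 1 + ‖y‖ := by
  refine ContinuousLinearMap.opNorm_le_bound _ (by positivity) fun z => ?_
  rw [shear_apply, add_mul, one_mul]
  refine (norm_sub_le _ _).trans (add_le_add (norm_fst_le z) ?_)
  rw [norm_smul, mul_comm]
  exact mul_le_mul_of_nonneg_left (norm_snd_le z) (norm_nonneg _)

theorem norm_iteratedFDeriv_comp_clm_le {V W G : Type*} [NormedAddCommGroup V] [NormedSpace ℝ V]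
    [NormedAddCommGroup W] [NormedSpace ℝ W] [NormedAddCommGroup G] [NormedSpace ℝ G]
    (g : V →L[ℝ] W) {f : W → G} (hf : ContDiff ℝ (⊤ : ℕ∞) f) (i : ℕ) (z : V) :
    ‖iteratedFDeriv ℝ i (f ∘ g) z‖ ≤ ‖iteratedFDeriv ℝ i f (g z)‖ * ‖g‖ ^ i := by
  rw [g.iteratedFDeriv_comp_right hf z (by exact_mod_cast le_top)]
  refine (ContinuousMultilinearMap.norm_compContinuousLinearMap_le _ _).trans ?_
  simp

theorem contDiff_uncurry_stdDensity_shear :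
    ContDiff ℝ (⊤ : ℕ∞) (Function.uncurry fun (y : E n) (z : E n × ℝ) =>
      stdDensity (z.1 - z.2 • y)) := by
  refine contDiff_stdDensity.comp ?_
  exact (contDiff_fst.comp contDiff_snd).sub ((contDiff_snd.comp contDiff_snd).smul contDiff_fst)

theorem norm_iteratedFDeriv_stdDensity_shear_le (i : ℕ) : ∃ C, 0 ≤ C ∧ ∀ (y : E n) (z : E n × ℝ),
    ‖iteratedFDeriv ℝ i (fun z : E n × ℝ => stdDensity (z.1 - z.2 • y)) z‖ ≤
      C * (1 + ‖y‖) ^ i := by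
  obtain ⟨C, hC⟩ := exists_norm_iteratedFDeriv_stdDensity_le (n := n) i
  have hC0 : 0 ≤ C := (norm_nonneg _).trans (hC 0)
  refine ⟨C, hC0, fun y z => ?_⟩
  refine (norm_iteratedFDeriv_comp_clm_le (shear y) contDiff_stdDensity i z).trans ?_
  exact mul_le_mul (hC _) (pow_le_pow_left₀ (norm_nonneg _) (norm_shear_le y) i)
    (by positivity) hC0

variable {p : Measure (E n)} [IsProbabilityMeasure p]

theorem integrable_one_add_norm_pow (hp : Integrable (fun y => ‖y‖ ^ 2) p) {i : ℕ} (hi : i ≤ 2) :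
    Integrable (fun y : E n => (1 + ‖y‖) ^ i) p := by
  refine (((integrable_const (1 : ℝ)).add hp).const_mul 2).mono' (by fun_prop)
    (Eventually.of_forall fun y => ?_)
  rw [Real.norm_of_nonneg (by positivity)]
  have h1 : (1 + ‖y‖) ^ i ≤ (1 + ‖y‖) ^ 2 :=
    pow_le_pow_right₀ (by linarith [norm_nonneg y]) hi
  simp only [Pi.add_apply]
  nlinarith [sq_nonneg (‖y‖ - 1)]

/-- Each derivative in (x, s) costs a factor 1 + ‖y‖, so two moments of the data buy two joint
derivatives. -/
theorem contDiff_smoothed (hp : Integrable (fun y => ‖y‖ ^ 2) p) : ContDiff ℝ 2 (smoothed p) := by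
  choose C _ hC using norm_iteratedFDeriv_stdDensity_shear_le (n := n)
  exact contDiff_integral_of_dominated 2 (B := fun i y => C i * (1 + ‖y‖) ^ i)
    (contDiff_infty.1 contDiff_uncurry_stdDensity_shear 2)
    (fun i hi => (integrable_one_add_norm_pow hp hi).const_mul _) fun i _ y z => hC i y z

theorem fderiv_stdDensity_shear (y : E n) (z : E n × ℝ) :
    fderiv ℝ (fun z : E n × ℝ => stdDensity (z.1 - z.2 • y)) z =
      (fderiv ℝ stdDensity (z.1 - z.2 • y)).comp (shear y) :=
  ((contDiff_stdDensity.differentiable (by simp) _).hasFDerivAt.comp z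
    (shear y).hasFDerivAt).fderiv

theorem norm_fderiv_stdDensity_shear_le : ∃ C, 0 ≤ C ∧ ∀ (y : E n) (z : E n × ℝ),
    ‖fderiv ℝ (fun z : E n × ℝ => stdDensity (z.1 - z.2 • y)) z‖ ≤ C * (1 + ‖y‖) := by
  obtain ⟨C, h0, hC⟩ := norm_iteratedFDeriv_stdDensity_shear_le (n := n) 1
  refine ⟨C, h0, fun y z => ?_⟩
  have := hC y z
  rwa [← zero_add 1, ← norm_iteratedFDeriv_fderiv, norm_iteratedFDeriv_zero, zero_add,
    pow_one] at this

theorem integrable_stdDensity_shear (z : E n × ℝ) :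
    Integrable (fun y => stdDensity (z.1 - z.2 • y)) p := by
  obtain ⟨C, -, hC⟩ := norm_iteratedFDeriv_stdDensity_shear_le (n := n) 0
  refine (integrable_const C).mono' ?_ (Eventually.of_forall fun y => by simpa using hC y z)
  exact (continuous_stdDensity.comp (by fun_prop)).aestronglyMeasurable

theorem integrable_fderiv_stdDensity_shear (hp : Integrable (fun y => ‖y‖ ^ 2) p)
    (z : E n × ℝ) : Integrable
      (fun y => fderiv ℝ (fun z : E n × ℝ => stdDensity (z.1 - z.2 • y)) z) p := by
  obtain ⟨C, -, hC⟩ := norm_fderiv_stdDensity_shear_le (n := n)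
  have h1 := (integrable_one_add_norm_pow hp one_le_two).const_mul C
  refine h1.mono' ?_ (Eventually.of_forall fun y => by simpa using hC y z)
  have : ContDiff ℝ 0 fun y : E n =>
      fderiv ℝ (fun z : E n × ℝ => stdDensity (z.1 - z.2 • y)) z :=
    ContDiff.fderiv (m := (⊤ : ℕ∞)) contDiff_uncurry_stdDensity_shear contDiff_const (by simp)
  exact this.continuous.aestronglyMeasurable

theorem fderiv_smoothed_apply (hp : Integrable (fun y => ‖y‖ ^ 2) p) (z z' : E n × ℝ) :
    fderiv ℝ (smoothed p) z z' =
      ∫ y, -(stdDensity (z.1 - z.2 • y) * inner ℝ (z.1 - z.2 • y) (z'.1 - z'.2 • y)) ∂p := by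
  obtain ⟨C, -, hC⟩ := norm_fderiv_stdDensity_shear_le (n := n)
  obtain ⟨C₀, -, hC₀⟩ := norm_iteratedFDeriv_stdDensity_shear_le (n := n) 0
  have h := hasFDerivAt_integral_of_contDiff (μ := p)
    (h := fun (y : E n) (z : E n × ℝ) => stdDensity (z.1 - z.2 • y))
    (contDiff_uncurry_stdDensity_shear.of_le (by exact_mod_cast le_top))
    (integrable_const C₀)
    ((integrable_one_add_norm_pow hp one_le_two).const_mul C)
    (fun y z => by simpa using hC₀ y z) (fun y z => by simpa using hC y z) z
  have h2 : fderiv ℝ (smoothed p) z = _ := h.fderiv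
  rw [h2, ContinuousLinearMap.integral_apply (integrable_fderiv_stdDensity_shear hp z)]
  refine integral_congr_ae (Eventually.of_forall fun y => ?_)
  simp only [fderiv_stdDensity_shear, ContinuousLinearMap.comp_apply, fderiv_stdDensity_apply,
    shear_apply]

theorem integrable_stdDensity_mul_inner_shear (hp : Integrable (fun y => ‖y‖ ^ 2) p)
    (z z' : E n × ℝ) : Integrable (fun y =>
      -(stdDensity (z.1 - z.2 • y) * inner ℝ (z.1 - z.2 • y) (z'.1 - z'.2 • y))) p := by
  have := (integrable_fderiv_stdDensity_shear hp z).apply_continuousLinearMap z'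
  simpa only [fderiv_stdDensity_shear, ContinuousLinearMap.comp_apply, fderiv_stdDensity_apply,
    shear_apply] using this

theorem smoothed_pos (z : E n × ℝ) : 0 < smoothed p z := by
  refine (integral_pos_iff_support_of_nonneg (fun y => (stdDensity_pos _).le)
    (integrable_stdDensity_shear z)).2 ?_
  rw [show Function.support (fun y => stdDensity (z.1 - z.2 • y)) = univ from
    eq_univ_of_forall fun y => (stdDensity_pos _).ne']
  simp

/-- Derivatives in x alone produce no factor of y, hence smoothness of every order without moments.
This is what makes ρ̄(·, t)⁻¹ times a test field again a test field. -/
theorem contDiff_smoothed_left (u v : ℝ) :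
    ContDiff ℝ (⊤ : ℕ∞) fun x : E n => smoothed p (u • x, v) := by
  choose C hC using exists_norm_iteratedFDeriv_stdDensity_le (n := n)
  refine contDiff_infty.2 fun k => ?_
  have hC0 : ∀ i, 0 ≤ C i := fun i => (norm_nonneg _).trans (hC i 0)
  refine contDiff_integral_of_dominated k (h := fun (y x : E n) => stdDensity (u • x - v • y))
    (B := fun i _ => C i * ‖u • ContinuousLinearMap.id ℝ (E n)‖ ^ i) ?_
    (fun i _ => integrable_const _) fun i _ y x => ?_
  · refine (contDiff_stdDensity.of_le (by exact_mod_cast le_top)).comp ?_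
    exact (contDiff_snd.const_smul u).sub (contDiff_fst.const_smul v)
  · have hs : ContDiff ℝ (⊤ : ℕ∞) fun w : E n => stdDensity (w - v • y) :=
      contDiff_stdDensity.comp (contDiff_id.sub contDiff_const)
    refine (norm_iteratedFDeriv_comp_clm_le (u • ContinuousLinearMap.id ℝ (E n)) hs i x).trans ?_
    rw [iteratedFDeriv_comp_sub]
    gcongr
    exact hC i _

/-- The logarithm of `smoothed`. -/
def logSmoothed (p : Measure (E n)) (z : E n × ℝ) : ℝ := Real.log (smoothed p z)

theorem contDiff_logSmoothed (hp : Integrable (fun y => ‖y‖ ^ 2) p) :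
    ContDiff ℝ 2 (logSmoothed p) :=
  (contDiff_smoothed hp).log fun z => (smoothed_pos z).ne'

theorem fderiv_logSmoothed (hp : Integrable (fun y => ‖y‖ ^ 2) p) (z : E n × ℝ) :
    fderiv ℝ (logSmoothed p) z = (smoothed p z)⁻¹ • fderiv ℝ (smoothed p) z :=
  (((contDiff_smoothed hp).differentiable two_ne_zero z).hasFDerivAt.log
    (smoothed_pos z).ne').fderiv

end Smoothing

/-! ### The marginal homotopy as a rescaled Gaussian smoothing -/

namespace Params

variable {n : ℕ} (P : Params n)

/-- The precision of the conditional homotopy. -/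
def precision (t : ℝ) : ℝ := P.α t / P.ω ^ 2 + P.β t / P.ν ^ 2

/-- The inverse standard deviation of the conditional homotopy. -/
def scale (t : ℝ) : ℝ := √(P.precision t)

/-- The coefficient of the data point in the standardized variable. -/
def shift (t : ℝ) : ℝ := P.β t / P.ν ^ 2 / P.scale t

/-- The derivative of `scale`. -/
def scaleDeriv (t : ℝ) : ℝ :=
  (derivWithin P.α (Icc 0 1) t / P.ω ^ 2 + derivWithin P.β (Icc 0 1) t / P.ν ^ 2) /
    (2 * P.scale t)

/-- The derivative of `shift`. -/
def shiftDeriv (t : ℝ) : ℝ :=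
  derivWithin P.β (Icc 0 1) t / P.ν ^ 2 / P.scale t - P.shift t * P.scaleDeriv t / P.scale t

/-- The derivative in time of the logarithm of the marginal homotopy. -/
def logDensityRate (x : E n) (t : ℝ) : ℝ :=
  n * P.scaleDeriv t / P.scale t +
    fderiv ℝ (logSmoothed P.pdata) (P.scale t • x, P.shift t)
      (P.scaleDeriv t • x, P.shiftDeriv t)

/-- The score as a linear functional. -/
def score (x : E n) (t : ℝ) : E n →L[ℝ] ℝ :=
  (fderiv ℝ (logSmoothed P.pdata) (P.scale t • x, P.shift t)).comp
    (P.scale t • ContinuousLinearMap.inl ℝ (E n) ℝ)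

theorem score_apply (x η : E n) (t : ℝ) : P.score x t η =
    fderiv ℝ (logSmoothed P.pdata) (P.scale t • x, P.shift t) (P.scale t • η, 0) := by
  rw [score, ContinuousLinearMap.comp_apply]
  simp only [smul_apply, ContinuousLinearMap.inl_apply, Prod.smul_mk, smul_zero]

namespace Valid

variable {P} (hP : P.Valid)
include hP

theorem precision_pos {t : ℝ} (ht : t ∈ Icc (0 : ℝ) 1) : 0 < P.precision t := by
  have h1 := hP.α_nonneg t ht
  have h2 := hP.β_nonneg t ht
  have h3 := hP.sum_pos t ht
  have hω := hP.ω_pos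
  have hν := hP.ν_pos
  unfold precision
  rcases h1.eq_or_lt with h | h
  · have : 0 < P.β t := by linarith
    positivity
  · positivity

theorem scale_pos {t : ℝ} (ht : t ∈ Icc (0 : ℝ) 1) : 0 < P.scale t :=
  Real.sqrt_pos.2 (hP.precision_pos ht)

theorem scale_sq {t : ℝ} (ht : t ∈ Icc (0 : ℝ) 1) :
    P.scale t ^ 2 = P.α t / P.ω ^ 2 + P.β t / P.ν ^ 2 :=
  Real.sq_sqrt (hP.precision_pos ht).le

theorem scale_mul_shift {t : ℝ} (ht : t ∈ Icc (0 : ℝ) 1) :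
    P.scale t * P.shift t = P.β t / P.ν ^ 2 :=
  mul_div_cancel₀ _ (hP.scale_pos ht).ne'

theorem scale_mul_scaleDeriv {t : ℝ} (ht : t ∈ Icc (0 : ℝ) 1) :
    2 * P.scale t * P.scaleDeriv t =
      derivWithin P.α (Icc 0 1) t / P.ω ^ 2 + derivWithin P.β (Icc 0 1) t / P.ν ^ 2 := by
  have := hP.scale_pos ht
  exact mul_div_cancel₀ _ (by positivity)

theorem scale_mul_shiftDeriv {t : ℝ} (ht : t ∈ Icc (0 : ℝ) 1) :
    P.scale t * P.shiftDeriv t + P.shift t * P.scaleDeriv t =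
      derivWithin P.β (Icc 0 1) t / P.ν ^ 2 := by
  have := hP.scale_pos ht
  unfold shiftDeriv
  field_simp
  ring

theorem hasDerivWithinAt_scale {t : ℝ} (ht : t ∈ Icc (0 : ℝ) 1) :
    HasDerivWithinAt P.scale (P.scaleDeriv t) (Icc 0 1) t := by
  have hα := (hP.α_smooth.differentiableOn one_ne_zero t ht).hasDerivWithinAt
  have hβ := (hP.β_smooth.differentiableOn one_ne_zero t ht).hasDerivWithinAt
  exact ((hα.div_const _).add (hβ.div_const _)).sqrt (hP.precision_pos ht).ne'

theorem hasDerivWithinAt_shift {t : ℝ} (ht : t ∈ Icc (0 : ℝ) 1) :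
    HasDerivWithinAt P.shift (P.shiftDeriv t) (Icc 0 1) t := by
  have hβ := (hP.β_smooth.differentiableOn one_ne_zero t ht).hasDerivWithinAt
  have hs := hP.scale_pos ht
  refine ((hβ.div_const _).div (hP.hasDerivWithinAt_scale ht) hs.ne').congr_deriv ?_
  rw [shiftDeriv, shift]
  field_simp

theorem continuousOn_scale : ContinuousOn P.scale (Icc 0 1) :=
  fun _ ht => (hP.hasDerivWithinAt_scale ht).continuousWithinAt

theorem continuousOn_shift : ContinuousOn P.shift (Icc 0 1) :=
  fun _ ht => (hP.hasDerivWithinAt_shift ht).continuousWithinAt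

theorem continuousOn_scaleDeriv : ContinuousOn P.scaleDeriv (Icc 0 1) := by
  have hα := hP.α_smooth.continuousOn_derivWithin (uniqueDiffOn_Icc zero_lt_one) le_rfl
  have hβ := hP.β_smooth.continuousOn_derivWithin (uniqueDiffOn_Icc zero_lt_one) le_rfl
  refine ((hα.div_const _).add (hβ.div_const _)).div
    (continuousOn_const.mul hP.continuousOn_scale) fun t ht => ?_
  have := hP.scale_pos ht
  positivity

theorem continuousOn_shiftDeriv : ContinuousOn P.shiftDeriv (Icc 0 1) := by
  have hβ := hP.β_smooth.continuousOn_derivWithin (uniqueDiffOn_Icc zero_lt_one) le_rfl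
  have h0 : ∀ t ∈ Icc (0 : ℝ) 1, P.scale t ≠ 0 := fun t ht => (hP.scale_pos ht).ne'
  exact ((hβ.div_const _).div hP.continuousOn_scale h0).sub
    ((hP.continuousOn_shift.mul hP.continuousOn_scaleDeriv).div hP.continuousOn_scale h0)

/-- Completing the square in x. The factor `K` depends on y and t only, so it disappears on
normalization. -/
theorem exists_exp_logHomotopy_eq {t : ℝ} (ht : t ∈ Icc (0 : ℝ) 1) (y : E n) : ∃ K > 0, ∀ x,
    Real.exp (P.logHomotopy x y t) = K * stdDensity (P.scale t • x - P.shift t • y) := by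
  have hω := hP.ω_pos
  have hν := hP.ν_pos
  set c₁ : ℝ := (2 * Real.pi * P.ω ^ 2) ^ (-(n : ℝ) / 2) with hc₁
  set c₂ : ℝ := (2 * Real.pi * P.ν ^ 2) ^ (-(n : ℝ) / 2) with hc₂
  set c : ℝ := (2 * Real.pi) ^ (-(n : ℝ) / 2) with hc
  have hc₁0 : 0 < c₁ := by positivity
  have hc₂0 : 0 < c₂ := by positivity
  have hc0 : 0 < c := by positivity
  refine ⟨c⁻¹ * Real.exp (P.α t * Real.log c₁ + P.β t * Real.log c₂ -
    P.β t / P.ν ^ 2 * ‖y‖ ^ 2 / 2 + P.shift t ^ 2 * ‖y‖ ^ 2 / 2), by positivity, fun x => ?_⟩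
  have h1 : Real.log (gaussianDensity 0 P.ω x) = Real.log c₁ - ‖x‖ ^ 2 / (2 * P.ω ^ 2) := by
    rw [gaussianDensity, Real.log_mul hc₁0.ne' (Real.exp_pos _).ne', Real.log_exp, sub_zero]
    ring
  have h2 : Real.log (gaussianDensity x P.ν y) = Real.log c₂ - ‖y - x‖ ^ 2 / (2 * P.ν ^ 2) := by
    rw [gaussianDensity, Real.log_mul hc₂0.ne' (Real.exp_pos _).ne', Real.log_exp]
    ring
  have h3 : ‖y - x‖ ^ 2 = ‖x‖ ^ 2 - 2 * inner ℝ x y + ‖y‖ ^ 2 := by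
    rw [norm_sub_rev, norm_sub_sq_real]
  have h4 : ‖P.scale t • x - P.shift t • y‖ ^ 2 = P.scale t ^ 2 * ‖x‖ ^ 2 -
      2 * (P.scale t * P.shift t) * inner ℝ x y + P.shift t ^ 2 * ‖y‖ ^ 2 := by
    rw [norm_sub_sq_real, norm_smul, norm_smul, inner_smul_left, inner_smul_right, mul_pow,
      mul_pow, Real.norm_eq_abs, Real.norm_eq_abs, sq_abs, sq_abs]
    simp
    ring
  rw [stdDensity, ← hc, mul_assoc, mul_left_comm (Real.exp _), inv_mul_cancel_left₀ hc0.ne',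
    ← Real.exp_add]
  congr 1
  rw [logHomotopy, h1, h2, h3, h4, hP.scale_sq ht, hP.scale_mul_shift ht]
  field_simp
  ring

theorem condDensity_eq {t : ℝ} (ht : t ∈ Icc (0 : ℝ) 1) (x y : E n) :
    P.condDensity x y t = P.scale t ^ n * stdDensity (P.scale t • x - P.shift t • y) := by
  obtain ⟨K, hK, h⟩ := hP.exists_exp_logHomotopy_eq ht y
  have hs := hP.scale_pos ht
  have hi : ∫ x', Real.exp (P.logHomotopy x' y t) = K * (P.scale t ^ n)⁻¹ := by
    simp_rw [h]
    rw [integral_const_mul, integral_comp_smul_sub hs stdDensity, integral_stdDensity, mul_one]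
  rw [condDensity, h, hi]
  field_simp

theorem marginalDensity_eq {t : ℝ} (ht : t ∈ Icc (0 : ℝ) 1) (x : E n) :
    P.marginalDensity x t = P.scale t ^ n * smoothed P.pdata (P.scale t • x, P.shift t) := by
  simp_rw [marginalDensity, hP.condDensity_eq ht]
  rw [integral_const_mul, smoothed]

theorem marginalDensity_pos {t : ℝ} (ht : t ∈ Icc (0 : ℝ) 1) (x : E n) :
    0 < P.marginalDensity x t := by
  have := hP.prob
  rw [hP.marginalDensity_eq ht]
  exact mul_pos (pow_pos (hP.scale_pos ht) n) (smoothed_pos _)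

theorem contDiff_marginalDensity {t : ℝ} (ht : t ∈ Icc (0 : ℝ) 1) :
    ContDiff ℝ (⊤ : ℕ∞) fun x => P.marginalDensity x t := by
  have := hP.prob
  simp_rw [hP.marginalDensity_eq ht]
  exact contDiff_const.mul (contDiff_smoothed_left _ _)

/-! ### The source term is minus the time derivative -/

/-- The coefficient of ‖y‖² is left unsimplified: it does not involve w, so it recurs verbatim in
the mean innovation and cancels in the difference. -/
theorem innovation_eq {t : ℝ} (ht : t ∈ Icc (0 : ℝ) 1) (x y w : E n)
    (hw : w = P.scale t • x - P.shift t • y) :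
    P.innovation x y t = 2 * P.scaleDeriv t / P.scale t * ‖w‖ ^ 2 +
      2 * (P.scaleDeriv t * P.shift t / P.scale t - P.shiftDeriv t) * inner ℝ w y +
      (2 * P.scaleDeriv t * P.shift t ^ 2 / P.scale t -
        2 * (P.scale t * P.shiftDeriv t + P.shift t * P.scaleDeriv t) * P.shift t / P.scale t +
        (P.scale t * P.shiftDeriv t + P.shift t * P.scaleDeriv t)) * ‖y‖ ^ 2 := by
  have hs := hP.scale_pos ht
  have hB := hP.scale_mul_shiftDeriv ht
  have hA : derivWithin P.α (Icc 0 1) t / P.ω ^ 2 = 2 * P.scale t * P.scaleDeriv t -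
      (P.scale t * P.shiftDeriv t + P.shift t * P.scaleDeriv t) := by
    rw [hP.scale_mul_scaleDeriv ht, hB]
    ring
  have hx : x = (P.scale t)⁻¹ • (w + P.shift t • y) := by
    rw [hw, sub_add_cancel, inv_smul_smul₀ hs.ne']
  have h1 : ‖x‖ ^ 2 = (P.scale t ^ 2)⁻¹ *
      (‖w‖ ^ 2 + 2 * P.shift t * inner ℝ w y + P.shift t ^ 2 * ‖y‖ ^ 2) := by
    rw [hx, norm_smul, mul_pow, norm_add_sq_real, norm_smul, mul_pow, inner_smul_right,
      Real.norm_eq_abs, Real.norm_eq_abs, sq_abs, sq_abs, inv_pow]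
    ring
  have h2 : inner ℝ x y = (P.scale t)⁻¹ * (inner ℝ w y + P.shift t * ‖y‖ ^ 2) := by
    rw [hx, inner_smul_left, inner_add_left, inner_smul_left, real_inner_self_eq_norm_sq]
    simp
  rw [innovation, ← hB, hA, norm_sub_sq_real, h1, h2]
  field_simp
  ring

/-- Under ρ(· | y, t) the variable w is standard Gaussian: ‖w‖² has mean n and ⟨w, y⟩ has mean 0. -/
theorem meanInnovation_eq {t : ℝ} (ht : t ∈ Icc (0 : ℝ) 1) (y : E n) :
    P.meanInnovation y t = 2 * P.scaleDeriv t / P.scale t * n +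
      (2 * P.scaleDeriv t * P.shift t ^ 2 / P.scale t -
        2 * (P.scale t * P.shiftDeriv t + P.shift t * P.scaleDeriv t) * P.shift t / P.scale t +
        (P.scale t * P.shiftDeriv t + P.shift t * P.scaleDeriv t)) * ‖y‖ ^ 2 := by
  have hs := hP.scale_pos ht
  set a := 2 * P.scaleDeriv t / P.scale t
  set b := 2 * (P.scaleDeriv t * P.shift t / P.scale t - P.shiftDeriv t)
  set c := (2 * P.scaleDeriv t * P.shift t ^ 2 / P.scale t -
        2 * (P.scale t * P.shiftDeriv t + P.shift t * P.scaleDeriv t) * P.shift t / P.scale t +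
        (P.scale t * P.shiftDeriv t + P.shift t * P.scaleDeriv t)) * ‖y‖ ^ 2
  have h1 : ∀ x, P.condDensity x y t * P.innovation x y t =
      (fun w => P.scale t ^ n * (a * (‖w‖ ^ 2 * stdDensity w) +
        b * (inner ℝ w y * stdDensity w) + c * stdDensity w))
        (P.scale t • x - P.shift t • y) := by
    intro x
    rw [hP.condDensity_eq ht, hP.innovation_eq ht x y _ rfl]
    ring
  rw [meanInnovation, integral_congr_ae (Eventually.of_forall h1),
    integral_comp_smul_sub hs fun w => P.scale t ^ n * (a * (‖w‖ ^ 2 * stdDensity w) +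
        b * (inner ℝ w y * stdDensity w) + c * stdDensity w), integral_const_mul, integral_add, integral_add,
    integral_const_mul, integral_const_mul, integral_const_mul,
    integral_norm_sq_mul_stdDensity, integral_inner_mul_stdDensity, integral_stdDensity]
  · field_simp
    ring
  · exact integrable_norm_sq_mul_stdDensity.const_mul _
  · exact (integrable_inner_mul_stdDensity y).const_mul _
  · exact (integrable_norm_sq_mul_stdDensity.const_mul _).add
      ((integrable_inner_mul_stdDensity y).const_mul _)
  · exact integrable_stdDensity.const_mul _

theorem innovation_sub_meanInnovation {t : ℝ} (ht : t ∈ Icc (0 : ℝ) 1) (x y w : E n)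
    (hw : w = P.scale t • x - P.shift t • y) :
    P.innovation x y t - P.meanInnovation y t = 2 * P.scaleDeriv t / P.scale t * (‖w‖ ^ 2 - n) +
      2 * (P.scaleDeriv t * P.shift t / P.scale t - P.shiftDeriv t) * inner ℝ w y := by
  rw [hP.innovation_eq ht x y w hw, hP.meanInnovation_eq ht]
  ring

/-- The bracket is the time derivative of log(uⁿ g(u x − v y)), that is, of log ρ(x | y, t). -/
theorem innovation_sub_meanInnovation' {t : ℝ} (ht : t ∈ Icc (0 : ℝ) 1) (x y : E n) :
    P.innovation x y t - P.meanInnovation y t = -2 * (n * P.scaleDeriv t / P.scale t -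
      inner ℝ (P.scale t • x - P.shift t • y) (P.scaleDeriv t • x - P.shiftDeriv t • y)) := by
  have hs := hP.scale_pos ht
  set w := P.scale t • x - P.shift t • y with hw
  have hx : x = (P.scale t)⁻¹ • (w + P.shift t • y) := by
    rw [hw, sub_add_cancel, inv_smul_smul₀ hs.ne']
  rw [hP.innovation_sub_meanInnovation ht x y w hw]
  have h1 : inner ℝ w (P.scaleDeriv t • x - P.shiftDeriv t • y) = P.scaleDeriv t / P.scale t *
      (‖w‖ ^ 2 + P.shift t * inner ℝ w y) - P.shiftDeriv t * inner ℝ w y := by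
    rw [inner_sub_right, inner_smul_right, inner_smul_right, hx, inner_smul_right,
      inner_add_right, inner_smul_right, real_inner_self_eq_norm_sq]
    ring
  rw [h1]
  ring

/-- Averaging −½ρ(γ − γ̄) = ∂ₜρ over the data identifies the source with −∂ₜρ̄, so (P) is a
continuity equation. -/
theorem source_eq {t : ℝ} (ht : t ∈ Icc (0 : ℝ) 1) (x : E n) :
    P.source x t = -(P.marginalDensity x t * P.logDensityRate x t) := by
  have := hP.prob
  have hp := hP.moment
  have hs := hP.scale_pos ht
  have hS := smoothed_pos (p := P.pdata) (P.scale t • x, P.shift t)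
  have h1 : ∀ y, P.condDensity x y t * (P.innovation x y t - P.meanInnovation y t) =
      -2 * P.scale t ^ n * (n * P.scaleDeriv t / P.scale t *
        stdDensity (P.scale t • x - P.shift t • y) +
        -(stdDensity (P.scale t • x - P.shift t • y) * inner ℝ (P.scale t • x - P.shift t • y)
          (P.scaleDeriv t • x - P.shiftDeriv t • y))) := by
    intro y
    rw [hP.condDensity_eq ht, hP.innovation_sub_meanInnovation' ht]
    ring
  have hi1 := integrable_stdDensity_shear (p := P.pdata) (P.scale t • x, P.shift t)
  have hi2 := integrable_stdDensity_mul_inner_shear hp (P.scale t • x, P.shift t)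
    (P.scaleDeriv t • x, P.shiftDeriv t)
  have h2 := fderiv_smoothed_apply hp (P.scale t • x, P.shift t)
    (P.scaleDeriv t • x, P.shiftDeriv t)
  simp only at hi1 hi2 h2
  rw [source]
  simp_rw [h1]
  rw [integral_const_mul, integral_add (hi1.const_mul _) hi2, integral_const_mul, ← h2,
    logDensityRate, hP.marginalDensity_eq ht, fderiv_logSmoothed hp]
  rw [show ∫ y, stdDensity (P.scale t • x - P.shift t • y) ∂P.pdata =
    smoothed P.pdata (P.scale t • x, P.shift t) from rfl]
  simp only [smul_apply, smul_eq_mul]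
  field_simp

end Valid

end Params

/-! ### Fubini in the standardized variable -/

section Shear

variable {n : ℕ} {p : Measure (E n)} [IsProbabilityMeasure p]

theorem integrable_prod_of_continuous {V W : Type*} [TopologicalSpace V] [TopologicalSpace W]
    [SecondCountableTopology V] [SecondCountableTopology W] [MeasurableSpace V] [BorelSpace V]
    [MeasurableSpace W] [BorelSpace W] {μ : Measure V} {ν : Measure W} [SFinite μ] [SFinite ν]
    {f : V × W → ℝ} (hf : Continuous f) (hi : ∀ y, Integrable (fun x => f (x, y)) μ)
    {B : W → ℝ} (hB : Integrable B ν) (hb : ∀ y, ∫ x, ‖f (x, y)‖ ∂μ ≤ B y) :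
    Integrable f (μ.prod ν) := by
  have hm : AEStronglyMeasurable f (μ.prod ν) := hf.aestronglyMeasurable
  rw [integrable_prod_iff' hm]
  refine ⟨Eventually.of_forall hi, hB.mono' ?_ (Eventually.of_forall fun y => ?_)⟩
  · exact hm.norm.prod_swap.integral_prod_right'
  · rw [Real.norm_of_nonneg (integral_nonneg fun _ => norm_nonneg _)]
    exact hb y

/-- Fubini's theorem in the variables `w = u x - v y` and `y`. -/
theorem integral_integral_comp_shear (hp : Integrable (fun y => ‖y‖ ^ 2) p) {u : ℝ} (hu : 0 < u)
    (v : ℝ) {F : E n → E n → ℝ} (hF : Continuous (Function.uncurry F))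
    (hi : ∀ y, Integrable fun w => F w y) {C : ℝ} (hC : ∀ y, ∫ w, ‖F w y‖ ≤ C * (1 + ‖y‖)) :
    Integrable (fun x => ∫ y, F (u • x - v • y) y ∂p) ∧
      ∫ x, ∫ y, F (u • x - v • y) y ∂p = (u ^ n)⁻¹ * ∫ y, (∫ w, F w y) ∂p := by
  have hcont : Continuous fun z : E n × E n => F (u • z.1 - v • z.2) z.2 :=
    hF.comp (by fun_prop : Continuous fun z : E n × E n => (u • z.1 - v • z.2, z.2))
  have hint : Integrable (fun z : E n × E n => F (u • z.1 - v • z.2) z.2)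
      ((volume : Measure (E n)).prod p) := by
    have h1 := (integrable_one_add_norm_pow hp one_le_two).const_mul ((u ^ n)⁻¹ * C)
    refine integrable_prod_of_continuous hcont
      (fun y => integrable_comp_smul_sub hu (hi y) (v • y)) h1 fun y => ?_
    have h2 := integral_comp_smul_sub hu (fun w => ‖F w y‖) (v • y)
    refine h2.le.trans ?_
    rw [mul_assoc, pow_one]
    exact mul_le_mul_of_nonneg_left (hC y) (by positivity)
  refine ⟨hint.integral_prod_left, ?_⟩
  rw [integral_integral_swap hint, ← integral_const_mul]
  refine integral_congr_ae (Eventually.of_forall fun y => ?_)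
  exact integral_comp_smul_sub hu (fun w => F w y) _

end Shear

namespace Params

variable {n : ℕ} {P : Params n}

/-- The derivative of the score along a trajectory through `x` with velocity `V`. -/
def scoreDeriv (P : Params n) (x V η : E n) (t : ℝ) : ℝ :=
  fderiv ℝ (fderiv ℝ (logSmoothed P.pdata)) (P.scale t • x, P.shift t)
      (P.scaleDeriv t • x + P.scale t • V, P.shiftDeriv t) (P.scale t • η, 0) +
    fderiv ℝ (logSmoothed P.pdata) (P.scale t • x, P.shift t) (P.scaleDeriv t • η, 0)

namespace Valid

variable (hP : P.Valid)
include hP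

/-! ### Mass conservation -/

theorem integrable_marginalDensity {t : ℝ} (ht : t ∈ Icc (0 : ℝ) 1) :
    Integrable (fun x => P.marginalDensity x t) ∧ ∫ x, P.marginalDensity x t = 1 := by
  have := hP.prob
  have hs := hP.scale_pos ht
  have h := integral_integral_comp_shear (p := P.pdata) hP.moment hs (P.shift t)
    (F := fun w _ => P.scale t ^ n * stdDensity w) (C := P.scale t ^ n)
    (continuous_const.mul (continuous_stdDensity.comp continuous_fst))
    (fun _ => integrable_stdDensity.const_mul _) (fun y => by
      simp_rw [norm_mul, Real.norm_of_nonneg (stdDensity_pos _).le]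
      rw [integral_const_mul, integral_stdDensity, Real.norm_of_nonneg (by positivity)]
      gcongr
      linarith [norm_nonneg y])
  simp_rw [marginalDensity, hP.condDensity_eq ht]
  refine ⟨h.1, h.2.trans ?_⟩
  simp_rw [integral_const_mul, integral_stdDensity]
  simp
  field_simp

theorem isProbabilityMeasure_marginalLaw {t : ℝ} (ht : t ∈ Icc (0 : ℝ) 1) :
    IsProbabilityMeasure (P.marginalLaw t) := by
  constructor
  obtain ⟨h1, h2⟩ := hP.integrable_marginalDensity ht
  rw [marginalLaw, withDensity_apply _ MeasurableSet.univ, Measure.restrict_univ,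
    ← ofReal_integral_eq_lintegral_ofReal h1
      (Eventually.of_forall fun x => (hP.marginalDensity_pos ht x).le), h2, ENNReal.ofReal_one]

/-- For each y the integrand is the Gaussian density times a(‖w‖² − n) + b⟨w, y⟩, which has Gaussian
mean zero. Its L¹ norm grows at most linearly in ‖y‖, so the data moments justify Fubini. -/
theorem integrable_source {t : ℝ} (ht : t ∈ Icc (0 : ℝ) 1) :
    Integrable (fun x => P.source x t) ∧ ∫ x, P.source x t = 0 := by
  have := hP.prob
  have hs := hP.scale_pos ht
  obtain ⟨a, ha⟩ : ∃ a, a = 2 * P.scaleDeriv t / P.scale t := ⟨_, rfl⟩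
  obtain ⟨b, hb⟩ : ∃ b, b = 2 * (P.scaleDeriv t * P.shift t / P.scale t - P.shiftDeriv t) :=
    ⟨_, rfl⟩
  have hi : ∀ y : E n, Integrable fun w : E n =>
      a * (‖w‖ ^ 2 * stdDensity w) - a * n * stdDensity w + b * (inner ℝ w y * stdDensity w) :=
    fun y => ((integrable_norm_sq_mul_stdDensity.const_mul a).sub
      (integrable_stdDensity.const_mul (a * n))).add
      ((integrable_inner_mul_stdDensity y).const_mul b)
  have h := integral_integral_comp_shear (p := P.pdata) hP.moment hs (P.shift t)
    (F := fun w y => P.scale t ^ n * (a * (‖w‖ ^ 2 * stdDensity w) - a * n * stdDensity w +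
      b * (inner ℝ w y * stdDensity w)))
    (C := P.scale t ^ n * (|a| * n + |a| * n + |b| * ∫ w : E n, ‖w‖ * stdDensity w)) (by
      have h1 : Continuous fun z : E n × E n => stdDensity z.1 :=
        continuous_stdDensity.comp continuous_fst
      unfold Function.uncurry
      fun_prop)
    (fun y => (hi y).const_mul _) (fun y => by
      simp_rw [norm_mul (P.scale t ^ n), Real.norm_of_nonneg (pow_pos hs n).le]
      rw [integral_const_mul, mul_assoc]
      refine mul_le_mul_of_nonneg_left ?_ (by positivity)
      have hI0 : 0 ≤ ∫ w : E n, ‖w‖ * stdDensity w :=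
        integral_nonneg fun w => mul_nonneg (norm_nonneg _) (stdDensity_pos w).le
      have hb : ∀ w : E n, ‖a * (‖w‖ ^ 2 * stdDensity w) - a * n * stdDensity w +
          b * (inner ℝ w y * stdDensity w)‖ ≤ |a| * (‖w‖ ^ 2 * stdDensity w) +
          |a| * n * stdDensity w + |b| * ‖y‖ * (‖w‖ * stdDensity w) := by
        intro w
        have h0 := (stdDensity_pos w).le
        refine (norm_add_le _ _).trans (add_le_add ((norm_sub_le _ _).trans (add_le_add ?_ ?_)) ?_)
        · rw [norm_mul, Real.norm_of_nonneg (by positivity : 0 ≤ ‖w‖ ^ 2 * stdDensity w)]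
          rfl
        · rw [norm_mul, norm_mul, Real.norm_of_nonneg h0, Real.norm_natCast]
          rfl
        · rw [norm_mul, norm_mul, Real.norm_of_nonneg h0, Real.norm_eq_abs b, mul_assoc]
          refine mul_le_mul_of_nonneg_left ?_ (abs_nonneg _)
          rw [← mul_assoc, mul_comm ‖y‖]
          exact mul_le_mul_of_nonneg_right (norm_inner_le_norm w y) h0
      have hi1 := (integrable_norm_sq_mul_stdDensity (n := n)).const_mul |a|
      have hi2 := (integrable_stdDensity (n := n)).const_mul (|a| * n)
      have hi3 := (integrable_norm_mul_stdDensity (n := n)).const_mul (|b| * ‖y‖)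
      have hi12 : Integrable fun w : E n =>
        |a| * (‖w‖ ^ 2 * stdDensity w) + |a| * n * stdDensity w := hi1.add hi2
      refine (integral_mono (hi y).norm (hi12.add hi3) hb).trans ?_
      have e : ∫ w : E n, (|a| * (‖w‖ ^ 2 * stdDensity w) + |a| * n * stdDensity w +
          |b| * ‖y‖ * (‖w‖ * stdDensity w)) =
          |a| * n + |a| * n + |b| * ‖y‖ * ∫ w : E n, ‖w‖ * stdDensity w := by
        rw [integral_add hi12 hi3, integral_add hi1 hi2, integral_const_mul,
          integral_const_mul, integral_const_mul, integral_norm_sq_mul_stdDensity,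
          integral_stdDensity, mul_one]
      refine e.le.trans ?_
      have h1 : 0 ≤ |b| * ∫ w : E n, ‖w‖ * stdDensity w := by positivity
      have h2 : 0 ≤ (|a| * n + |a| * n) * ‖y‖ := by positivity
      nlinarith)
  have hpt : ∀ x y, P.condDensity x y t * (P.innovation x y t - P.meanInnovation y t) =
      P.scale t ^ n * (a * (‖P.scale t • x - P.shift t • y‖ ^ 2 *
        stdDensity (P.scale t • x - P.shift t • y)) -
        a * n * stdDensity (P.scale t • x - P.shift t • y) +
        b * (inner ℝ (P.scale t • x - P.shift t • y) y *
          stdDensity (P.scale t • x - P.shift t • y))) := by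
    intro x y
    rw [hP.condDensity_eq ht, hP.innovation_sub_meanInnovation ht x y _ rfl, ← ha, ← hb]
    ring
  simp_rw [source, hpt]
  refine ⟨h.1.const_mul _, ?_⟩
  rw [integral_const_mul, h.2]
  have h0 : ∀ y : E n, ∫ w : E n, P.scale t ^ n * (a * (‖w‖ ^ 2 * stdDensity w) -
      a * n * stdDensity w + b * (inner ℝ w y * stdDensity w)) = 0 := by
    intro y
    have hi1 := (integrable_norm_sq_mul_stdDensity (n := n)).const_mul a
    have hi2 := (integrable_stdDensity (n := n)).const_mul (a * n)
    have hi12 : Integrable fun w : E n =>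
      a * (‖w‖ ^ 2 * stdDensity w) - a * n * stdDensity w := hi1.sub hi2
    rw [integral_const_mul, integral_add hi12
      ((integrable_inner_mul_stdDensity y).const_mul b), integral_sub hi1 hi2, integral_const_mul,
      integral_const_mul, integral_const_mul, integral_norm_sq_mul_stdDensity,
      integral_stdDensity, integral_inner_mul_stdDensity]
    ring
  simp [h0]

/-! ### Derivatives of the logarithm of the marginal density -/

theorem log_marginalDensity {t : ℝ} (ht : t ∈ Icc (0 : ℝ) 1) (x : E n) :
    Real.log (P.marginalDensity x t) =
      n * Real.log (P.scale t) + logSmoothed P.pdata (P.scale t • x, P.shift t) := by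
  have := hP.prob
  rw [hP.marginalDensity_eq ht, Real.log_mul (pow_pos (hP.scale_pos ht) n).ne'
    (smoothed_pos _).ne', Real.log_pow, logSmoothed]

theorem hasDerivWithinAt_point {γ : ℝ → E n} {γ' : E n} {t : ℝ} (ht : t ∈ Icc (0 : ℝ) 1)
    (hγ : HasDerivWithinAt γ γ' (Icc 0 1) t) :
    HasDerivWithinAt (fun s => (P.scale s • γ s, P.shift s))
      (P.scaleDeriv t • γ t + P.scale t • γ', P.shiftDeriv t) (Icc 0 1) t :=
  (((hP.hasDerivWithinAt_scale ht).smul hγ).congr_deriv (add_comm _ _)).prodMk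
    (hP.hasDerivWithinAt_shift ht)

theorem hasDerivWithinAt_log_marginalDensity {γ : ℝ → E n} {γ' : E n} {t : ℝ}
    (ht : t ∈ Icc (0 : ℝ) 1) (hγ : HasDerivWithinAt γ γ' (Icc 0 1) t) :
    HasDerivWithinAt (fun s => Real.log (P.marginalDensity (γ s) s))
      (P.score (γ t) t γ' + P.logDensityRate (γ t) t) (Icc 0 1) t := by
  have := hP.prob
  have h1 := ((contDiff_logSmoothed hP.moment).differentiable two_ne_zero
    (P.scale t • γ t, P.shift t)).hasFDerivAt.comp_hasDerivWithinAt t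
    (hP.hasDerivWithinAt_point ht hγ)
  have h2 := ((hP.hasDerivWithinAt_scale ht).log (hP.scale_pos ht).ne').const_mul (n : ℝ)
  refine ((h2.add h1).congr_of_mem (fun s hs => ?_) ht).congr_deriv ?_
  · exact hP.log_marginalDensity hs _
  · rw [score_apply, logDensityRate]
    have : (P.scaleDeriv t • γ t + P.scale t • γ', P.shiftDeriv t) =
      (P.scale t • γ', (0 : ℝ)) + (P.scaleDeriv t • γ t, P.shiftDeriv t) := by
      simp [add_comm]
    rw [this, map_add]
    ring

theorem hasDerivWithinAt_marginalDensity {t : ℝ} (ht : t ∈ Icc (0 : ℝ) 1) (x : E n) :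
    HasDerivWithinAt (fun s => P.marginalDensity x s) (-P.source x t) (Icc 0 1) t := by
  have h := (hP.hasDerivWithinAt_log_marginalDensity ht
    (hasDerivWithinAt_const t (Icc 0 1) x)).exp
  refine (h.congr_of_mem (fun s hs => ?_) ht).congr_deriv ?_
  · exact (Real.exp_log (hP.marginalDensity_pos hs x)).symm
  · rw [Real.exp_log (hP.marginalDensity_pos ht x), hP.source_eq ht]
    simp

theorem hasFDerivAt_log_marginalDensity {t : ℝ} (ht : t ∈ Icc (0 : ℝ) 1) (x : E n) :
    HasFDerivAt (fun x => Real.log (P.marginalDensity x t)) (P.score x t) x := by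
  have := hP.prob
  have hl : HasFDerivAt (fun x : E n => (P.scale t • x, P.shift t))
      (P.scale t • ContinuousLinearMap.inl ℝ (E n) ℝ) x := by
    refine (((hasFDerivAt_id x).const_smul (P.scale t)).prodMk
      (hasFDerivAt_const (P.shift t) x)).congr_fderiv ?_
    ext v <;> simp
  have h1 := ((contDiff_logSmoothed hP.moment).differentiable two_ne_zero
    (P.scale t • x, P.shift t)).hasFDerivAt.comp x hl
  simp_rw [hP.log_marginalDensity ht]
  exact h1.const_add _

theorem fderiv_marginalDensity {t : ℝ} (ht : t ∈ Icc (0 : ℝ) 1) (x : E n) :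
    fderiv ℝ (fun x => P.marginalDensity x t) x = P.marginalDensity x t • P.score x t := by
  have h := (hP.hasFDerivAt_log_marginalDensity ht x).exp
  simp_rw [Real.exp_log (hP.marginalDensity_pos ht _)] at h
  exact h.fderiv

theorem contDiff_fderiv_logSmoothed : ContDiff ℝ 1 (fderiv ℝ (logSmoothed P.pdata)) := by
  have := hP.prob
  exact (contDiff_logSmoothed hP.moment).fderiv_right (by norm_num)

theorem contDiff_score (t : ℝ) : ContDiff ℝ 1 fun x => P.score x t := by
  refine ContDiff.clm_comp ?_ contDiff_const
  exact hP.contDiff_fderiv_logSmoothed.comp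
    ((contDiff_id.const_smul (P.scale t)).prodMk contDiff_const)

theorem contDiff_logDensityRate (t : ℝ) : ContDiff ℝ 1 fun x => P.logDensityRate x t := by
  refine contDiff_const.add (ContDiff.clm_apply ?_ ?_)
  · exact hP.contDiff_fderiv_logSmoothed.comp
      ((contDiff_id.const_smul (P.scale t)).prodMk contDiff_const)
  · exact (contDiff_id.const_smul (P.scaleDeriv t)).prodMk contDiff_const

theorem hasDerivWithinAt_score {γ : ℝ → E n} {γ' : E n} {t : ℝ}
    (ht : t ∈ Icc (0 : ℝ) 1) (hγ : HasDerivWithinAt γ γ' (Icc 0 1) t) (η : E n) :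
    HasDerivWithinAt (fun s => P.score (γ s) s η) (P.scoreDeriv (γ t) γ' η t) (Icc 0 1) t := by
  simp_rw [score_apply]
  have h1 := (hP.contDiff_fderiv_logSmoothed.differentiable one_ne_zero
    (P.scale t • γ t, P.shift t)).hasFDerivAt.comp_hasDerivWithinAt t
    (hP.hasDerivWithinAt_point ht hγ)
  have h2 : HasDerivWithinAt (fun s => (P.scale s • η, (0 : ℝ))) (P.scaleDeriv t • η, 0)
      (Icc 0 1) t :=
    ((hP.hasDerivWithinAt_scale ht).smul_const η).prodMk (hasDerivWithinAt_const _ _ _)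
  exact h1.clm_apply h2

/-- The rate of change of the score at a moving point is the Hessian of log ρ̄ along `V` plus ∂ₜ∇log
ρ̄ = ∇∂ₜ log ρ̄. The exchange rests on the symmetry of the second derivative of `logSmoothed` in its
joint variables. -/
theorem scoreDeriv_eq (x V η : E n) (t : ℝ) : P.scoreDeriv x V η t =
    fderiv ℝ (fun x => P.score x t) x V η + fderiv ℝ (fun x => P.logDensityRate x t) x η := by
  have := hP.prob
  set z : E n × ℝ := (P.scale t • x, P.shift t) with hz
  have hD := (hP.contDiff_fderiv_logSmoothed.differentiable one_ne_zero z).hasFDerivAt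
  have hl : HasFDerivAt (fun x : E n => (P.scale t • x, P.shift t))
      (P.scale t • ContinuousLinearMap.inl ℝ (E n) ℝ) x := by
    refine (((hasFDerivAt_id x).const_smul (P.scale t)).prodMk
      (hasFDerivAt_const (P.shift t) x)).congr_fderiv ?_
    ext v <;> simp
  have hl' : HasFDerivAt (fun x : E n => (P.scaleDeriv t • x, P.shiftDeriv t))
      (P.scaleDeriv t • ContinuousLinearMap.inl ℝ (E n) ℝ) x := by
    refine (((hasFDerivAt_id x).const_smul (P.scaleDeriv t)).prodMk
      (hasFDerivAt_const (P.shiftDeriv t) x)).congr_fderiv ?_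
    ext v <;> simp
  have h1 := hD.comp x hl
  have h2 : HasFDerivAt (fun x => P.score x t) _ x := h1.clm_comp
    (hasFDerivAt_const (P.scale t • ContinuousLinearMap.inl ℝ (E n) ℝ) x)
  have h3 : HasFDerivAt (fun x => P.logDensityRate x t) _ x := (h1.clm_apply hl').const_add _
  have hsymm := ((contDiff_logSmoothed hP.moment).contDiffAt (x := z)).isSymmSndFDerivAt (by simp)
  rw [h2.fderiv, h3.fderiv, scoreDeriv]
  have e : (P.scaleDeriv t • x + P.scale t • V, P.shiftDeriv t) =
      (P.scaleDeriv t • x, P.shiftDeriv t) + P.scale t • (V, (0 : ℝ)) := by simp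
  have e2 : (P.scale t • η, (0 : ℝ)) = P.scale t • (η, (0 : ℝ)) := by simp
  have e3 : (P.scaleDeriv t • η, (0 : ℝ)) = P.scaleDeriv t • (η, (0 : ℝ)) := by simp
  rw [e, e2, e3, map_add]
  simp only [← hz, map_smul, add_apply, smul_apply, ContinuousLinearMap.comp_apply,
    ContinuousLinearMap.flip_apply, ContinuousLinearMap.compL_apply,
    ContinuousLinearMap.inl_apply, Function.comp_apply, smul_eq_mul,
    ContinuousLinearMap.comp_zero, zero_add]
  rw [hsymm.eq (P.scaleDeriv t • x, P.shiftDeriv t)]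
  ring

theorem continuousOn_logDensityRate :
    ContinuousOn (fun z : E n × ℝ => P.logDensityRate z.1 z.2) (univ ×ˢ Icc 0 1) := by
  have hsnd : MapsTo (Prod.snd : E n × ℝ → ℝ) (univ ×ˢ Icc 0 1) (Icc 0 1) := fun z hz => hz.2
  have hu := hP.continuousOn_scale.comp continuousOn_snd hsnd
  have hv := hP.continuousOn_shift.comp continuousOn_snd hsnd
  have hu' := hP.continuousOn_scaleDeriv.comp continuousOn_snd hsnd
  have hv' := hP.continuousOn_shiftDeriv.comp continuousOn_snd hsnd
  refine ContinuousOn.add ((continuousOn_const.mul hu').div hu fun z hz =>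
    (hP.scale_pos hz.2).ne') (ContinuousOn.clm_apply ?_ ?_)
  · exact hP.contDiff_fderiv_logSmoothed.continuous.comp_continuousOn
      ((hu.smul continuousOn_fst).prodMk hv)
  · exact (hu'.smul continuousOn_fst).prodMk hv'

theorem continuousOn_marginalDensity :
    ContinuousOn (fun z : E n × ℝ => P.marginalDensity z.1 z.2) (univ ×ˢ Icc 0 1) := by
  have := hP.prob
  have hsnd : MapsTo (Prod.snd : E n × ℝ → ℝ) (univ ×ˢ Icc 0 1) (Icc 0 1) := fun z hz => hz.2
  have hu := hP.continuousOn_scale.comp continuousOn_snd hsnd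
  have hv := hP.continuousOn_shift.comp continuousOn_snd hsnd
  refine ContinuousOn.congr ((hu.pow n).mul
    ((contDiff_smoothed hP.moment).continuous.comp_continuousOn
      ((hu.smul continuousOn_fst).prodMk hv))) fun z hz => ?_
  exact hP.marginalDensity_eq hz.2 z.1

theorem continuousOn_source :
    ContinuousOn (fun z : E n × ℝ => P.source z.1 z.2) (univ ×ˢ Icc 0 1) :=
  (hP.continuousOn_marginalDensity.mul hP.continuousOn_logDensityRate).neg.congr
    fun z hz => hP.source_eq hz.2 z.1

theorem continuousOn_scoreDeriv {Y : Type*} [TopologicalSpace Y] {x V η : Y → E n} {τ : Y → ℝ}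
    {s : Set Y} (hx : ContinuousOn x s) (hV : ContinuousOn V s) (hη : ContinuousOn η s)
    (hτ : ContinuousOn τ s) (hs : MapsTo τ s (Icc 0 1)) :
    ContinuousOn (fun y => P.scoreDeriv (x y) (V y) (η y) (τ y)) s := by
  have hu := hP.continuousOn_scale.comp hτ hs
  have hv := hP.continuousOn_shift.comp hτ hs
  have hu' := hP.continuousOn_scaleDeriv.comp hτ hs
  have hv' := hP.continuousOn_shiftDeriv.comp hτ hs
  have hz := (hu.smul hx).prodMk hv
  refine ContinuousOn.add (ContinuousOn.clm_apply (ContinuousOn.clm_apply ?_ ?_) ?_)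
    (ContinuousOn.clm_apply ?_ ?_)
  · exact (hP.contDiff_fderiv_logSmoothed.continuous_fderiv
      one_ne_zero).comp_continuousOn hz
  · exact ((hu'.smul hx).add (hu.smul hV)).prodMk hv'
  · exact (hu.smul hη).prodMk continuousOn_const
  · exact hP.contDiff_fderiv_logSmoothed.continuous.comp_continuousOn hz
  · exact (hu'.smul hη).prodMk continuousOn_const

end Valid

end Params

/-! ### The residual of the Poisson equation -/

section Residual

variable {n : ℕ} {P : Params n}

theorem contDiff_gradient {φ : E n → ℝ} (hφ : ContDiff ℝ 2 φ) : ContDiff ℝ 1 (gradient φ) :=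
  (InnerProductSpace.toDual ℝ (E n)).symm.contDiff.comp (hφ.fderiv_right (by norm_num))

/-- The residual of the Poisson equation for the velocity field `V`, relative to the density. -/
def residual (P : Params n) (t : ℝ) (V : E n → E n) (x : E n) : ℝ :=
  divergence V x + P.score x t (V x) + P.logDensityRate x t

theorem continuous_residual (hP : P.Valid) (t : ℝ) {V : E n → E n} (hV : ContDiff ℝ 1 V) :
    Continuous (residual P t V) :=
  ((continuous_divergence hV).add ((hP.contDiff_score t).continuous.clm_apply hV.continuous)).add
    (hP.contDiff_logDensityRate t).continuous

theorem divergence_sub_source (hP : P.Valid) {t : ℝ} (ht : t ∈ Icc (0 : ℝ) 1) {V : E n → E n}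
    (hV : Differentiable ℝ V) (x : E n) :
    divergence (fun y => P.marginalDensity y t • V y) x - P.source x t =
      P.marginalDensity x t * residual P t V x := by
  rw [divergence_smul ((hP.contDiff_marginalDensity ht).differentiable (by simp) x) (hV x),
    hP.fderiv_marginalDensity ht, hP.source_eq ht, residual]
  simp only [smul_apply, smul_eq_mul]
  ring

theorem solvesPoisson_iff (hP : P.Valid) {t : ℝ} (ht : t ∈ Icc (0 : ℝ) 1) {φ : E n → ℝ}
    (hφ : ContDiff ℝ 2 φ) : SolvesPoisson P t φ ↔ ∀ x, residual P t (gradient φ) x = 0 := by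
  refine forall_congr' fun x => ?_
  rw [← sub_eq_zero, divergence_sub_source hP ht
    ((contDiff_gradient hφ).differentiable one_ne_zero), mul_eq_zero]
  simp [(hP.marginalDensity_pos ht x).ne']

theorem integral_densityLaw {u : E n → ℝ} (hu : Measurable u) (hu0 : ∀ x, 0 ≤ u x)
    (f : E n → ℝ) : ∫ x, f x ∂(densityLaw u) = ∫ x, u x * f x := by
  have hm : Measurable fun x => ENNReal.ofReal (u x) := ENNReal.measurable_ofReal.comp hu
  rw [densityLaw, integral_withDensity_eq_integral_toReal_smul hm
    (Eventually.of_forall fun x => ENNReal.ofReal_lt_top)]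
  refine integral_congr_ae (Eventually.of_forall fun x => ?_)
  simp only [ENNReal.toReal_ofReal (hu0 x), smul_eq_mul]

theorem integral_marginalLaw (hP : P.Valid) {t : ℝ} (ht : t ∈ Icc (0 : ℝ) 1) (f : E n → ℝ) :
    ∫ x, f x ∂(P.marginalLaw t) = ∫ x, P.marginalDensity x t * f x :=
  integral_densityLaw (hP.contDiff_marginalDensity ht).continuous.measurable
    (fun x => (hP.marginalDensity_pos ht x).le) f

theorem integrable_marginalLaw_iff (hP : P.Valid) {t : ℝ} (ht : t ∈ Icc (0 : ℝ) 1)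
    (f : E n → ℝ) : Integrable f (P.marginalLaw t) ↔
      Integrable fun x => P.marginalDensity x t * f x := by
  have hm : Measurable fun x => ENNReal.ofReal (P.marginalDensity x t) :=
    ENNReal.measurable_ofReal.comp (hP.contDiff_marginalDensity ht).continuous.measurable
  rw [Params.marginalLaw, integrable_withDensity_iff_integrable_smul' hm
    (Eventually.of_forall fun x => ENNReal.ofReal_lt_top)]
  simp only [ENNReal.toReal_ofReal (hP.marginalDensity_pos ht _).le, smul_eq_mul]

end Residual

/-! ### Potential flows -/

namespace IsPotentialFlow

variable {n : ℕ} {P : Params n} {Φ : E n → ℝ → ℝ} {X : E n → ℝ → E n}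

theorem isC1Flow (h : IsPotentialFlow P Φ X) :
    IsC1Flow (fun x t => gradient (fun y => Φ y t) x)
      (fun x t => fderiv ℝ (gradient fun y => Φ y t) x) X where
  hasFDerivAt t ht x :=
    ((contDiff_gradient (h.smooth t ht)).differentiable one_ne_zero x).hasFDerivAt
  continuousOn_deriv := h.continuous_hessian
  start := h.start
  ode := h.ode

theorem differentiable (h : IsPotentialFlow P Φ X) {t : ℝ} (ht : t ∈ Icc (0 : ℝ) 1) :
    Differentiable ℝ fun x => X x t := fun x => by
  obtain ⟨J, -, hJ⟩ := h.isC1Flow.exists_jacobian x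
  exact (hJ t ht).1.differentiableAt

/-- Conservation of mass along a flow that solves the Poisson equation. -/
theorem marginalDensity_mul_det (hP : P.Valid) (h : IsPotentialFlow P Φ X)
    (hsol : ∀ t ∈ Icc (0 : ℝ) 1, SolvesPoisson P t fun x => Φ x t) {t : ℝ}
    (ht : t ∈ Icc (0 : ℝ) 1) (x : E n) : (fderiv ℝ (fun y => X y t) x).det ≠ 0 ∧
      P.marginalDensity (X x t) t = P.marginalDensity x 0 /
        |(fderiv ℝ (fun y => X y t) x).det| := by
  obtain ⟨J, hJ0, hJ⟩ := h.isC1Flow.exists_jacobian x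
  have h0 : (0 : ℝ) ∈ Icc (0 : ℝ) 1 := left_mem_Icc.2 zero_le_one
  -- By Liouville's formula this derivative is exactly the residual at the moving point, hence zero.
  have hder : ∀ s ∈ Icc (0 : ℝ) 1, HasDerivWithinAt
      (fun s => Real.log (P.marginalDensity (X x s) s) + Real.log (J s).det) 0 (Icc 0 1) s := by
    intro s hs
    refine ((hP.hasDerivWithinAt_log_marginalDensity hs (h.ode x s hs)).add
      (hJ s hs).2.2).congr_deriv ?_
    have := (solvesPoisson_iff hP hs (h.smooth s hs)).1 (hsol s hs) (X x s)
    rw [← this, residual, divergence]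
    ring
  have hconst := (convex_Icc (0 : ℝ) 1).norm_image_sub_le_of_norm_hasDerivWithin_le
    (C := 0) hder (by simp) h0 ht
  rw [zero_mul, norm_le_zero_iff, sub_eq_zero, h.start, hJ0,
    show (1 : E n →L[ℝ] E n).det = 1 from map_one LinearMap.det, Real.log_one, add_zero] at hconst
  obtain ⟨hfd, hdet, -⟩ := hJ t ht
  rw [hfd.fderiv]
  refine ⟨hdet, ?_⟩
  have hρ := hP.marginalDensity_pos ht (X x t)
  have hd := abs_pos.2 hdet
  rw [← Real.log_abs (J t).det, ← Real.log_mul hρ.ne' hd.ne'] at hconst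
  have := Real.log_injOn_pos (mul_pos hρ hd) (hP.marginalDensity_pos h0 x) hconst
  rw [← this, mul_div_cancel_right₀ _ hd.ne']

/-- The pushed density equals ρ̄ on the range of the flow and is 0 elsewhere, hence is at most ρ̄.
Both laws have mass 1, so the inequality is an equality and surjectivity of the flow need not be
shown. -/
theorem flowLaw_eq_of_solvesPoisson (hP : P.Valid) (h : IsPotentialFlow P Φ X)
    (hsol : ∀ t ∈ Icc (0 : ℝ) 1, SolvesPoisson P t fun x => Φ x t) {t : ℝ}
    (ht : t ∈ Icc (0 : ℝ) 1) : flowLaw P X t = P.marginalLaw t := by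
  have h0 : (0 : ℝ) ∈ Icc (0 : ℝ) 1 := left_mem_Icc.2 zero_le_one
  have := hP.isProbabilityMeasure_marginalLaw h0
  have := hP.isProbabilityMeasure_marginalLaw ht
  have hd := h.differentiable ht
  have hinj := h.isC1Flow.injective ht
  have hmass := h.marginalDensity_mul_det hP hsol ht
  have hmap : flowLaw P X t = volume.withDensity
      (pushforwardDensity (fun x => X x t) fun x => P.marginalDensity x 0) :=
    map_densityLaw hd hinj fun x => (hmass x).1
  have hprob : IsProbabilityMeasure (flowLaw P X t) :=
    Measure.isProbabilityMeasure_map hd.continuous.measurable.aemeasurable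
  refine Measure.eq_of_le_of_measure_univ_eq ?_ (by simp)
  rw [hmap]
  refine withDensity_mono (Eventually.of_forall fun y => ?_)
  by_cases hy : y ∈ range fun x => X x t
  · obtain ⟨x, rfl⟩ := hy
    have := pushforwardDensity_apply (u := fun x => P.marginalDensity x 0) hinj x
    rw [this]
    exact (congrArg ENNReal.ofReal (hmass x).2).ge
  · rw [pushforwardDensity, Function.extend_apply' _ _ _ hy]
    exact zero_le

/-- The derivative of the mean of a test function along a potential flow. -/
theorem hasDerivWithinAt_integral_comp (hP : P.Valid) (h : IsPotentialFlow P Φ X)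
    {ψ : E n → ℝ} (hψ : ContDiff ℝ (⊤ : ℕ∞) ψ) (hc : HasCompactSupport ψ) {t : ℝ}
    (ht : t ∈ Icc (0 : ℝ) 1) :
    HasDerivWithinAt (fun s => ∫ z, ψ z ∂(flowLaw P X s))
      (∫ z, fderiv ℝ ψ z (gradient (fun y => Φ y t) z) ∂(flowLaw P X t)) (Icc 0 1) t := by
  have := hP.isProbabilityMeasure_marginalLaw (left_mem_Icc.2 zero_le_one)
  have hψ' : Continuous (fderiv ℝ ψ) := hψ.continuous_fderiv (by simp)
  obtain ⟨C, hC⟩ := (hc.isCompact.prod (isCompact_Icc (a := (0 : ℝ)) (b := 1))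
    ).exists_bound_of_continuousOn
    (f := fun z : E n × ℝ => fderiv ℝ ψ z.1 (gradient (fun y => Φ y z.2) z.1))
    ((hψ'.comp continuous_fst).continuousOn.clm_apply
      (h.continuous_gradient.mono (prod_mono_left (subset_univ _))))
  -- The velocity may be unbounded, but only its values on the support of `ψ` count.
  have hC' : ∀ z, ∀ s ∈ Icc (0 : ℝ) 1,
      ‖fderiv ℝ ψ z (gradient (fun y => Φ y s) z)‖ ≤ max C 0 := by
    intro z s hs
    by_cases hz : z ∈ tsupport ψ
    · exact (hC (z, s) ⟨hz, hs⟩).trans (le_max_left _ _)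
    · have : fderiv ℝ ψ z = 0 := by
        by_contra hne
        exact hz (support_fderiv_subset ℝ hne)
      simp [this]
  obtain ⟨B, hB⟩ := hψ.continuous.bounded_above_of_compact_support hc
  have key := hasDerivWithinAt_integral (μ := P.marginalLaw 0) (a := 0) (b := 1) (t := t)
    (F := fun s x => ψ (X x s))
    (F' := fun s x => fderiv ℝ ψ (X x s) (gradient (fun y => Φ y s) (X x s)))
    (bound := fun _ => max C 0) ht
    (fun s hs => (integrable_const B).mono'
      (hψ.continuous.comp (h.differentiable hs).continuous).aestronglyMeasurable
      (Eventually.of_forall fun x => hB _))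
    (Eventually.of_forall fun x s hs =>
      (hψ.differentiable (by simp) _).hasFDerivAt.comp_hasDerivWithinAt s (h.ode x s hs))
    (Eventually.of_forall fun x s hs => hC' _ s hs) (integrable_const _)
  refine (key.congr_of_mem (fun s hs => ?_) ht).congr_deriv ?_
  · rw [flowLaw, integral_map (h.differentiable hs).continuous.measurable.aemeasurable
      hψ.continuous.aestronglyMeasurable]
  · rw [flowLaw, integral_map (h.differentiable ht).continuous.measurable.aemeasurable]
    exact (hψ'.clm_apply
      (contDiff_gradient (h.smooth t ht)).continuous).aestronglyMeasurable

theorem hasDerivWithinAt_integral_marginalLaw (hP : P.Valid)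
    {ψ : E n → ℝ} (hψ : ContDiff ℝ (⊤ : ℕ∞) ψ) (hc : HasCompactSupport ψ) {t : ℝ}
    (ht : t ∈ Icc (0 : ℝ) 1) :
    HasDerivWithinAt (fun s => ∫ z, ψ z ∂(P.marginalLaw s)) (∫ z, -P.source z t * ψ z)
      (Icc 0 1) t := by
  obtain ⟨C, hC⟩ := (hc.isCompact.prod (isCompact_Icc (a := (0 : ℝ)) (b := 1))
    ).exists_bound_of_continuousOn
    (hP.continuousOn_source.mono (prod_mono_left (subset_univ _)))
  have key := hasDerivWithinAt_integral (μ := (volume : Measure (E n))) (a := 0) (b := 1) (t := t)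
    (F := fun s x => P.marginalDensity x s * ψ x) (F' := fun s x => -P.source x s * ψ x)
    (bound := fun x => C * ‖ψ x‖) ht
    (fun s hs => ((hP.contDiff_marginalDensity hs).continuous.mul
      hψ.continuous).integrable_of_hasCompactSupport hc.mul_left)
    (Eventually.of_forall fun x s hs => (hP.hasDerivWithinAt_marginalDensity hs x).mul_const _)
    (Eventually.of_forall fun x s hs => ?_)
    ((hψ.continuous.integrable_of_hasCompactSupport hc).norm.const_mul _)
  · exact key.congr_of_mem (fun s hs => integral_marginalLaw hP hs ψ) ht
  · by_cases hx : x ∈ tsupport ψ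
    · rw [norm_mul, norm_neg]
      exact mul_le_mul_of_nonneg_right (hC (x, s) ⟨hx, hs⟩) (norm_nonneg _)
    · simp [image_eq_zero_of_notMem_tsupport hx]

/-- The mean of a test function ψ has time derivative ∫ ρ̄ ∇ψ · ∇Φ through the flow and −∫ ψ ·
source through the density. Equating them is the weak form of (P). Derivatives within [0, 1] are
unique, so the endpoints are covered. -/
theorem solvesPoisson_of_flowLaw_eq (hP : P.Valid) (h : IsPotentialFlow P Φ X)
    (hlaw : ∀ t ∈ Icc (0 : ℝ) 1, flowLaw P X t = P.marginalLaw t) {t : ℝ}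
    (ht : t ∈ Icc (0 : ℝ) 1) : SolvesPoisson P t fun x => Φ x t := by
  have hV := contDiff_gradient (h.smooth t ht)
  have hρ : ContDiff ℝ 1 fun x => P.marginalDensity x t :=
    (hP.contDiff_marginalDensity ht).of_le (by exact_mod_cast le_top)
  have hρV : ContDiff ℝ 1 fun y => P.marginalDensity y t • gradient (fun x => Φ x t) y :=
    hρ.smul hV
  have hsrc : Continuous fun x => P.source x t := by
    have := hP.continuousOn_source.comp (Continuous.prodMk_left t).continuousOn
      (fun x (_ : x ∈ univ) => (⟨trivial, ht⟩ : (x, t) ∈ univ ×ˢ Icc (0 : ℝ) 1))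
    exact continuousOn_univ.1 this
  intro x
  rw [← sub_eq_zero]
  refine eq_zero_of_integral_mul_eq_zero (r := fun x =>
    divergence (fun y => P.marginalDensity y t • gradient (fun x => Φ x t) y) x - P.source x t)
    ((continuous_divergence hρV).sub hsrc) (fun ψ hψ hc => ?_) x
  have h1 := h.hasDerivWithinAt_integral_comp hP hψ hc ht
  have h2 : HasDerivWithinAt (fun s => ∫ z, ψ z ∂(flowLaw P X s)) (∫ z, -P.source z t * ψ z)
      (Icc 0 1) t := (hasDerivWithinAt_integral_marginalLaw hP hψ hc ht).congr_of_mem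
    (fun s hs => by rw [hlaw s hs]) ht
  have h3 := (uniqueDiffOn_Icc zero_lt_one t ht).eq_deriv _ h1 h2
  rw [hlaw t ht, integral_marginalLaw hP ht] at h3
  have hψ1 : ContDiff ℝ 1 ψ := hψ.of_le (by exact_mod_cast le_top)
  have h4 := integral_mul_divergence_add_eq_zero hψ1 hρV hc.smul_right
  have hi1 : Integrable fun x => ψ x *
      divergence (fun y => P.marginalDensity y t • gradient (fun x => Φ x t) y) x :=
    (hψ.continuous.mul (continuous_divergence hρV)).integrable_of_hasCompactSupport hc.mul_right
  have hi2 : Integrable fun x => fderiv ℝ ψ x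
      (P.marginalDensity x t • gradient (fun x => Φ x t) x) := by
    refine ((hψ.continuous_fderiv (by simp)).clm_apply
      hρV.continuous).integrable_of_hasCompactSupport ((hc.fderiv ℝ).mono ?_)
    intro x hx h0
    exact hx (by simp [h0])
  have hi3 : Integrable fun x => ψ x * P.source x t :=
    (hψ.continuous.mul hsrc).integrable_of_hasCompactSupport hc.mul_right
  rw [integral_add hi1 hi2] at h4
  simp_rw [map_smul, smul_eq_mul] at h4
  simp_rw [mul_sub]
  rw [integral_sub hi1 hi3]
  have h5 : ∫ z, -P.source z t * ψ z = -∫ z, ψ z * P.source z t := by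
    rw [← integral_neg]
    exact integral_congr_ae (Eventually.of_forall fun z => by simp only; ring)
  linarith

theorem solvesPoisson_iff_flowLaw_eq (hP : P.Valid) (h : IsPotentialFlow P Φ X) :
    (∀ t ∈ Icc (0 : ℝ) 1, SolvesPoisson P t fun x => Φ x t) ↔
      ∀ t ∈ Icc (0 : ℝ) 1, flowLaw P X t = P.marginalLaw t :=
  ⟨fun hsol _ ht => h.flowLaw_eq_of_solvesPoisson hP hsol ht,
    fun hlaw _ ht => h.solvesPoisson_of_flowLaw_eq hP hlaw ht⟩

theorem klDiv_eq_zero (hP : P.Valid) (h : IsPotentialFlow P Φ X)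
    (hsol : ∀ t ∈ Icc (0 : ℝ) 1, SolvesPoisson P t fun x => Φ x t) {t : ℝ}
    (ht : t ∈ Icc (0 : ℝ) 1) : klDiv (flowLaw P X t) (P.marginalLaw t) = 0 := by
  have := hP.isProbabilityMeasure_marginalLaw ht
  rw [h.flowLaw_eq_of_solvesPoisson hP hsol ht, klDiv_self]

theorem minimizesKL_of_solvesPoisson (hP : P.Valid) (h : IsPotentialFlow P Φ X)
    (hsol : ∀ t ∈ Icc (0 : ℝ) 1, SolvesPoisson P t fun x => Φ x t) {t : ℝ}
    (ht : t ∈ Icc (0 : ℝ) 1) : MinimizesKL P X t := by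
  intro Ψ Y _
  rw [h.klDiv_eq_zero hP hsol ht]
  exact zero_le

/-- Comparison with the solving flow forces the minimum to be 0 at each time, and zero divergence
between probability laws means equality. -/
theorem solvesPoisson_of_minimizesKL (hP : P.Valid) (h : IsPotentialFlow P Φ X)
    {Ψ : E n → ℝ → ℝ} {Y : E n → ℝ → E n} (hY : IsPotentialFlow P Ψ Y)
    (hsol : ∀ t ∈ Icc (0 : ℝ) 1, SolvesPoisson P t fun x => Ψ x t)
    (hmin : ∀ t ∈ Icc (0 : ℝ) 1, MinimizesKL P X t) :
    ∀ t ∈ Icc (0 : ℝ) 1, SolvesPoisson P t fun x => Φ x t := by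
  refine (h.solvesPoisson_iff_flowLaw_eq hP).2 fun t ht => ?_
  have h0 := hmin t ht Ψ Y hY
  rw [hY.klDiv_eq_zero hP hsol ht] at h0
  have := hP.isProbabilityMeasure_marginalLaw ht
  have := hP.isProbabilityMeasure_marginalLaw (left_mem_Icc.2 zero_le_one)
  have : IsProbabilityMeasure (flowLaw P X t) :=
    Measure.isProbabilityMeasure_map (h.differentiable ht).continuous.measurable.aemeasurable
  exact klDiv_eq_zero_iff.1 (le_antisymm h0 (zero_le))

end IsPotentialFlow

/-! ### Compactly supported perturbations of a diffeomorphism -/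

section Perturbation

variable {n : ℕ}

theorem fderiv_eq_zero_of_notMem_tsupport {F : Type*} [NormedAddCommGroup F] [NormedSpace ℝ F]
    {f : E n → F} {x : E n} (hx : x ∉ tsupport f) : fderiv ℝ f x = 0 := by
  by_contra hne
  exact hx (support_fderiv_subset ℝ hne)

theorem zero_smul_clm (A : E n →L[ℝ] E n) : (0 : ℝ) • A = 0 := by
  ext v
  simp

theorem smul_zero_clm (c : ℝ) : c • (0 : E n →L[ℝ] E n) = 0 := by
  ext v
  simp

theorem smul_mul_clm (c : ℝ) (A B : E n →L[ℝ] E n) : (c • A) * B = c • (A * B) := rfl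

theorem isUnit_fderiv_of_inverse {T g : E n → E n} (hT : Differentiable ℝ T)
    (hg : Differentiable ℝ g) (hgl : Function.LeftInverse g T) (hgr : Function.RightInverse g T)
    (x : E n) : IsUnit (fderiv ℝ T x) ∧ fderiv ℝ g (T x) = Ring.inverse (fderiv ℝ T x) := by
  have h1 : fderiv ℝ g (T x) * fderiv ℝ T x = 1 := by
    have := fderiv_comp x (hg (T x)) (hT x)
    rw [hgl.comp_eq_id, fderiv_id] at this
    exact this.symm
  have h2 : fderiv ℝ T x * fderiv ℝ g (T x) = 1 := by
    have := fderiv_comp (T x) (hT (g (T x))) (hg (T x))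
    rw [hgr.comp_eq_id, fderiv_id, hgl x] at this
    exact this.symm
  exact ⟨⟨⟨_, _, h2, h1⟩, rfl⟩, (Ring.inverse_unit ⟨_, _, h2, h1⟩).symm⟩

theorem _root_.ContinuousOn.ringInverse {Y R : Type*} [TopologicalSpace Y] [NormedRing R]
    [HasSummableGeomSeries R] {A : Y → R} {s : Set Y} (hA : ContinuousOn A s)
    (hu : ∀ y ∈ s, IsUnit (A y)) : ContinuousOn (fun y => Ring.inverse (A y)) s := by
  intro y hy
  obtain ⟨a, ha⟩ := hu y hy
  have := NormedRing.inverse_continuousAt a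
  rw [ha] at this
  exact this.comp_continuousWithinAt (hA y hy)

theorem det_ne_zero_of_isUnit {A : E n →L[ℝ] E n} (hA : IsUnit A) : A.det ≠ 0 :=
  det_ne_zero_of_mul_eq_one (Ring.mul_inverse_cancel A hA)

/-- Small compactly supported perturbations of a diffeomorphism are injective immersions. -/
theorem exists_perturbation {T g η : E n → E n} (hT : ContDiff ℝ 1 T)
    (hg : Differentiable ℝ g) (hgl : Function.LeftInverse g T) (hgr : Function.RightInverse g T)
    (hη : ContDiff ℝ 1 η) (hc : HasCompactSupport η) :
    ∃ ε₀ > (0 : ℝ), ∀ ε ∈ Icc (-ε₀) ε₀, Function.Injective (fun x => T x + ε • η x) ∧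
      ∀ x, IsUnit (fderiv ℝ T x + ε • fderiv ℝ η x) := by
  have hTd := hT.differentiable one_ne_zero
  have hηd := hη.differentiable one_ne_zero
  have hinv := isUnit_fderiv_of_inverse hTd hg hgl hgr
  obtain ⟨C, hC⟩ := hc.isCompact.exists_bound_of_continuousOn
    (f := fun x => fderiv ℝ η x * Ring.inverse (fderiv ℝ T x))
    ((hη.continuous_fderiv one_ne_zero).continuousOn.mul
      ((hT.continuous_fderiv one_ne_zero).continuousOn.ringInverse fun x _ => (hinv x).1))
  set L := max C 1 with hL
  have hL1 : 1 ≤ L := le_max_right _ _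
  have hψd : Differentiable ℝ (η ∘ g) := hηd.comp hg
  have hψ : ∀ x, fderiv ℝ (η ∘ g) (T x) = fderiv ℝ η x * Ring.inverse (fderiv ℝ T x) := by
    intro x
    rw [fderiv_comp _ (hηd _) (hg _), (hinv x).2, hgl x]
    rfl
  have hψL : ∀ y, ‖fderiv ℝ (η ∘ g) y‖ ≤ L := by
    intro y
    rw [← hgr y, hψ]
    by_cases hy : g y ∈ tsupport η
    · exact (hC _ hy).trans (le_max_left _ _)
    · rw [fderiv_eq_zero_of_notMem_tsupport hy, zero_mul, norm_zero]
      linarith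
  -- T + εη = (id + ε η∘g)∘T, and η∘g is `L`-Lipschitz. For |ε| ≤ 1/(2L) the first factor differs
  -- from the identity by a ½-contraction, hence is an injective immersion.
  refine ⟨1 / (2 * L), by positivity, fun ε hε => ?_⟩
  have hε' : |ε| * L ≤ 1 / 2 := by
    have := mul_le_mul_of_nonneg_right (abs_le.2 hε) (by linarith : 0 ≤ L)
    refine this.trans_eq ?_
    field_simp
  refine ⟨fun x y hxy => ?_, fun x => ?_⟩
  · have h1 := convex_univ.norm_image_sub_le_of_norm_fderiv_le
      (fun z _ => hψd z) (fun z _ => hψL z) (mem_univ (T y)) (mem_univ (T x))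
    simp only [Function.comp_apply, hgl x, hgl y] at h1
    have h2 : T x - T y = -(ε • (η x - η y)) := by
      simp only at hxy
      rw [smul_sub, neg_sub, sub_eq_sub_iff_add_eq_add, hxy]
      abel
    have h3 : ‖T x - T y‖ ≤ 1 / 2 * ‖T x - T y‖ := by
      calc ‖T x - T y‖ = |ε| * ‖η x - η y‖ := by rw [h2, norm_neg, norm_smul, Real.norm_eq_abs]
        _ ≤ |ε| * (L * ‖T x - T y‖) := mul_le_mul_of_nonneg_left h1 (abs_nonneg _)
        _ = |ε| * L * ‖T x - T y‖ := by ring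
        _ ≤ _ := mul_le_mul_of_nonneg_right hε' (norm_nonneg _)
    have h4 : ‖T x - T y‖ = 0 := by linarith [norm_nonneg (T x - T y)]
    exact hgl.injective (sub_eq_zero.1 (norm_eq_zero.1 h4))
  · have h1 : fderiv ℝ T x + ε • fderiv ℝ η x =
        (1 - -(ε • fderiv ℝ (η ∘ g) (T x))) * fderiv ℝ T x := by
      rw [hψ, sub_neg_eq_add, add_mul, one_mul, smul_mul_clm,
        Ring.inverse_mul_cancel_right _ _ (hinv x).1]
    rw [h1]
    refine (isUnit_one_sub_of_norm_lt_one ?_).mul (hinv x).1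
    rw [norm_neg, norm_smul, Real.norm_eq_abs]
    calc |ε| * ‖fderiv ℝ (η ∘ g) (T x)‖ ≤ |ε| * L :=
          mul_le_mul_of_nonneg_left (hψL _) (abs_nonneg _)
      _ < 1 := by linarith

/-- The first variation of the Kullback–Leibler divergence of a transported density under
compactly supported perturbations of the transport map. -/
theorem hasDerivAt_klDiv_perturbation {T g η : E n → E n} {u v : E n → ℝ} (hT : ContDiff ℝ 1 T)
    (hg : Differentiable ℝ g) (hgl : Function.LeftInverse g T) (hgr : Function.RightInverse g T)
    (hη : ContDiff ℝ 1 η) (hc : HasCompactSupport η) (hu : Measurable u) (hu0 : ∀ x, 0 < u x)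
    (hv : ContDiff ℝ 1 v) (hv0 : ∀ x, 0 < v x) [IsProbabilityMeasure (densityLaw u)]
    [IsProbabilityMeasure (densityLaw v)]
    (hfin : klDiv ((densityLaw u).map T) (densityLaw v) ≠ ∞) :
    (∀ᶠ ε in 𝓝 (0 : ℝ),
      klDiv ((densityLaw u).map fun x => T x + ε • η x) (densityLaw v) ≠ ∞) ∧
    HasDerivAt
      (fun ε : ℝ => (klDiv ((densityLaw u).map fun x => T x + ε • η x) (densityLaw v)).toReal)
      (-∫ x, (traceCLM n (fderiv ℝ η x * Ring.inverse (fderiv ℝ T x)) +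
        fderiv ℝ (fun y => Real.log (v y)) (T x) (η x)) ∂(densityLaw u)) 0 := by
  obtain ⟨ε₀, hε₀, hpert⟩ := exists_perturbation hT hg hgl hgr hη hc
  have hTd := hT.differentiable one_ne_zero
  have hηd := hη.differentiable one_ne_zero
  have hDT := hT.continuous_fderiv one_ne_zero
  have hDη := hη.continuous_fderiv one_ne_zero
  have hlv : ContDiff ℝ 1 fun y => Real.log (v y) := hv.log fun y => (hv0 y).ne'
  have hmem0 : (0 : ℝ) ∈ Icc (-ε₀) ε₀ := ⟨by linarith, hε₀.le⟩
  have hfd : ∀ (ε : ℝ) x, HasFDerivAt (fun x => T x + ε • η x)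
      (fderiv ℝ T x + ε • fderiv ℝ η x) x := fun ε x =>
    (hTd x).hasFDerivAt.add ((hηd x).hasFDerivAt.const_smul ε)
  have hkl := fun ε (hε : ε ∈ Icc (-ε₀) ε₀) =>
    klDiv_map_densityLaw (f := fun x => T x + ε • η x) (u := u) (v := v)
      (fun x => (hfd ε x).differentiableAt) (hpert ε hε).1
      (fun x => by rw [(hfd ε x).fderiv]; exact det_ne_zero_of_isUnit ((hpert ε hε).2 x))
      hu hv.continuous.measurable hu0 hv0
  simp only [(hfd _ _).fderiv] at hkl
  set F : ℝ → E n → ℝ := fun ε x => Real.log (u x) -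
    Real.log (fderiv ℝ T x + ε • fderiv ℝ η x).det - Real.log (v (T x + ε • η x)) with hF
  have hF0 : Integrable (F 0) (densityLaw u) := by
    refine (hkl 0 hmem0).1.1 ?_
    simpa using hfin
  have hFi : ∀ ε ∈ Icc (-ε₀) ε₀, Integrable (F ε) (densityLaw u) := by
    intro ε hε
    have hcont : ∀ ε ∈ Icc (-ε₀) ε₀, Continuous fun x =>
        Real.log (fderiv ℝ T x + ε • fderiv ℝ η x).det + Real.log (v (T x + ε • η x)) := by
      intro ε hε
      refine Continuous.add (Continuous.log ?_ fun x =>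
        det_ne_zero_of_isUnit ((hpert ε hε).2 x)) ?_
      · exact (differentiable_det (V := E n)).continuous.comp (hDT.add (hDη.const_smul ε))
      · exact hlv.continuous.comp (hT.continuous.add (hη.continuous.const_smul ε))
    -- The perturbation changes the integrand only on the support of `η`, so finiteness of the
    -- divergence passes from ε = 0 to small ε.
    have hd : Integrable (fun x => F 0 x - F ε x) (densityLaw u) := by
      have : (fun x => F 0 x - F ε x) = fun x =>
          (Real.log (fderiv ℝ T x + ε • fderiv ℝ η x).det + Real.log (v (T x + ε • η x))) -
          (Real.log (fderiv ℝ T x + (0 : ℝ) • fderiv ℝ η x).det +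
            Real.log (v (T x + (0 : ℝ) • η x))) := by
        funext x
        simp only [hF]
        ring
      rw [this]
      refine ((hcont ε hε).sub (hcont 0 hmem0)).integrable_of_hasCompactSupport
        (HasCompactSupport.intro hc fun x hx => ?_)
      simp [fderiv_eq_zero_of_notMem_tsupport hx, image_eq_zero_of_notMem_tsupport hx,
        smul_zero_clm]
    exact (hF0.sub hd).congr (Eventually.of_forall fun x => by simp)
  set F' : ℝ → E n → ℝ := fun ε x =>
    -(traceCLM n (fderiv ℝ η x * Ring.inverse (fderiv ℝ T x + ε • fderiv ℝ η x)) +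
      fderiv ℝ (fun y => Real.log (v y)) (T x + ε • η x) (η x)) with hF'
  have hder : ∀ x, ∀ ε ∈ Icc (-ε₀) ε₀,
      HasDerivWithinAt (fun ε => F ε x) (F' ε x) (Icc (-ε₀) ε₀) ε := by
    intro x ε hε
    have h1 : HasDerivWithinAt (fun ε : ℝ => fderiv ℝ T x + ε • fderiv ℝ η x) (fderiv ℝ η x)
        (Icc (-ε₀) ε₀) ε := by
      simpa using ((hasDerivWithinAt_id ε _).smul_const (fderiv ℝ η x)).const_add (fderiv ℝ T x)
    have h2 : HasDerivWithinAt (fun ε : ℝ => T x + ε • η x) (η x) (Icc (-ε₀) ε₀) ε := by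
      simpa using ((hasDerivWithinAt_id ε _).smul_const (η x)).const_add (T x)
    have h3 := hasDerivWithinAt_log_det h1 (Ring.mul_inverse_cancel _ ((hpert ε hε).2 x))
    have h4 := (hlv.differentiable one_ne_zero (T x + ε • η x)).hasFDerivAt.comp_hasDerivWithinAt
      ε h2
    refine ((h3.const_sub (Real.log (u x))).sub h4).congr_deriv ?_
    simp only [hF', traceCLM_apply]
    ring
  have hcompact : IsCompact (tsupport η ×ˢ Icc (-ε₀) ε₀) := hc.isCompact.prod isCompact_Icc
  obtain ⟨C, hC⟩ := hcompact.exists_bound_of_continuousOn (f := fun z => F' z.2 z.1) (by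
    refine ContinuousOn.neg (ContinuousOn.add ?_ ?_)
    · refine (traceCLM n).continuous.comp_continuousOn
        ((hDη.comp continuous_fst).continuousOn.mul (ContinuousOn.ringInverse ?_ fun z hz =>
          (hpert _ hz.2).2 _))
      exact ((hDT.comp continuous_fst).add
        (continuous_snd.smul (hDη.comp continuous_fst))).continuousOn
    · refine Continuous.continuousOn (((hlv.continuous_fderiv one_ne_zero).comp ?_).clm_apply
        (hη.continuous.comp continuous_fst))
      exact (hT.continuous.comp continuous_fst).add
        (continuous_snd.smul (hη.continuous.comp continuous_fst)))
  have hbound : ∀ x, ∀ ε ∈ Icc (-ε₀) ε₀, ‖F' ε x‖ ≤ max C 0 := by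
    intro x ε hε
    by_cases hx : x ∈ tsupport η
    · exact (hC (x, ε) ⟨hx, hε⟩).trans (le_max_left _ _)
    · simp [hF', fderiv_eq_zero_of_notMem_tsupport hx, image_eq_zero_of_notMem_tsupport hx]
  have hnhds : Icc (-ε₀) ε₀ ∈ 𝓝 (0 : ℝ) := Icc_mem_nhds (by linarith) hε₀
  refine ⟨Filter.mem_of_superset hnhds fun ε hε => (hkl ε hε).1.2 (hFi ε hε), ?_⟩
  have key := (hasDerivWithinAt_integral hmem0 hFi (Eventually.of_forall hder)
    (Eventually.of_forall hbound) (integrable_const _)).hasDerivAt hnhds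
  refine (key.congr_of_eventuallyEq
    (Filter.mem_of_superset hnhds fun ε hε => (hkl ε hε).2)).congr_deriv ?_
  rw [← integral_neg]
  simp [hF', zero_smul_clm]

end Perturbation

/-! ### The first variation to first order in the step length -/

section FirstVariation

variable {n : ℕ} {P : Params n}

theorem _root_.HasDerivWithinAt.ringInverse {R : Type*} [NormedRing R] [NormedAlgebra ℝ R]
    [HasSummableGeomSeries R] {A : ℝ → R} {A' : R} {s : Set ℝ} {t : ℝ}
    (hA : HasDerivWithinAt A A' s t) (hu : IsUnit (A t)) :
    HasDerivWithinAt (fun r => Ring.inverse (A r))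
      (-(Ring.inverse (A t) * A' * Ring.inverse (A t))) s t := by
  obtain ⟨a, ha⟩ := hu
  have h := hasFDerivAt_ringInverse (𝕜 := ℝ) a
  rw [ha] at h
  refine (h.comp_hasDerivWithinAt t hA).congr_deriv ?_
  rw [← ha, Ring.inverse_unit]
  simp

/-- Minus the first variation of the divergence for an Euler step from time `t` to time `s`. -/
def stepVariation (P : Params n) (t : ℝ) (V η : E n → E n) (s : ℝ) : ℝ :=
  ∫ x, (traceCLM n (fderiv ℝ η x * Ring.inverse (1 + (s - t) • fderiv ℝ V x)) +
    P.score (x + (s - t) • V x) s (η x)) ∂(P.marginalLaw t)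

/-- The inverse Jacobian contributes −DV at s = t and the score contributes `scoreDeriv`. The
integrands are supported in that of `η`, so a bound on a compact set dominates them. -/
theorem hasDerivWithinAt_stepVariation (hP : P.Valid) {t b : ℝ} (ht : 0 ≤ t) (htb : t ≤ b)
    (hb : b ≤ 1) {V η : E n → E n} (hV : ContDiff ℝ 1 V) (hη : ContDiff ℝ 1 η)
    (hc : HasCompactSupport η)
    (hunit : ∀ s ∈ Icc t b, ∀ x, IsUnit (1 + (s - t) • fderiv ℝ V x)) :
    HasDerivWithinAt (stepVariation P t V η)
      (∫ x, (-traceCLM n (fderiv ℝ η x * fderiv ℝ V x) + P.scoreDeriv x (V x) (η x) t)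
        ∂(P.marginalLaw t)) (Icc t b) t := by
  have hsub : Icc t b ⊆ Icc (0 : ℝ) 1 := Icc_subset_Icc ht hb
  have htmem : t ∈ Icc t b := left_mem_Icc.2 htb
  have := hP.isProbabilityMeasure_marginalLaw (hsub htmem)
  have hDV := hV.continuous_fderiv one_ne_zero
  have hDη := hη.continuous_fderiv one_ne_zero
  set F : ℝ → E n → ℝ := fun s x =>
    traceCLM n (fderiv ℝ η x * Ring.inverse (1 + (s - t) • fderiv ℝ V x)) +
      P.score (x + (s - t) • V x) s (η x) with hF
  set F' : ℝ → E n → ℝ := fun s x =>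
    traceCLM n (fderiv ℝ η x * -(Ring.inverse (1 + (s - t) • fderiv ℝ V x) * fderiv ℝ V x *
      Ring.inverse (1 + (s - t) • fderiv ℝ V x))) +
      P.scoreDeriv (x + (s - t) • V x) (V x) (η x) s with hF'
  have hFi : ∀ s ∈ Icc t b, Integrable (F s) (P.marginalLaw t) := by
    intro s hs
    refine Continuous.integrable_of_hasCompactSupport (Continuous.add ?_ ?_)
      (HasCompactSupport.intro hc fun x hx => ?_)
    · refine (traceCLM n).continuous.comp (hDη.mul ?_)
      exact continuousOn_univ.1 (ContinuousOn.ringInverse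
        (continuous_const.add (hDV.const_smul (s - t))).continuousOn fun x _ => hunit s hs x)
    · exact ((hP.contDiff_score s).continuous.comp
        (continuous_id.add (hV.continuous.const_smul (s - t)))).clm_apply hη.continuous
    · simp [hF, fderiv_eq_zero_of_notMem_tsupport hx, image_eq_zero_of_notMem_tsupport hx]
  have hder : ∀ x, ∀ s ∈ Icc t b,
      HasDerivWithinAt (fun s => F s x) (F' s x) (Icc t b) s := by
    intro x s hs
    have h1 : HasDerivWithinAt (fun s : ℝ => 1 + (s - t) • fderiv ℝ V x) (fderiv ℝ V x)
        (Icc t b) s := by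
      simpa using (((hasDerivWithinAt_id s _).sub_const t).smul_const (fderiv ℝ V x)).const_add
        (1 : E n →L[ℝ] E n)
    have h2 : HasDerivWithinAt (fun s : ℝ => x + (s - t) • V x) (V x) (Icc 0 1) s := by
      simpa using (((hasDerivWithinAt_id s _).sub_const t).smul_const (V x)).const_add x
    exact ((traceCLM n).hasFDerivAt.comp_hasDerivWithinAt s
      ((h1.ringInverse (hunit s hs x)).const_mul (fderiv ℝ η x))).add
      ((hP.hasDerivWithinAt_score (hsub hs) h2 (η x)).mono hsub)
  have hcompact : IsCompact (tsupport η ×ˢ Icc t b) := hc.isCompact.prod isCompact_Icc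
  obtain ⟨C, hC⟩ := hcompact.exists_bound_of_continuousOn (f := fun z => F' z.2 z.1) (by
    have hinv : ContinuousOn (fun z : E n × ℝ => Ring.inverse (1 + (z.2 - t) • fderiv ℝ V z.1))
        (tsupport η ×ˢ Icc t b) := by
      refine ContinuousOn.ringInverse (Continuous.continuousOn ?_) fun z hz => hunit _ hz.2 _
      exact continuous_const.add
        ((continuous_snd.sub continuous_const).smul (hDV.comp continuous_fst))
    refine ContinuousOn.add ?_ (hP.continuousOn_scoreDeriv ?_ ?_ ?_ continuousOn_snd
      fun z hz => hsub hz.2)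
    · exact (traceCLM n).continuous.comp_continuousOn ((hDη.comp continuous_fst).continuousOn.mul
        ((hinv.mul (hDV.comp continuous_fst).continuousOn).mul hinv).neg)
    · exact (continuous_fst.add ((continuous_snd.sub continuous_const).smul
        (hV.continuous.comp continuous_fst))).continuousOn
    · exact (hV.continuous.comp continuous_fst).continuousOn
    · exact (hη.continuous.comp continuous_fst).continuousOn)
  have hbound : ∀ x, ∀ s ∈ Icc t b, ‖F' s x‖ ≤ max C 0 := by
    intro x s hs
    by_cases hx : x ∈ tsupport η
    · exact (hC (x, s) ⟨hx, hs⟩).trans (le_max_left _ _)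
    · simp [hF', fderiv_eq_zero_of_notMem_tsupport hx, image_eq_zero_of_notMem_tsupport hx,
        Params.scoreDeriv, ← Prod.zero_eq_mk]
  refine (hasDerivWithinAt_integral htmem hFi (Eventually.of_forall hder)
    (Eventually.of_forall hbound) (integrable_const _)).congr_deriv ?_
  refine integral_congr_ae (Eventually.of_forall fun x => ?_)
  have : traceCLM n (fderiv ℝ η x * -fderiv ℝ V x) =
      -traceCLM n (fderiv ℝ η x * fderiv ℝ V x) :=
    (congrArg (traceCLM n) (mul_neg (fderiv ℝ η x) (fderiv ℝ V x))).trans (map_neg _ _)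
  simp [hF', zero_smul_clm, this]

theorem hasCompactSupport_smul (f : E n → ℝ) {ξ : E n → E n} (hξ : HasCompactSupport ξ) :
    HasCompactSupport fun x => f x • ξ x :=
  HasCompactSupport.intro hξ fun x hx => by
    rw [image_eq_zero_of_notMem_tsupport hx, smul_zero]

theorem divergence_marginalDensity_smul (hP : P.Valid) {t : ℝ} (ht : t ∈ Icc (0 : ℝ) 1)
    {η : E n → E n} (hη : Differentiable ℝ η) (x : E n) :
    divergence (fun y => P.marginalDensity y t • η y) x =
      P.marginalDensity x t * (divergence η x + P.score x t (η x)) := by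
  rw [divergence_smul ((hP.contDiff_marginalDensity ht).differentiable (by simp) x) (hη x),
    hP.fderiv_marginalDensity ht]
  simp only [smul_apply, smul_eq_mul]
  ring

/-- At s = t the integrand times ρ̄ is div(ρ̄η). -/
theorem stepVariation_self (hP : P.Valid) {t : ℝ} (ht : t ∈ Icc (0 : ℝ) 1) (V : E n → E n)
    {η : E n → E n} (hη : ContDiff ℝ 1 η) (hc : HasCompactSupport η) :
    stepVariation P t V η t = 0 := by
  have hρ : ContDiff ℝ 1 fun x => P.marginalDensity x t :=
    (hP.contDiff_marginalDensity ht).of_le (by exact_mod_cast le_top)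
  rw [stepVariation, integral_marginalLaw hP ht,
    ← integral_divergence_eq_zero (F := fun x => P.marginalDensity x t • η x) (hρ.smul hη)
      (hasCompactSupport_smul _ hc)]
  refine integral_congr_ae (Eventually.of_forall fun x => ?_)
  simp only
  rw [divergence_marginalDensity_smul hP ht (hη.differentiable one_ne_zero),
    divergence_eq_traceCLM]
  simp [zero_smul_clm]

theorem fderiv_score_symm (hP : P.Valid) {t : ℝ} (ht : t ∈ Icc (0 : ℝ) 1) (x v w : E n) :
    fderiv ℝ (fun x => P.score x t) x v w = fderiv ℝ (fun x => P.score x t) x w v :=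
  second_derivative_symmetric (f := fun x => Real.log (P.marginalDensity x t))
    (fun y => hP.hasFDerivAt_log_marginalDensity ht y)
    ((hP.contDiff_score t).differentiable one_ne_zero x).hasFDerivAt v w

theorem integral_fderiv_sub_trace {f : E n → ℝ} {V ξ : E n → E n} (hf : ContDiff ℝ 1 f)
    (hV : ContDiff ℝ 1 V) (hξ : ContDiff ℝ 2 ξ) (hξc : HasCompactSupport ξ) :
    ∫ x, (fderiv ℝ f x (ξ x) - traceCLM n (fderiv ℝ V x * fderiv ℝ ξ x)) =
      -∫ x, (f x + divergence V x) * divergence ξ x := by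
  have hξ1 : ContDiff ℝ 1 ξ := hξ.of_le (by norm_num)
  have hdivξ := continuous_divergence hξ1
  have hdivc : HasCompactSupport (divergence ξ) := by
    refine HasCompactSupport.intro hξc fun x hx => ?_
    rw [divergence_eq_traceCLM, fderiv_eq_zero_of_notMem_tsupport hx, map_zero]
  have hi1 : Integrable fun x => fderiv ℝ f x (ξ x) :=
    ((hf.continuous_fderiv one_ne_zero).clm_apply hξ.continuous).integrable_of_hasCompactSupport
      (HasCompactSupport.intro hξc fun x hx => by
        rw [image_eq_zero_of_notMem_tsupport hx, map_zero])
  have hi2 : Integrable fun x => traceCLM n (fderiv ℝ V x * fderiv ℝ ξ x) :=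
    ((traceCLM n).continuous.comp ((hV.continuous_fderiv one_ne_zero).mul
      (hξ1.continuous_fderiv one_ne_zero))).integrable_of_hasCompactSupport
      (HasCompactSupport.intro hξc fun x hx => by
        simp [fderiv_eq_zero_of_notMem_tsupport hx])
  have hi3 : Integrable fun x => f x * divergence ξ x :=
    (hf.continuous.mul hdivξ).integrable_of_hasCompactSupport hdivc.mul_left
  have hi4 : Integrable fun x => divergence V x * divergence ξ x :=
    ((continuous_divergence hV).mul hdivξ).integrable_of_hasCompactSupport hdivc.mul_left
  have hIBP := integral_mul_divergence_add_eq_zero hf hξ1 (hasCompactSupport_smul f hξc)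
  rw [integral_add hi3 hi1] at hIBP
  simp_rw [add_mul]
  rw [integral_sub hi1 hi2, integral_trace_fderiv_mul_fderiv hV hξ hξc, integral_add hi3 hi4]
  linarith

theorem fderiv_score_add_logDensityRate (hP : P.Valid) (t : ℝ) {V : E n → E n}
    (hV : Differentiable ℝ V) (x v : E n) :
    fderiv ℝ (fun x => P.score x t (V x) + P.logDensityRate x t) x v =
      fderiv ℝ (fun x => P.score x t) x v (V x) + P.score x t (fderiv ℝ V x v) +
        fderiv ℝ (fun x => P.logDensityRate x t) x v := by
  have h := (((hP.contDiff_score t).differentiable one_ne_zero x).hasFDerivAt.clm_apply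
    (hV x).hasFDerivAt).add
    ((hP.contDiff_logDensityRate t).differentiable one_ne_zero x).hasFDerivAt
  have h' : fderiv ℝ (fun x => P.score x t (V x) + P.logDensityRate x t) x = _ := h.fderiv
  rw [h']
  simp only [add_apply, ContinuousLinearMap.comp_apply, ContinuousLinearMap.flip_apply]
  ring

theorem traceCLM_mul_fderiv_smul (hP : P.Valid) {t : ℝ} (ht : t ∈ Icc (0 : ℝ) 1)
    {η : E n → E n} {x : E n} (hη : DifferentiableAt ℝ η x) (A : E n →L[ℝ] E n) :
    traceCLM n (A * fderiv ℝ (fun y => P.marginalDensity y t • η y) x) =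
      P.marginalDensity x t * (traceCLM n (fderiv ℝ η x * A) + P.score x t (A (η x))) := by
  rw [fderiv_fun_smul ((hP.contDiff_marginalDensity ht).differentiable (by simp) x) hη,
    hP.fderiv_marginalDensity ht, traceCLM_mul_comm, add_mul, smul_mul_clm, map_add, map_smul,
    smul_eq_mul, mul_add]
  have : (P.marginalDensity x t • P.score x t).smulRight (η x) * A =
      ((P.marginalDensity x t • P.score x t).comp A).smulRight (η x) := rfl
  rw [this, traceCLM_smulRight]
  rfl

/-- The first-order coefficient of the first variation, in terms of the residual. -/
theorem integral_stepVariation_deriv (hP : P.Valid) {t : ℝ} (ht : t ∈ Icc (0 : ℝ) 1)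
    {V η : E n → E n} (hV : ContDiff ℝ 1 V) (hη : ContDiff ℝ 2 η) (hc : HasCompactSupport η) :
    ∫ x, (-traceCLM n (fderiv ℝ η x * fderiv ℝ V x) + P.scoreDeriv x (V x) (η x) t)
        ∂(P.marginalLaw t) =
      -∫ x, residual P t V x * divergence (fun y => P.marginalDensity y t • η y) x := by
  have hρ : ContDiff ℝ 2 fun x => P.marginalDensity x t :=
    contDiff_infty.1 (hP.contDiff_marginalDensity ht) 2
  have hVd := hV.differentiable one_ne_zero
  -- Passing from η to ξ = ρ̄η, the terms ∇log ρ̄ · (DV η) from the two summands cancel, and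
  -- symmetry of the Hessian of log ρ̄ exchanges `V` and `η`.
  have hpoint : ∀ x, P.marginalDensity x t *
      (-traceCLM n (fderiv ℝ η x * fderiv ℝ V x) + P.scoreDeriv x (V x) (η x) t) =
      fderiv ℝ (fun x => P.score x t (V x) + P.logDensityRate x t) x
          (P.marginalDensity x t • η x) -
        traceCLM n (fderiv ℝ V x * fderiv ℝ (fun y => P.marginalDensity y t • η y) x) := by
    intro x
    rw [traceCLM_mul_fderiv_smul hP ht (hη.differentiable two_ne_zero x), map_smul, smul_eq_mul,
      fderiv_score_add_logDensityRate hP t hVd, hP.scoreDeriv_eq,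
      fderiv_score_symm hP ht x (V x) (η x)]
    ring
  rw [integral_marginalLaw hP ht, integral_congr_ae (Eventually.of_forall hpoint)]
  have hξ : ContDiff ℝ 2 fun y => P.marginalDensity y t • η y := hρ.smul hη
  have hξc : HasCompactSupport fun y => P.marginalDensity y t • η y :=
    hasCompactSupport_smul _ hc
  have hf : ContDiff ℝ 1 fun x => P.score x t (V x) + P.logDensityRate x t :=
    ((hP.contDiff_score t).clm_apply hV).add (hP.contDiff_logDensityRate t)
  have hres : ∀ x, residual P t V x =
      (P.score x t (V x) + P.logDensityRate x t) + divergence V x := fun x => by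
    rw [residual]
    ring
  simp_rw [hres]
  exact integral_fderiv_sub_trace hf hV hξ hξc

end FirstVariation

/-! ### First-order optimality of one step -/

section Optimality

variable {n : ℕ} {P : Params n} {t : ℝ} {φ : E n → ℝ}

theorem contDiff_eulerStep (hφ : ContDiff ℝ 2 φ) (Δ : ℝ) : ContDiff ℝ 1 (eulerStep φ Δ) :=
  contDiff_id.add ((contDiff_gradient hφ).const_smul Δ)

theorem fderiv_eulerStep (hφ : ContDiff ℝ 2 φ) (Δ : ℝ) (x : E n) :
    fderiv ℝ (eulerStep φ Δ) x = 1 + Δ • fderiv ℝ (gradient φ) x :=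
  ((hasFDerivAt_id x).add
    (((contDiff_gradient hφ).differentiable one_ne_zero x).hasFDerivAt.const_smul Δ)).fderiv

namespace StepAdmissible

theorem hasDerivAt_stepKL (hP : P.Valid) (ht : t ∈ Ico (0 : ℝ) 1) (h : StepAdmissible P t φ)
    {η : E n → E n} (hη : ContDiff ℝ 1 η) (hc : HasCompactSupport η) :
    ∀ᶠ Δ in 𝓝[>] (0 : ℝ), (∀ᶠ ε in 𝓝 (0 : ℝ), stepKL P t φ η Δ ε ≠ ∞) ∧
      HasDerivAt (fun ε => (stepKL P t φ η Δ ε).toReal)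
        (-stepVariation P t (gradient φ) η (t + Δ)) 0 := by
  have hle : ∀ᶠ Δ in 𝓝[>] (0 : ℝ), Δ ∈ Ioo 0 (1 - t) := Ioo_mem_nhdsGT (by linarith [ht.2])
  filter_upwards [h.diffeo, h.finite, hle] with Δ ⟨g, hg, hgl, hgr⟩ hfin hΔ
  have ht' : t ∈ Icc (0 : ℝ) 1 := ⟨ht.1, ht.2.le⟩
  have htΔ : t + Δ ∈ Icc (0 : ℝ) 1 := ⟨by linarith [ht.1, hΔ.1], by linarith [hΔ.2]⟩
  have : IsProbabilityMeasure (densityLaw fun x => P.marginalDensity x t) :=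
    hP.isProbabilityMeasure_marginalLaw ht'
  have : IsProbabilityMeasure (densityLaw fun x => P.marginalDensity x (t + Δ)) :=
    hP.isProbabilityMeasure_marginalLaw htΔ
  have hv : ContDiff ℝ 1 fun x => P.marginalDensity x (t + Δ) :=
    contDiff_infty.1 (hP.contDiff_marginalDensity htΔ) 1
  have key := hasDerivAt_klDiv_perturbation (u := fun x => P.marginalDensity x t)
    (v := fun x => P.marginalDensity x (t + Δ)) (contDiff_eulerStep h.smooth Δ) hg hgl hgr hη hc
    (hP.contDiff_marginalDensity ht').continuous.measurable (hP.marginalDensity_pos ht') hv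
    (hP.marginalDensity_pos htΔ) (by simpa [stepKL, Params.marginalLaw] using hfin)
  refine ⟨key.1, key.2.congr_deriv ?_⟩
  rw [stepVariation]
  congr 1
  refine integral_congr_ae (Eventually.of_forall fun x => ?_)
  simp only
  rw [(hP.hasFDerivAt_log_marginalDensity htΔ _).fderiv, fderiv_eulerStep h.smooth,
    add_sub_cancel_left]
  rfl

/-- Since the variation vanishes at Δ = 0, its quotient by Δ is a difference quotient, whose limit
is the first-order coefficient. -/
theorem tendsto_stepVariation_div (hP : P.Valid) (ht : t ∈ Ico (0 : ℝ) 1)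
    (h : StepAdmissible P t φ) {η : E n → E n} (hη : ContDiff ℝ 2 η)
    (hc : HasCompactSupport η) :
    Tendsto (fun Δ => -stepVariation P t (gradient φ) η (t + Δ) / Δ) (𝓝[>] 0)
      (𝓝 (∫ x, residual P t (gradient φ) x *
        divergence (fun y => P.marginalDensity y t • η y) x)) := by
  have ht' : t ∈ Icc (0 : ℝ) 1 := ⟨ht.1, ht.2.le⟩
  have hη1 : ContDiff ℝ 1 η := hη.of_le (by norm_num)
  have hunit : ∀ᶠ Δ in 𝓝[>] (0 : ℝ), Δ < 1 - t ∧
      ∀ x, IsUnit (1 + Δ • fderiv ℝ (gradient φ) x) := by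
    have hle : ∀ᶠ Δ in 𝓝[>] (0 : ℝ), Δ ∈ Ioo 0 (1 - t) := Ioo_mem_nhdsGT (by linarith [ht.2])
    filter_upwards [h.diffeo, hle] with Δ ⟨g, hg, hgl, hgr⟩ hΔ
    refine ⟨hΔ.2, fun x => ?_⟩
    rw [← fderiv_eulerStep h.smooth]
    exact (isUnit_fderiv_of_inverse ((contDiff_eulerStep h.smooth Δ).differentiable one_ne_zero)
      hg hgl hgr x).1
  obtain ⟨d, hd, hsub⟩ := mem_nhdsGT_iff_exists_Ioc_subset.1 hunit
  rw [mem_Ioi] at hd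
  have hder := hasDerivWithinAt_stepVariation hP (b := t + d) ht.1 (by linarith)
    (by linarith [(hsub ⟨hd, le_rfl⟩).1]) (contDiff_gradient h.smooth) hη1 hc (fun s hs x => by
      rcases hs.1.eq_or_lt with rfl | hlt
      · rw [sub_self, zero_smul_clm, add_zero]
        exact isUnit_one
      · exact (hsub ⟨by linarith, by linarith [hs.2]⟩).2 x)
  rw [integral_stepVariation_deriv hP ht' (contDiff_gradient h.smooth) hη hc,
    hasDerivWithinAt_iff_tendsto_slope] at hder
  have hmap : Tendsto (fun Δ : ℝ => t + Δ) (𝓝[>] 0) (𝓝[Icc t (t + d) \ {t}] t) := by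
    refine tendsto_nhdsWithin_iff.2 ⟨?_, ?_⟩
    · exact ((continuous_const.add continuous_id).tendsto' 0 t (by simp)).mono_left
        nhdsWithin_le_nhds
    · filter_upwards [Ioo_mem_nhdsGT hd] with Δ hΔ
      exact ⟨⟨by linarith [hΔ.1], by linarith [hΔ.2]⟩, by simp [hΔ.1.ne']⟩
  have hlim := (hder.comp hmap).neg
  rw [neg_neg] at hlim
  refine hlim.congr fun Δ => ?_
  rw [Function.comp_apply, slope_def_field, stepVariation_self hP ht' _ hη1 hc, sub_zero,
    add_sub_cancel_left, neg_div]

/-- Uniqueness of derivatives identifies any admissible δ with minus `stepVariation` for small Δ,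
and δ/Δ has a known limit. -/
theorem firstOrderOptimal_iff (hP : P.Valid) (ht : t ∈ Ico (0 : ℝ) 1)
    (h : StepAdmissible P t φ) :
    FirstOrderOptimal P t φ ↔ ∀ η : E n → E n, ContDiff ℝ (⊤ : ℕ∞) η → HasCompactSupport η →
      ∫ x, residual P t (gradient φ) x *
        divergence (fun y => P.marginalDensity y t • η y) x = 0 := by
  constructor
  · intro hopt η hη hc
    obtain ⟨δ, hδ, hlim⟩ := hopt η hη hc
    refine tendsto_nhds_unique
      (h.tendsto_stepVariation_div hP ht (contDiff_infty.1 hη 2) hc) (hlim.congr' ?_)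
    filter_upwards [hδ, h.hasDerivAt_stepKL hP ht (contDiff_infty.1 hη 1) hc] with Δ h1 h2
    rw [h1.2.unique h2.2]
  · intro hall η hη hc
    refine ⟨_, h.hasDerivAt_stepKL hP ht (contDiff_infty.1 hη 1) hc, ?_⟩
    have hlim := h.tendsto_stepVariation_div hP ht (contDiff_infty.1 hη 2) hc
    rwa [hall η hη hc] at hlim

end StepAdmissible

theorem residual_eq_of_integral_mul_divergence (hP : P.Valid) (ht : t ∈ Icc (0 : ℝ) 1)
    {V : E n → E n} (hV : ContDiff ℝ 1 V)
    (h : ∀ η : E n → E n, ContDiff ℝ (⊤ : ℕ∞) η → HasCompactSupport η →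
      ∫ x, residual P t V x * divergence (fun y => P.marginalDensity y t • η y) x = 0)
    (x y : E n) : residual P t V x = residual P t V y := by
  refine eq_of_integral_mul_fderiv_eq_zero (continuous_residual hP t hV)
    (fun ζ hζ hc e => ?_) x y
  have hρ := hP.contDiff_marginalDensity ht
  -- With this field div(ρ̄η) is the derivative of ζ along e, so the residual has vanishing weak
  -- gradient.
  have hη : ContDiff ℝ (⊤ : ℕ∞) fun x => (P.marginalDensity x t)⁻¹ • (ζ x • e) :=
    (hρ.inv fun x => (hP.marginalDensity_pos ht x).ne').smul (hζ.smul contDiff_const)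
  have hηc : HasCompactSupport fun x => (P.marginalDensity x t)⁻¹ • (ζ x • e) :=
    HasCompactSupport.intro hc fun x hx => by
      rw [image_eq_zero_of_notMem_tsupport hx, zero_smul, smul_zero]
  rw [← h _ hη hηc]
  refine integral_congr_ae (Eventually.of_forall fun x => ?_)
  simp only
  have h1 : (fun y => P.marginalDensity y t • (P.marginalDensity y t)⁻¹ • (ζ y • e)) =
      fun y => ζ y • e := by
    funext y
    rw [smul_inv_smul₀ (hP.marginalDensity_pos ht y).ne']
  rw [h1, divergence_smul (hζ.differentiable (by simp) x) (differentiableAt_const e),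
    divergence_eq_traceCLM, fderiv_const_apply, map_zero, mul_zero, zero_add]

/-- The flux of an integrable field through the spheres at infinity vanishes: a constant residual
is zero. -/
theorem eq_zero_of_residual_eq (hP : P.Valid) (ht : t ∈ Icc (0 : ℝ) 1) {V : E n → E n}
    (hV : ContDiff ℝ 1 V) (hVi : Integrable V (P.marginalLaw t)) {c : ℝ}
    (hr : ∀ x, residual P t V x = c) : c = 0 := by
  have hρ : ContDiff ℝ 1 fun x => P.marginalDensity x t :=
    contDiff_infty.1 (hP.contDiff_marginalDensity ht) 1
  have hρV : ContDiff ℝ 1 fun x => P.marginalDensity x t • V x := hρ.smul hV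
  -- Rescaled, this gives cut-offs equal to 1 on balls of radius k + 1 with gradients of size O(1/(k
  -- + 1)).
  let b : ContDiffBump (0 : E n) := ⟨1, 2, one_pos, one_lt_two⟩
  have hb : ContDiff ℝ 1 (b : E n → ℝ) := b.contDiff
  obtain ⟨C, hC⟩ := (hb.continuous_fderiv one_ne_zero).bounded_above_of_compact_support
    (b.hasCompactSupport.fderiv ℝ)
  let R : ℕ → ℝ := fun k => ((k : ℝ) + 1)⁻¹
  have hR0 : ∀ k, 0 < R k := fun k => by positivity
  have hR : Tendsto R atTop (𝓝 0) := tendsto_inv_atTop_zero.comp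
    (tendsto_atTop_add_const_right _ _ tendsto_natCast_atTop_atTop)
  let χ : ℕ → E n → ℝ := fun k x => b (R k • x)
  have hχ : ∀ k, ContDiff ℝ 1 (χ k) := fun k => hb.comp (contDiff_id.const_smul (R k))
  have hχc : ∀ k, HasCompactSupport (χ k) := fun k =>
    b.hasCompactSupport.comp_smul (hR0 k).ne'
  have hχ' : ∀ k x v, fderiv ℝ (χ k) x v = R k * fderiv ℝ b (R k • x) v := by
    intro k x v
    have h1 : HasFDerivAt (fun x : E n => R k • x) (R k • ContinuousLinearMap.id ℝ (E n)) x :=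
      (hasFDerivAt_id x).const_smul (R k)
    have h2 := ((hb.differentiable one_ne_zero (R k • x)).hasFDerivAt.comp x h1).fderiv
    have h3 : fderiv ℝ (χ k) x = _ := h2
    rw [h3]
    simp
  have hdiv : ∀ x, divergence (fun y => P.marginalDensity y t • V y) x =
      P.source x t + P.marginalDensity x t * c := by
    intro x
    have := divergence_sub_source hP ht (hV.differentiable one_ne_zero) x
    rw [hr] at this
    linarith
  obtain ⟨hsi, hs0⟩ := hP.integrable_source ht
  obtain ⟨hρi, hρ1⟩ := hP.integrable_marginalDensity ht
  have hD : Integrable fun x => P.source x t + P.marginalDensity x t * c :=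
    hsi.add (hρi.mul_const c)
  -- The source has integral 0 and ρ̄ has mass 1, so the cut-off integrals of div(ρ̄V) tend to c.
  have hlim1 : Tendsto (fun k => ∫ x, χ k x * (P.source x t + P.marginalDensity x t * c)) atTop
      (𝓝 c) := by
    have hc : ∫ x, (P.source x t + P.marginalDensity x t * c) = c := by
      rw [integral_add hsi (hρi.mul_const c), hs0, integral_mul_const, hρ1]
      ring
    suffices Tendsto (fun k => ∫ x, χ k x * (P.source x t + P.marginalDensity x t * c)) atTop
        (𝓝 (∫ x, (P.source x t + P.marginalDensity x t * c))) by rwa [hc] at this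
    refine tendsto_integral_of_dominated_convergence
      (fun x => ‖P.source x t + P.marginalDensity x t * c‖)
      (fun k => (hχ k).continuous.aestronglyMeasurable.mul hD.aestronglyMeasurable) hD.norm
      (fun k => Eventually.of_forall fun x => ?_) (Eventually.of_forall fun x => ?_)
    · rw [norm_mul, Real.norm_of_nonneg b.nonneg]
      exact mul_le_of_le_one_left (norm_nonneg _) b.le_one
    · have hx : Tendsto (fun k => R k • x) atTop (𝓝 0) := by
        simpa using hR.smul_const x
      have h1 : Tendsto (fun k => χ k x) atTop (𝓝 (b 0)) :=
        (hb.continuous.tendsto 0).comp hx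
      have hb0 : b (0 : E n) = 1 := b.one_of_mem_closedBall (by simp [b])
      rw [hb0] at h1
      simpa using h1.mul_const (P.source x t + P.marginalDensity x t * c)
  have hnorm : Integrable fun x => P.marginalDensity x t * ‖V x‖ :=
    (integrable_marginalLaw_iff hP ht _).1 hVi.norm
  have hlim2 : Tendsto (fun k => ∫ x, χ k x * (P.source x t + P.marginalDensity x t * c)) atTop
      (𝓝 0) := by
    -- Moving the divergence onto the cut-off leaves ρ̄V against a gradient of size at most R k · C;
    -- integrability of ρ̄‖V‖ makes this tend to 0.
    have hle : ∀ k, ‖∫ x, χ k x * (P.source x t + P.marginalDensity x t * c)‖ ≤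
        R k * (C * ∫ x, P.marginalDensity x t * ‖V x‖) := by
      intro k
      have h0 := integral_mul_divergence_add_eq_zero (hχ k) hρV
        (HasCompactSupport.intro (hχc k) fun x hx => by
          rw [image_eq_zero_of_notMem_tsupport hx, zero_smul])
      simp_rw [hdiv] at h0
      have hi1 : Integrable fun x => χ k x * (P.source x t + P.marginalDensity x t * c) := by
        simp_rw [← hdiv]
        exact ((hχ k).continuous.mul (continuous_divergence hρV)).integrable_of_hasCompactSupport
          (hχc k).mul_right
      have hi2 : Integrable fun x => fderiv ℝ (χ k) x (P.marginalDensity x t • V x) :=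
        (((hχ k).continuous_fderiv one_ne_zero).clm_apply
          hρV.continuous).integrable_of_hasCompactSupport
          (HasCompactSupport.intro (hχc k) fun x hx => by
            rw [fderiv_eq_zero_of_notMem_tsupport hx, zero_apply])
      rw [integral_add hi1 hi2] at h0
      rw [eq_neg_of_add_eq_zero_left h0, norm_neg, ← integral_const_mul, ← integral_const_mul]
      refine norm_integral_le_of_norm_le ((hnorm.const_mul C).const_mul (R k))
        (Eventually.of_forall fun x => ?_)
      rw [hχ', norm_mul, Real.norm_of_nonneg (hR0 k).le]
      refine mul_le_mul_of_nonneg_left ?_ (hR0 k).le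
      refine ((fderiv ℝ b (R k • x)).le_of_opNorm_le (hC _) _).trans_eq ?_
      rw [norm_smul, Real.norm_of_nonneg (hP.marginalDensity_pos ht x).le]
    refine squeeze_zero_norm hle ?_
    simpa using hR.mul_const (C * ∫ x, P.marginalDensity x t * ‖V x‖)
  exact tendsto_nhds_unique hlim1 hlim2

/-- A potential solves the Poisson equation if and only if its Euler step is optimal to first
order. -/
theorem StepAdmissible.solvesPoisson_iff_firstOrderOptimal (hP : P.Valid)
    (ht : t ∈ Ico (0 : ℝ) 1) (h : StepAdmissible P t φ) :
    SolvesPoisson P t φ ↔ FirstOrderOptimal P t φ := by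
  have ht' : t ∈ Icc (0 : ℝ) 1 := ⟨ht.1, ht.2.le⟩
  have := hP.isProbabilityMeasure_marginalLaw ht'
  have hV := contDiff_gradient h.smooth
  rw [solvesPoisson_iff hP ht' h.smooth, h.firstOrderOptimal_iff hP ht]
  refine ⟨fun hr η _ _ => by simp [hr], fun hall x => ?_⟩
  have hconst := residual_eq_of_integral_mul_divergence hP ht' hV hall
  -- Here the weighted Sobolev condition enters: a square-integrable gradient is integrable against
  -- a probability law.
  exact eq_zero_of_residual_eq hP ht' hV (h.memH10.memLp_gradient.integrable one_le_two)
    fun y => hconst y x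

end Optimality

end VPFB

end

theorem proposition3 {n : ℕ} (P : VPFB.Params n) (hP : P.Valid) :
    (∀ t ∈ Set.Ico (0 : ℝ) 1, ∀ φ : VPFB.E n → ℝ, VPFB.StepAdmissible P t φ →
      (VPFB.SolvesPoisson P t φ ↔ VPFB.FirstOrderOptimal P t φ)) ∧
    (∀ (Φ : VPFB.E n → ℝ → ℝ) (X : VPFB.E n → ℝ → VPFB.E n), VPFB.IsPotentialFlow P Φ X →
      ((∀ t ∈ Set.Icc (0 : ℝ) 1, VPFB.SolvesPoisson P t fun x => Φ x t) ↔
        ∀ t ∈ Set.Icc (0 : ℝ) 1, VPFB.flowLaw P X t = P.marginalLaw t) ∧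
      ((∀ t ∈ Set.Icc (0 : ℝ) 1, VPFB.SolvesPoisson P t fun x => Φ x t) →
        ∀ t ∈ Set.Icc (0 : ℝ) 1, VPFB.MinimizesKL P X t) ∧
      ((∃ (Ψ : VPFB.E n → ℝ → ℝ) (Y : VPFB.E n → ℝ → VPFB.E n), VPFB.IsPotentialFlow P Ψ Y ∧
          ∀ t ∈ Set.Icc (0 : ℝ) 1, VPFB.SolvesPoisson P t fun x => Ψ x t) →
        (∀ t ∈ Set.Icc (0 : ℝ) 1, VPFB.MinimizesKL P X t) →
        ∀ t ∈ Set.Icc (0 : ℝ) 1, VPFB.SolvesPoisson P t fun x => Φ x t)) := by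
  refine ⟨fun t ht φ h => h.solvesPoisson_iff_firstOrderOptimal hP ht,
    fun Φ X h => ⟨h.solvesPoisson_iff_flowLaw_eq hP,
      fun hsol t ht => h.minimizesKL_of_solvesPoisson hP hsol ht, ?_⟩⟩
  rintro ⟨Ψ, Y, hY, hsol⟩ hmin
  exact h.solvesPoisson_of_minimizesKL hP hY hsol hmin
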